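/- **Setting.** Let $J>0$, $\zeta\in(0,\pi)$ with $\zeta/\pi$ irrational, and $0<h<8J\cos^2(\zeta/2)$. Put $$K(\lambda\mid\eta)=\frac{\sin 2\eta}{2\pi\sinh(\lambda+i\eta)\sinh(\lambda-i\eta)},\qquad K_r(\lambda)=K\big(\lambda\mid\tfrac{(r+1)\zeta}{2}\big)+K\big(\lambda\mid\tfrac{(r-1)\zeta}{2}\big).$$ Let $q>0$ be the endpoint of the Fermi zone and $\varepsilon_1$ the dressed energy: $\varepsilon_1$ is the continuous solution on $\mathbb R$ of $$\varepsilon_1(\lambda)+\int_{-q}^{q}K(\lambda-\mu\mid\zeta)\,\varepsilon_1(\mu)\,d\mu=h-4\pi J\sin(\zeta)\,K(\lambda\mid\tfrac{\zeta}{2}),\qquad\text{with } \varepsilon_1(q)=0.$$ For $r\ge 1$ and $\lambda\in\mathbb C$ let $$\varepsilon_r(\lambda)=rh-4\pi J\sin(\zeta)K(\lambda\mid\tfrac{r\zeta}{2})-\int_{-q}^{q}K_r(\lambda-\mu)\varepsilon_1(\mu)\,d\mu .$$ For a kernel $g$ put $\Theta[g](\lambda)=\lim_{\delta\to0^+}2\pi\int_{\Gamma_\lambda}g(\mu-\delta)\,d\mu$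 with $\Gamma_\lambda=[0,i\,\Im\lambda]\cup[i\,\Im\lambda,\lambda]$, and let $\theta(\cdot\mid\eta)=\Theta[K(\cdot\mid\eta)]$, $\theta_r=\Theta[K_r]$. Let $\widehat\eta=\eta-\pi\lfloor\eta/\pi\rfloor$, $\ell_r=1-r+2\lfloor\frac{r\zeta}{2\pi}\rfloor$, $m_r=2-r-\delta_{r,1}+2\sum_{s=\pm1}\lfloor\zeta\frac{r+s}{2\pi}\rfloor$, $\mathcal A_{r,s}=\{\lambda:\frac{\pi}{2}\ge|\Im\lambda|\ge\min(\widehat{\tfrac{r+s}{2}\zeta},\,\pi-\widehat{\tfrac{r+s}{2}\zeta})\}$ and $p_F=p_1(q)$. The dressed momenta are, for $-\frac\pi2<\Im\lambda\le\frac\pi2$, $$p_r(\lambda)=\theta(\lambda\mid\tfrac{r\zeta}{2})-\int_{-q}^{q}\theta_r(\lambda-\mu)\,p_1'(\mu)\frac{d\mu}{2\pi}+\pi\ell_r-p_Fm_r-2p_F\sum_{s=\pm1}(1-\delta_{s,-1}\delta_{r,1})\,\mathrm{sgn}\big(1-\tfrac2\pi\widehat{\tfrac{r+s}{2}\zeta}\big)\mathbf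 1_{\mathcal A_{r,s}}(\lambda),$$ extended $i\pi$-periodically to $\mathbb C$; here $p_1$ on $\mathbb R$ is the $C^1$ solution of the equation given by $r=1$. For real $v\ne0$ put $$u_r(\lambda,v)=p_r(\lambda)-\frac1v\,\varepsilon_r(\lambda),\qquad v_\infty=\frac{8\pi J\sin\zeta-2\cos\zeta\int_{-q}^{q}\sinh(2\mu)\varepsilon_1'(\mu)\,d\mu}{2\pi-2\cos\zeta\int_{-q}^{q}\cosh(2\mu)p_1'(\mu)\,d\mu}.$$ **Strings.** The set $\mathfrak N_{\rm st}\subset\{2,3,\dots\}$ and the parities $\sigma_r\in\{0,1\}$ are as follows. * If $\frac\pi2<\zeta<\pi$: $r\in\mathfrak N_{\rm st}$ with parity $\sigma_r$ iff $(-1)^{\sigma_r}\sin(k\zeta)\sin((r-k)\zeta)>0$ for $k=1,\dots,r-1$. * If $0<\zeta<\frac\pi2$: let $\kappa_r=\lfloor(r-1)\frac\zeta\pi\rfloor$ and $w_p=\lfloor(p-\frac{\kappa_r}{2}+(r-1)\frac{\zeta}{2\pi})\frac{\pi}{\zeta}\rfloor$. Then $r\in\mathfrak N_{\rm st}$ iff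 $(-1)^{\kappa_r}\sin\big(\frac{\pi\zeta}{\pi-\zeta}(k-p)\big)\sin\big(\frac{\pi\zeta}{\pi-\zeta}(r-k+p-\kappa_r-1)\big)>0$ for all integers $p\ge0$ and $1\le k\le r-2$ with $w_p+1\le k\le w_{p+1}-1$, and $\sigma_r\equiv\kappa_r$ mod $2$. Put $\mathfrak N=\{1\}\cup\mathfrak N_{\rm st}$. **Lemma.** For each $r\in\mathfrak N$ there are real numbers $0<v_r^{(m)}<v_\infty<v_r^{(M)}$ such that the following holds. All functions of $\lambda\in\mathbb R$ below are differentiated along the real direction; the functions $u_r$ in question are differentiable there, and for $r=1$ the derivatives are real. 1. If $|v|>v_r^{(M)}$, then for every $\lambda\in\mathbb R$ $$\big|\partial_\lambda u_r(\lambda+i\sigma_r\tfrac\pi2,v)\big|>0\ \text{ if } r\in\mathfrak N_{\rm st},\qquad \min\Big(\partial_\lambda u_1(\lambda,v),\,-\partial_\lambda u_1(\lambda+i\tfrac\pi2,v)\Big)>0\ \text{ if } r=1 .$$ 2. If $0<|v|<v_r^{(m)}$, then $\lambda\mapsto\partial_\lambda u_r(\lambda+i\sigma_r\frac\pi2,v)$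 has exactly one zero on $\mathbb R$ if $r\in\mathfrak N_{\rm st}$; for $r=1$, each of $\lambda\mapsto\partial_\lambda u_1(\lambda,v)$ and $\lambda\mapsto\partial_\lambda u_1(\lambda+i\frac\pi2,v)$ has exactly one zero on $\mathbb R$. -/

import Mathlib

noncomputable section

namespace XXZ

open Complex Filter Topology

/-- The kernel `K(z ∣ η) = sin(2η) / (2π sinh(z + iη) sinh(z - iη))`. -/
def K (η : ℝ) (z : ℂ) : ℂ :=
  (Real.sin (2 * η) : ℂ) / (2 * (Real.pi : ℂ) * (sinh (z + I * η) * sinh (z - I * η)))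

/-- The `r`-string kernel `K_r(z) = K(z ∣ (r+1)ζ/2) + K(z ∣ (r-1)ζ/2)`.
For `r = 1` it is `K(z ∣ ζ)`, because `K(· ∣ 0) = 0`. -/
def Kstring (ζ : ℝ) (r : ℕ) (z : ℂ) : ℂ :=
  K (((r : ℝ) + 1) * ζ / 2) z + K (((r : ℝ) - 1) * ζ / 2) z

/-- `2π ∫_{Γ_z} g(μ - 0⁺) dμ`, where `Γ_z` is the path `[0, i Im z] ∪ [i Im z, z]`; the poles of `g`
on the imaginary axis are thus passed on their left. -/
def barePhase (g : ℂ → ℂ) (z : ℂ) : ℂ :=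
  2 * (Real.pi : ℂ) * limUnder (𝓝[>] (0 : ℝ)) (fun δ : ℝ =>
    (∫ t in (0 : ℝ)..z.im, g (t * I - δ) * I) + ∫ s in (0 : ℝ)..z.re, g (s + z.im * I - δ))

/-- `f` is the dressed energy `ε(· ∣ Q)` for coupling `J` and magnetic field `h`: the continuous
solution of
`ε(x) + ∫_{-Q}^{Q} K(x - μ ∣ ζ) ε(μ) dμ = h - 4πJ sin(ζ) K(x ∣ ζ/2)`. -/
def IsDressedEnergy (ζ J h Q : ℝ) (f : ℝ → ℝ) : Prop :=
  Continuous f ∧ ∀ x : ℝ,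
    (f x : ℂ) + ∫ μ in (-Q)..Q, K ζ ((x : ℂ) - μ) * (f μ : ℂ)
      = h - 4 * Real.pi * J * Real.sin ζ * K (ζ / 2) x

/-- The dressed energy `ε_r` of an `r`-string, on `ℂ`, built from `ε₁` on `[-q, q]`. -/
def dressedEnergy (ζ J h q : ℝ) (ε₁ : ℝ → ℝ) (r : ℕ) (z : ℂ) : ℂ :=
  r * h - 4 * Real.pi * J * Real.sin ζ * K ((r : ℝ) * ζ / 2) z
    - ∫ μ in (-q)..q, Kstring ζ r (z - μ) * (ε₁ μ : ℂ)

/-- `η - π ⌊η / π⌋`. -/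
def hatAngle (η : ℝ) : ℝ := η - Real.pi * (⌊η / Real.pi⌋ : ℝ)

/-- The integer `ℓ_r(ζ)`. -/
def ell (ζ : ℝ) (r : ℕ) : ℤ := 1 - r + 2 * ⌊(r : ℝ) * ζ / (2 * Real.pi)⌋

/-- The integer `m_r(ζ)`. -/
def emm (ζ : ℝ) (r : ℕ) : ℤ :=
  2 - r - (if r = 1 then 1 else 0)
    + 2 * (⌊ζ * ((r : ℝ) + 1) / (2 * Real.pi)⌋ + ⌊ζ * ((r : ℝ) - 1) / (2 * Real.pi)⌋)

/-- The set `𝒜_{r,s}`, for `s = ±1`. -/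
def stripSet (ζ : ℝ) (r : ℕ) (s : ℤ) : Set ℂ :=
  {z | |z.im| ≤ Real.pi / 2 ∧
    min (hatAngle (((r : ℝ) + s) / 2 * ζ)) (Real.pi - hatAngle (((r : ℝ) + s) / 2 * ζ)) ≤ |z.im|}

/-- The expression of the dressed momentum `p_r` in the strip `|Im z| ≤ π/2`, in terms of the
restriction `p₁` of the `1`-string momentum to the real axis; `p₁ q` is the Fermi momentum. -/
def stripMomentum (ζ q : ℝ) (p₁ : ℝ → ℝ) (r : ℕ) (z : ℂ) : ℂ :=
  barePhase (K ((r : ℝ) * ζ / 2)) z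
    - (∫ μ in (-q)..q, barePhase (Kstring ζ r) (z - μ) * ((deriv p₁ μ : ℝ) : ℂ)) / (2 * Real.pi)
    + Real.pi * (ell ζ r : ℂ) - (p₁ q : ℂ) * (emm ζ r : ℂ)
    - 2 * (p₁ q : ℂ) * ∑ s ∈ ({1, -1} : Finset ℤ),
        (if s = -1 ∧ r = 1 then (0 : ℂ) else 1)
          * (Real.sign (1 - 2 / Real.pi * hatAngle (((r : ℝ) + s) / 2 * ζ)) : ℂ)
          * (stripSet ζ r s).indicator (fun _ => (1 : ℂ)) z

/-- The representative of `z` modulo `iπ` with imaginary part in `(-π/2, π/2]`. -/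
def stripRep (z : ℂ) : ℂ :=
  ⟨z.re, toIocMod Real.pi_pos (-(Real.pi / 2)) z.im⟩

/-- The dressed momentum `p_r` of an `r`-string, extended to `ℂ` by `iπ`-periodicity. -/
def dressedMomentum (ζ q : ℝ) (p₁ : ℝ → ℝ) (r : ℕ) (z : ℂ) : ℂ :=
  stripMomentum ζ q p₁ r (stripRep z)

/-- `f` is the dressed momentum `p₁` on the real axis: the continuously differentiable solution of
the linear integro-differential equation which is the case `r = 1` of the formula for `p_r`. -/
def IsDressedMomentum (ζ q : ℝ) (f : ℝ → ℝ) : Prop :=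
  ContDiff ℝ 1 f ∧ ∀ x : ℝ, (f x : ℂ) = dressedMomentum ζ q f 1 x

/-- `u_r(z, v) = p_r(z) - ε_r(z) / v`. -/
def u (ζ J h q : ℝ) (ε₁ p₁ : ℝ → ℝ) (r : ℕ) (z : ℂ) (v : ℝ) : ℂ :=
  dressedMomentum ζ q p₁ r z - dressedEnergy ζ J h q ε₁ r z / v

/-- The function `x ↦ u_r(x + iσπ/2, v)` of the real variable `x`. -/
def uLine (ζ J h q : ℝ) (ε₁ p₁ : ℝ → ℝ) (r σ : ℕ) (v x : ℝ) : ℂ :=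
  u ζ J h q ε₁ p₁ r (x + I * σ * Real.pi / 2) v

/-- The velocity `v_∞`. -/
def vInfty (ζ J q : ℝ) (ε₁ p₁ : ℝ → ℝ) : ℝ :=
  (8 * Real.pi * J * Real.sin ζ
      - 2 * Real.cos ζ * ∫ μ in (-q)..q, Real.sinh (2 * μ) * deriv ε₁ μ)
    / (2 * Real.pi - 2 * Real.cos ζ * ∫ μ in (-q)..q, Real.cosh (2 * μ) * deriv p₁ μ)

/-- `κ_r = ⌊(r-1)ζ/π⌋`. -/
def kappa (ζ : ℝ) (r : ℕ) : ℕ := ⌊((r : ℝ) - 1) * ζ / Real.pi⌋₊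

/-- `w_p = ⌊(p - κ_r/2 + (r-1)ζ/(2π)) π/ζ⌋`. -/
def wIndex (ζ : ℝ) (r : ℕ) (p : ℕ) : ℤ :=
  ⌊((p : ℝ) - (kappa ζ r : ℝ) / 2 + ((r : ℝ) - 1) * (ζ / (2 * Real.pi))) * (Real.pi / ζ)⌋

/-- Existence of `r`-strings of parity `σ`, i.e. centred on `ℝ + iσπ/2`, for `0 < ζ < π/2`;
the parity is that of `κ_r`. -/
def StringCondLow (ζ : ℝ) (r σ : ℕ) : Prop :=
  σ = kappa ζ r % 2 ∧
  ∀ k : ℕ, 1 ≤ k → k + 2 ≤ r → ∀ p : ℕ,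
    wIndex ζ r p + 1 ≤ (k : ℤ) → (k : ℤ) ≤ wIndex ζ r (p + 1) - 1 →
    0 < (-1 : ℝ) ^ kappa ζ r
      * Real.sin (Real.pi * ζ / (Real.pi - ζ) * ((k : ℝ) - p))
      * Real.sin (Real.pi * ζ / (Real.pi - ζ) * ((r : ℝ) - k + p - kappa ζ r - 1))

/-- Existence of `r`-strings of parity `σ`, i.e. centred on `ℝ + iσπ/2`, for `π/2 < ζ < π`. -/
def StringCondHigh (ζ : ℝ) (r σ : ℕ) : Prop :=
  (σ = 0 ∨ σ = 1) ∧
  ∀ k : ℕ, 1 ≤ k → k + 1 ≤ r →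
    0 < (-1 : ℝ) ^ σ * Real.sin (k * ζ) * Real.sin (((r : ℝ) - k) * ζ)

/-- `r ∈ 𝔑_st` and `σ = σ_r`: bound states of length `r ≥ 2` exist, with string parity `σ`. -/
def IsString (ζ : ℝ) (r σ : ℕ) : Prop :=
  2 ≤ r ∧ ((0 < ζ ∧ ζ < Real.pi / 2 ∧ StringCondLow ζ r σ) ∨
    (Real.pi / 2 < ζ ∧ ζ < Real.pi ∧ StringCondHigh ζ r σ))

end XXZ

end

/-!
On the two lines `ℝ` and `ℝ + iπ/2` the kernel `K(· ∣ η)` is the Poisson kernel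
`poisson (π/2) D` of a strip of half-width `π/2`, at a height `D` which is affine in `η`
(`XXZ.K_line`). Hence, along the line attached to an `r`-string, the derivative of `u_r(·, v)` is
`N - E / v`, where the real functions `N` and `E` are one and the same dressing operation
`XXZ.dressedLine`, at one and the same height `D`, applied to `p₁'` and `ε₁'`
(`XXZ.uLine_hasDerivAt`). For `ε₁'` this uses `ε₁(±q) = 0`, which removes the boundary terms of an
integration by parts.

*Signs.* The Poisson kernel has Fourier transform `sinh(kD) / sinh(kπ/2)` (`XXZ.ft_poisson`). If
`|D| < (π-ζ)/2`, then comparing Fourier transforms shows that the dressed quantity on the line is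
the convolution of the Poisson kernel of height `D` in the narrower strip of half-width `(π-ζ)/2`
with the part of `p₁'`, respectively `ε₁'`, *outside* the Fermi zone
(`XXZ.dressedLine_eq_conv_cutOut`). So the sign on the line follows from the sign on the real axis:
`p₁' > 0`, and `ε₁'` is odd and positive on `(0, ∞)`. These two facts follow by a contraction
argument from positive kernels that decrease away from the origin
(`XXZ.dressedMomentumDensity_pos`, `XXZ.dressedEnergyDeriv_ge`); for `ζ < π/2` the dressing equation
has to be inverted first (`XXZ.IsDressed.eq_add_conv_conv`). The remaining heights
`-ζ/2 ≤ D ≤ -(π-ζ)/2` occur for `ζ > π/2` and are immediate, since there all kernels have a sign.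
The string conditions enter only through `XXZ.IsString.isLineHeight`: they say that the line of an
`r`-string has, modulo `π`, one of these heights.

*The ratio.* Consequently `F = E / N` is odd, `F'(0) > 0` and `F` has no zero besides the origin. At
infinity both `N` and `E` are `sin(2D) e^{-2x}` times an amplitude independent of the line, up to
`O(e^{-4x})` (`XXZ.dressedLine_asymptotics`); irrationality of `ζ/π` gives `sin(2D) ≠ 0`. Therefore
`F` tends to the ratio of the two amplitudes, which is `v_∞` (`XXZ.vInfty_eq`), and both amplitudes
are positive. Such a function is bounded and takes every sufficiently small value exactly once
(`XXZ.exists_thresholds`). As `N - E / v` vanishes exactly where `F = v`, and has the constant sign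
of `N` once `|v|` exceeds the bound of `|F|`, this is the claim.
-/

namespace XXZ

open Real MeasureTheory Filter Topology

open scoped FourierTransform Convolution

/-! ### Poisson kernels of a strip -/

/-- The Poisson kernel, at height `D`, of a strip of half-width `M`:
`sin(πD/M) / (2M (cosh(πx/M) + cos(πD/M)))`. For `|D| < M` its Fourier transform is
`sinh(kD) / sinh(kM)`. -/
noncomputable def poisson (M D x : ℝ) : ℝ :=
  sin (π * D / M) / (2 * M * (cosh (π * x / M) + cos (π * D / M)))

/-- The derivative of `poisson M D`. -/
noncomputable def poissonDeriv (M D x : ℝ) : ℝ :=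
  -(sin (π * D / M) * (π / M) * sinh (π * x / M)) /
    (2 * M * (cosh (π * x / M) + cos (π * D / M)) ^ 2)

lemma cos_angle_gt {M D : ℝ} (hD : |D| < M) : -1 < cos (π * D / M) := by
  have hM : 0 < M := (abs_nonneg D).trans_lt hD
  have h1 : |π * D / M| < π := by
    rw [abs_div, abs_mul, abs_of_pos pi_pos, abs_of_pos hM, div_lt_iff₀ hM]
    gcongr
  rw [← cos_abs, ← cos_pi]
  exact cos_lt_cos_of_nonneg_of_le_pi (abs_nonneg _) le_rfl h1

lemma sin_angle_pos {M D : ℝ} (hD : 0 < D) (hDM : D < M) : 0 < sin (π * D / M) := by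
  have hM : 0 < M := hD.trans hDM
  apply sin_pos_of_pos_of_lt_pi (by positivity)
  rw [div_lt_iff₀ hM]
  gcongr

/-- Where `poisson M D` could be singular, its numerator vanishes. -/
lemma sin_eq_zero_or_denom_pos (a y : ℝ) : sin a = 0 ∨ 0 < cosh y + cos a := by
  by_cases h : sin a = 0
  · exact Or.inl h
  · right
    have h2 : cos a ≠ -1 := fun hc => h (by nlinarith [sin_sq_add_cos_sq a])
    have h3 : -1 < cos a := lt_of_le_of_ne (neg_one_le_cos a) (Ne.symm h2)
    linarith [one_le_cosh y]

lemma poisson_contDiff (M D : ℝ) : ContDiff ℝ ⊤ (poisson M D) := by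
  unfold poisson
  by_cases hM : M = 0
  · simp [hM]; fun_prop
  by_cases h : sin (π * D / M) = 0
  · simp only [h, zero_div]; fun_prop
  refine ContDiff.div (by fun_prop) ?_ ?_
  · have : ContDiff ℝ ⊤ fun x : ℝ => cosh (π * x / M) := contDiff_cosh.comp (by fun_prop)
    fun_prop
  · intro x
    have := (sin_eq_zero_or_denom_pos (π * D / M) (π * x / M)).resolve_left h
    positivity

lemma poisson_hasDerivAt (M D x : ℝ) : HasDerivAt (poisson M D) (poissonDeriv M D x) x := by
  unfold poisson poissonDeriv
  by_cases hM : M = 0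
  · simp [hM]; exact hasDerivAt_const _ _
  by_cases h : sin (π * D / M) = 0
  · simp only [h, zero_div, zero_mul, neg_zero]; exact hasDerivAt_const _ _
  have h0 := (sin_eq_zero_or_denom_pos (π * D / M) (π * x / M)).resolve_left h
  have h1 : HasDerivAt (fun x : ℝ => π * x / M) (π / M) x := by
    simpa using ((hasDerivAt_id x).const_mul π).div_const M
  have h2 := ((h1.cosh.add_const (cos (π * D / M))).const_mul (2 * M))
  have h3 := (hasDerivAt_const x (sin (π * D / M))).div h2 (by positivity)
  refine HasDerivAt.congr_deriv h3 ?_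
  have hne := h0.ne'
  rw [div_eq_div_iff (by positivity) (by positivity)]
  ring

lemma deriv_poisson (M D : ℝ) : deriv (poisson M D) = poissonDeriv M D :=
  funext fun x => (poisson_hasDerivAt M D x).deriv

lemma poissonDeriv_contDiff (M D : ℝ) : ContDiff ℝ ⊤ (poissonDeriv M D) := by
  rw [← deriv_poisson]
  exact (contDiff_succ_iff_deriv (n := ⊤)).1 (by simpa using poisson_contDiff M D) |>.2.2

lemma poisson_continuous (M D : ℝ) : Continuous (poisson M D) := (poisson_contDiff M D).continuous

lemma poissonDeriv_continuous (M D : ℝ) : Continuous (poissonDeriv M D) :=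
  (poissonDeriv_contDiff M D).continuous

lemma poisson_neg (M D x : ℝ) : poisson M D (-x) = poisson M D x := by
  simp [poisson, neg_div]

lemma poisson_neg_height (M D x : ℝ) : poisson M (-D) x = -poisson M D x := by
  simp [poisson, neg_div]

lemma poissonDeriv_neg (M D x : ℝ) : poissonDeriv M D (-x) = -poissonDeriv M D x := by
  simp [poissonDeriv, neg_div]

lemma poissonDeriv_neg_height (M D x : ℝ) : poissonDeriv M (-D) x = -poissonDeriv M D x := by
  simp [poissonDeriv, neg_div]

lemma poisson_zero_height (M x : ℝ) : poisson M 0 x = 0 := by simp [poisson]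

lemma poisson_self_height {M : ℝ} (hM : 0 < M) (x : ℝ) : poisson M M x = 0 := by
  simp [poisson, hM.ne']

lemma exists_mul_cosh_le {a : ℝ} (h : -1 < cos a) :
    ∃ c : ℝ, 0 < c ∧ ∀ y : ℝ, c * cosh y ≤ cosh y + cos a := by
  refine ⟨min 1 (1 + cos a), lt_min one_pos (by linarith), fun y => ?_⟩
  have h1 := one_le_cosh y
  rcases le_total 0 (cos a) with hc | hc
  · have : min 1 (1 + cos a) * cosh y ≤ 1 * cosh y := by
      gcongr; exact min_le_left _ _
    linarith
  · have : min 1 (1 + cos a) * cosh y ≤ (1 + cos a) * cosh y := by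
      gcongr; exact min_le_right _ _
    nlinarith

lemma denom_ge {M D : ℝ} (hD : |D| < M) :
    ∃ c : ℝ, 0 < c ∧ ∀ x : ℝ, c * cosh (π * x / M) ≤ cosh (π * x / M) + cos (π * D / M) := by
  obtain ⟨c, hc, h⟩ := exists_mul_cosh_le (cos_angle_gt hD)
  exact ⟨c, hc, fun x => h _⟩

lemma denom_pos {M D : ℝ} (hD : |D| < M) (x : ℝ) : 0 < cosh (π * x / M) + cos (π * D / M) := by
  linarith [cos_angle_gt hD, one_le_cosh (π * x / M)]

lemma poisson_pos {M D : ℝ} (hD : 0 < D) (hDM : D < M) (x : ℝ) : 0 < poisson M D x := by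
  have hM : 0 < M := hD.trans hDM
  have := denom_pos (M := M) (D := D) (by rwa [abs_of_pos hD]) x
  have := sin_angle_pos hD hDM
  unfold poisson; positivity

lemma poisson_nonneg {M D : ℝ} (hD : 0 ≤ D) (hDM : D < M) (x : ℝ) : 0 ≤ poisson M D x := by
  rcases hD.eq_or_lt with h | h
  · simp [← h, poisson_zero_height]
  · exact (poisson_pos h hDM x).le

lemma poisson_sub_add (M D x y : ℝ) (h : sin (π * D / M) ≠ 0) (hM : M ≠ 0) :
    poisson M D (x - y) - poisson M D (x + y) = sin (π * D / M) / M *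
      (sinh (π * x / M) * sinh (π * y / M)) /
      ((cosh (π * (x - y) / M) + cos (π * D / M)) *
        (cosh (π * (x + y) / M) + cos (π * D / M))) := by
  have h0 := (sin_eq_zero_or_denom_pos (π * D / M) (π * (x - y) / M)).resolve_left h
  have h1 := (sin_eq_zero_or_denom_pos (π * D / M) (π * (x + y) / M)).resolve_left h
  have e0 : cosh (π * (x - y) / M) = cosh (π * x / M) * cosh (π * y / M)
      - sinh (π * x / M) * sinh (π * y / M) := by rw [← cosh_sub]; congr 1; ring
  have e1 : cosh (π * (x + y) / M) = cosh (π * x / M) * cosh (π * y / M)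
      + sinh (π * x / M) * sinh (π * y / M) := by rw [← cosh_add]; congr 1; ring
  unfold poisson
  rw [div_sub_div _ _ (by positivity) (by positivity), div_eq_div_iff (by positivity)
    (by positivity)]
  have : cosh (π * (x + y) / M) - cosh (π * (x - y) / M)
      = 2 * (sinh (π * x / M) * sinh (π * y / M)) := by rw [e0, e1]; ring
  have : sinh (π * x / M) * sinh (π * y / M)
      = (cosh (π * (x + y) / M) - cosh (π * (x - y) / M)) / 2 := by rw [this]; ring
  rw [this]
  field_simp
  ring

/-- `poisson M D` with `0 ≤ D < M` is even and nonincreasing away from the origin. -/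
lemma poisson_add_le_sub {M D : ℝ} (hD : 0 ≤ D) (hDM : D < M) {x y : ℝ} (hx : 0 < x)
    (hy : 0 < y) : poisson M D (x + y) ≤ poisson M D (x - y) := by
  rcases hD.eq_or_lt with h | h
  · simp [← h, poisson_zero_height]
  have hM : 0 < M := h.trans hDM
  have hs := sin_angle_pos h hDM
  have h0 := denom_pos (M := M) (D := D) (by rwa [abs_of_pos h]) (x - y)
  have h1 := denom_pos (M := M) (D := D) (by rwa [abs_of_pos h]) (x + y)
  have h2 : 0 < sinh (π * x / M) := sinh_pos_iff.2 (by positivity)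
  have h3 : 0 < sinh (π * y / M) := sinh_pos_iff.2 (by positivity)
  have := poisson_sub_add M D x y hs.ne' hM.ne'
  have h4 : 0 ≤ poisson M D (x - y) - poisson M D (x + y) := by rw [this]; positivity
  linarith

lemma integrable_inv_cosh {a : ℝ} (ha : a ≠ 0) : Integrable fun x : ℝ => (cosh (a * x))⁻¹ := by
  have h : Integrable fun x : ℝ => (cosh x)⁻¹ := by
    refine (integrable_inv_one_add_sq.const_mul 2).mono'
      ((continuous_cosh.inv₀ fun x => (cosh_pos x).ne').aestronglyMeasurable)
      (Eventually.of_forall fun x => ?_)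
    have h1 : 1 + x ^ 2 / 2 ≤ cosh x := by
      have h5 : cosh x = 2 * sinh (x / 2) ^ 2 + 1 := by
        have := cosh_two_mul (x / 2)
        rw [show 2 * (x / 2) = x by ring, Real.cosh_sq] at this
        linarith
      have h6 : (x / 2) ^ 2 ≤ sinh (x / 2) ^ 2 := by
        rw [sq_le_sq, abs_sinh]
        exact self_le_sinh_iff.2 (abs_nonneg _)
      nlinarith
    rw [norm_inv, norm_of_nonneg (cosh_pos x).le, ← div_eq_mul_inv,
      inv_le_comm₀ (cosh_pos x) (by positivity)]
    rw [inv_div]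
    linarith
  exact h.comp_mul_left' ha

lemma norm_poisson_le {M D : ℝ} (hD : |D| < M) :
    ∃ C : ℝ, 0 < C ∧ ∀ x, |poisson M D x| ≤ C * (cosh (π / M * x))⁻¹ := by
  have hM : 0 < M := (abs_nonneg D).trans_lt hD
  obtain ⟨c, hc, h⟩ := denom_ge hD
  refine ⟨1 / (2 * M * c), by positivity, fun x => ?_⟩
  have h0 := denom_pos hD x
  rw [poisson, abs_div, abs_of_pos (show 0 < 2 * M * (cosh (π * x / M) + cos (π * D / M)) by
    positivity), ← div_eq_mul_inv, div_div, show π / M * x = π * x / M by ring]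
  have hcc := cosh_pos (π * x / M)
  apply div_le_div₀ zero_le_one (abs_sin_le_one _) (by positivity)
  have := h x
  nlinarith

lemma norm_poissonDeriv_le {M D : ℝ} (hD : |D| < M) :
    ∃ C : ℝ, 0 < C ∧ ∀ x, |poissonDeriv M D x| ≤ C * (cosh (π / M * x))⁻¹ := by
  have hM : 0 < M := (abs_nonneg D).trans_lt hD
  obtain ⟨c, hc, h⟩ := denom_ge hD
  refine ⟨π / (2 * M * M * c ^ 2), by positivity, fun x => ?_⟩
  have h0 := denom_pos hD x
  have hcc := cosh_pos (π * x / M)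
  rw [poissonDeriv, abs_div, abs_neg, abs_mul, abs_mul, abs_of_pos (show 0 < 2 * M *
    (cosh (π * x / M) + cos (π * D / M)) ^ 2 by positivity), ← div_eq_mul_inv, div_div,
    show π / M * x = π * x / M by ring, abs_of_pos (show 0 < π / M by positivity), abs_sinh]
  have h1 : sinh |π * x / M| ≤ cosh (π * x / M) := by
    rw [← cosh_abs]; exact (sinh_lt_cosh _).le
  have h2 : 0 ≤ sinh |π * x / M| := sinh_nonneg_iff.2 (abs_nonneg _)
  have h3 := abs_sin_le_one (π * D / M)
  calc |sin (π * D / M)| * (π / M) * sinh |π * x / M| /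
        (2 * M * (cosh (π * x / M) + cos (π * D / M)) ^ 2)
      ≤ 1 * (π / M) * cosh (π * x / M) / (2 * M * (c * cosh (π * x / M)) ^ 2) := by
        gcongr
        exact h x
    _ = π / (2 * M * M * c ^ 2 * cosh (π * x / M)) := by field_simp

lemma poisson_integrable {M D : ℝ} (hD : |D| < M) : Integrable (poisson M D) := by
  have hM : 0 < M := (abs_nonneg D).trans_lt hD
  obtain ⟨C, hC, h⟩ := norm_poisson_le hD
  exact ((integrable_inv_cosh (by positivity)).const_mul C).mono'
    (poisson_continuous M D).aestronglyMeasurable (Eventually.of_forall h)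

lemma poissonDeriv_integrable {M D : ℝ} (hD : |D| < M) : Integrable (poissonDeriv M D) := by
  have hM : 0 < M := (abs_nonneg D).trans_lt hD
  obtain ⟨C, hC, h⟩ := norm_poissonDeriv_le hD
  exact ((integrable_inv_cosh (by positivity)).const_mul C).mono'
    (poissonDeriv_continuous M D).aestronglyMeasurable (Eventually.of_forall h)

lemma poisson_bounded {M D : ℝ} (hD : |D| < M) : ∃ C : ℝ, 0 < C ∧ ∀ x, |poisson M D x| ≤ C := by
  obtain ⟨C, hC, h⟩ := norm_poisson_le hD
  refine ⟨C, hC, fun x => (h x).trans ?_⟩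
  exact mul_le_of_le_one_right hC.le (inv_le_one_of_one_le₀ (one_le_cosh _))

lemma poissonDeriv_bounded {M D : ℝ} (hD : |D| < M) :
    ∃ C : ℝ, 0 < C ∧ ∀ x, |poissonDeriv M D x| ≤ C := by
  obtain ⟨C, hC, h⟩ := norm_poissonDeriv_le hD
  refine ⟨C, hC, fun x => (h x).trans ?_⟩
  exact mul_le_of_le_one_right hC.le (inv_le_one_of_one_le₀ (one_le_cosh _))

lemma integral_poisson_of_pos {M D : ℝ} (hD : 0 < D) (hDM : D < M) :
    ∫ x, poisson M D x = D / M := by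
  have hM : 0 < M := hD.trans hDM
  have hs := sin_angle_pos hD hDM
  set a := π * D / M with ha
  have hda : ∀ x, HasDerivAt (fun x : ℝ => (1 / π) * arctan ((exp (π * x / M) + cos a) / sin a))
      (poisson M D x) x := by
    intro x
    have h1 : HasDerivAt (fun x : ℝ => π * x / M) (π / M) x := by
      simpa using ((hasDerivAt_id x).const_mul π).div_const M
    have h2 := ((h1.exp.add_const (cos a)).div_const (sin a)).arctan.const_mul (1 / π)
    refine HasDerivAt.congr_deriv h2 (Eq.symm ?_)
    have h3 := denom_pos (M := M) (D := D) (by rwa [abs_of_pos hD]) x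
    rw [show poisson M D x = sin a / (2 * M * (cosh (π * x / M) + cos a)) from rfl]
    rw [← ha] at h3
    set E := exp (π * x / M) with hE
    have hEp : 0 < E := exp_pos _
    have h4 : cosh (π * x / M) = (E + E⁻¹) / 2 := by rw [cosh_eq, ← hE, exp_neg]
    rw [h4] at h3 ⊢
    have h5 : 1 + ((E + cos a) / sin a) ^ 2 = 2 * E * ((E + E⁻¹) / 2 + cos a) / sin a ^ 2 := by
      field_simp
      nlinarith [sin_sq_add_cos_sq a]
    rw [h5]
    field_simp
  have hbot : Tendsto (fun x : ℝ => (1 / π) * arctan ((exp (π * x / M) + cos a) / sin a)) atBot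
      (𝓝 ((1 / π) * (π / 2 - a))) := by
    have h1 : Tendsto (fun x : ℝ => exp (π * x / M)) atBot (𝓝 0) := by
      refine tendsto_exp_atBot.comp ?_
      have : Tendsto (fun x : ℝ => (π / M) * x) atBot atBot :=
        tendsto_id.const_mul_atBot (by positivity)
      exact this.congr fun x => by ring
    have h2 := ((h1.add_const (cos a)).div_const (sin a))
    have h3 := ((continuous_arctan.tendsto _).comp h2).const_mul (1 / π)
    have h4 : arctan ((0 + cos a) / sin a) = π / 2 - a := by
      rw [zero_add, ← arctan_tan (x := π / 2 - a), tan_pi_div_two_sub, tan_eq_sin_div_cos, inv_div]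
      · have : a < π := by rw [ha, div_lt_iff₀ hM]; gcongr
        linarith
      · have : 0 < a := by positivity
        linarith
    rw [← h4]
    exact h3
  have htop : Tendsto (fun x : ℝ => (1 / π) * arctan ((exp (π * x / M) + cos a) / sin a)) atTop
      (𝓝 ((1 / π) * (π / 2))) := by
    have h1 : Tendsto (fun x : ℝ => exp (π * x / M)) atTop atTop := by
      refine tendsto_exp_atTop.comp ?_
      have : Tendsto (fun x : ℝ => (π / M) * x) atTop atTop :=
        tendsto_id.const_mul_atTop (by positivity)
      exact this.congr fun x => by ring
    have h2 := (tendsto_atTop_add_const_right _ (cos a) h1).atTop_div_const hs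
    have h3 := ((tendsto_arctan_atTop.mono_right nhdsWithin_le_nhds).comp h2).const_mul (1 / π)
    exact h3
  rw [integral_of_hasDerivAt_of_tendsto hda (poisson_integrable (by rwa [abs_of_pos hD])) hbot htop,
    ha]
  field_simp
  ring

/-! ### A contour integral over a period strip -/

/-- An entire function with two prescribed zeros is divisible by the corresponding linear
factors. -/
lemma exists_entire_quotient {f : ℂ → ℂ} (hf : Differentiable ℂ f) {a b : ℂ} (hab : a ≠ b)
    (ha : f a = 0) (hb : f b = 0) :
    ∃ g : ℂ → ℂ, Differentiable ℂ g ∧ ∀ z, f z = (z - a) * (z - b) * g z := by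
  have h1 : Differentiable ℂ (dslope f a) := by
    rw [← differentiableOn_univ] at hf ⊢
    exact (Complex.differentiableOn_dslope univ_mem).2 hf
  have h2 : Differentiable ℂ (dslope (dslope f a) b) := by
    rw [← differentiableOn_univ] at h1 ⊢
    exact (Complex.differentiableOn_dslope univ_mem).2 h1
  refine ⟨_, h2, fun z => ?_⟩
  have e1 := sub_smul_dslope f a z
  have e2 := sub_smul_dslope (dslope f a) b z
  have e3 := sub_smul_dslope f a b
  rw [ha, hb, sub_zero, smul_eq_mul, mul_eq_zero] at e3
  have e4 : dslope f a b = 0 := e3.resolve_left (sub_ne_zero.2 hab.symm)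
  rw [e4, sub_zero, smul_eq_mul] at e2
  rw [ha, sub_zero, smul_eq_mul] at e1
  rw [mul_assoc, e2, e1]

/-- The denominator of `poisson M D`, up to the factor `2M`, as an entire function. -/
noncomputable def stripDenom (M D : ℝ) (z : ℂ) : ℂ :=
  Complex.cosh (π * z / M) + Complex.cos (π * D / M)

lemma stripDenom_differentiable (M D : ℝ) : Differentiable ℂ (stripDenom M D) := by
  unfold stripDenom
  have : Differentiable ℂ fun z : ℂ => Complex.cosh (π * z / M) :=
    Complex.differentiable_cosh.comp (by fun_prop)
  fun_prop

lemma stripDenom_ofReal (M D x : ℝ) :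
    stripDenom M D x = ((cosh (π * x / M) + cos (π * D / M) : ℝ) : ℂ) := by
  simp [stripDenom]

lemma stripDenom_add_period {M : ℝ} (hM : M ≠ 0) (D : ℝ) (z : ℂ) :
    stripDenom M D (z + ((2 * M : ℝ) : ℂ) * Complex.I) = stripDenom M D z := by
  unfold stripDenom
  have : (π : ℂ) * (z + ((2 * M : ℝ) : ℂ) * Complex.I) / M = π * z / M + 2 * π * Complex.I := by
    have : (M : ℂ) ≠ 0 := by exact_mod_cast hM
    push_cast; field_simp
  rw [this, Complex.cosh_periodic]

lemma stripDenom_eq_zero {M D : ℝ} (hD : |D| < M) {z : ℂ} (h0 : 0 ≤ z.im) (h1 : z.im ≤ 2 * M)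
    (hz : stripDenom M D z = 0) :
    z = Complex.I * ((M - D : ℝ) : ℂ) ∨ z = Complex.I * ((M + D : ℝ) : ℂ) := by
  have hM : 0 < M := (abs_nonneg D).trans_lt hD
  have hMc : (M : ℂ) ≠ 0 := by exact_mod_cast hM.ne'
  have hpi : (π : ℂ) ≠ 0 := by exact_mod_cast pi_ne_zero
  obtain ⟨hD1, hD2⟩ := abs_lt.1 hD
  have key : stripDenom M D z = 2 * Complex.cos (π * (z * Complex.I + D) / M / 2) *
      Complex.cos (π * (z * Complex.I - D) / M / 2) := by
    unfold stripDenom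
    rw [← Complex.cos_mul_I, Complex.cos_add_cos]
    congr 2
    · congr 1; congr 1; ring
    · congr 1; ring
  have aux : ∀ d : ℝ, |d| < M → Complex.cos (π * (z * Complex.I + d) / M / 2) = 0 →
      z = Complex.I * ((M + d : ℝ) : ℂ) := by
    intro d hd hc
    obtain ⟨hd1, hd2⟩ := abs_lt.1 hd
    obtain ⟨n, hn⟩ := Complex.cos_eq_zero_iff.1 hc
    have e1 : z * Complex.I + d = (2 * n + 1) * M := by
      field_simp at hn
      linear_combination hn
    have e2 : z = -Complex.I * ((((2 * n + 1) * M - d : ℝ)) : ℂ) := by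
      push_cast
      linear_combination (-Complex.I) * e1 + z * Complex.I_mul_I
    have e3 : z.im = -((2 * n + 1) * M - d) := by rw [e2]; simp
    have hn1 : n < 0 := by
      by_contra h
      have : (0 : ℝ) ≤ n := by exact_mod_cast not_lt.1 h
      nlinarith
    have hn2 : -2 < n := by
      by_contra h
      have : (n : ℝ) ≤ -2 := by exact_mod_cast not_lt.1 h
      nlinarith
    have hn3 : n = -1 := by omega
    rw [e2, hn3]; push_cast; ring
  rw [key, mul_eq_zero, mul_eq_zero] at hz
  rcases hz with (hz | hz) | hz
  · norm_num at hz
  · exact Or.inr (aux D hD hz)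
  · left
    have := aux (-D) (by rwa [abs_neg]) (by push_cast; rwa [← sub_eq_add_neg])
    rw [this]; push_cast; ring

lemma norm_stripDenom_ge (M D : ℝ) (z : ℂ) :
    sinh (|π * z.re / M|) - 1 ≤ ‖stripDenom M D z‖ := by
  have h1 : sinh (|π * z.re / M|) ≤ ‖Complex.cosh (π * z / M)‖ := by
    have e : (π * z / M : ℂ).re = π * z.re / M := by
      rw [mul_div_assoc, Complex.re_ofReal_mul, Complex.div_ofReal_re]; ring
    rw [Complex.cosh, norm_div, sinh_eq]
    have h2 : ‖(2 : ℂ)‖ = 2 := by simp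
    rw [h2]
    gcongr
    rcases le_total 0 (π * z.re / M) with h | h
    · rw [abs_of_nonneg h]
      have := norm_sub_le_norm_add (Complex.exp (π * z / M)) (Complex.exp (-(π * z / M)))
      rwa [Complex.norm_exp, Complex.norm_exp, Complex.neg_re, e] at this
    · rw [abs_of_nonpos h, neg_neg]
      have := norm_sub_le_norm_add (Complex.exp (-(π * z / M))) (Complex.exp (π * z / M))
      rwa [Complex.norm_exp, Complex.norm_exp, Complex.neg_re, e, add_comm (Complex.exp _)] at this
  have h2 : ‖Complex.cos (π * D / M : ℂ)‖ ≤ 1 := by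
    have : Complex.cos (π * D / M : ℂ) = ((cos (π * D / M) : ℝ) : ℂ) := by push_cast; rfl
    rw [this, Complex.norm_real]; exact abs_cos_le_one _
  have h3 := norm_sub_le_norm_add (Complex.cosh (π * z / M)) (Complex.cos (π * D / M : ℂ))
  unfold stripDenom
  linarith

lemma tendsto_affine_div_sinh {a : ℝ} (ha : 0 < a) (A B : ℝ) :
    Tendsto (fun R : ℝ => (A + B * R) / (sinh (a * R) - 1)) atTop (𝓝 0) := by
  have h2 : Tendsto (fun R : ℝ => |A| * (8 * exp (-a * R)) + |B| * (8 * (R * exp (-a * R)))) atTop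
      (𝓝 0) := by
    have h1 : Tendsto (fun R : ℝ => |A| * (8 * exp (-a * R)) + |B| * (8 * (R * exp (-a * R)))) atTop
      (𝓝 (|A| * (8 * 0) + |B| * (8 * 0))) := by
      refine Tendsto.add (Tendsto.const_mul _ (Tendsto.const_mul _ ?_))
        (Tendsto.const_mul _ (Tendsto.const_mul _ ?_))
      · have := tendsto_exp_atBot.comp (tendsto_id.const_mul_atTop_of_neg (neg_lt_zero.2 ha))
        exact this
      · have := tendsto_rpow_mul_exp_neg_mul_atTop_nhds_zero 1 a ha
        simpa using this
    simpa using h1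
  refine squeeze_zero_norm' ?_ h2
  filter_upwards [eventually_ge_atTop (2 / a), eventually_ge_atTop 0] with R hR hR0
  have h3 : 2 ≤ a * R := by rw [div_le_iff₀ ha] at hR; linarith
  have h4 : exp (a * R) / 8 ≤ sinh (a * R) - 1 := by
    have e1 : 4 ≤ exp (a * R) := by
      have := Real.quadratic_le_exp_of_nonneg (x := a * R) (by linarith)
      nlinarith
    have e2 : exp (-(a * R)) ≤ 1 := exp_le_one_iff.2 (by linarith)
    rw [sinh_eq]; linarith
  have h5 := exp_pos (a * R)
  rw [norm_div, norm_eq_abs, norm_of_nonneg (by linarith : 0 ≤ sinh (a * R) - 1)]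
  have h6 : |A + B * R| ≤ |A| + |B| * R := by
    refine (abs_add_le _ _).trans ?_
    rw [abs_mul, abs_of_nonneg hR0]
  have h7 : 0 ≤ |A| + |B| * R := by positivity
  calc |A + B * R| / (sinh (a * R) - 1) ≤ (|A| + |B| * R) / (exp (a * R) / 8) := by gcongr
    _ = |A| * (8 * exp (-a * R)) + |B| * (8 * (R * exp (-a * R))) := by
        rw [show -a * R = -(a * R) by ring, exp_neg]; field_simp

/-- Cauchy's theorem on a period strip: the numerator cancels both poles. -/
lemma integral_sub_period_div_stripDenom {M D : ℝ} (hD : 0 < D) (hDM : D < M) {N : ℂ → ℂ}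
    (hN : Differentiable ℂ N) (hNa : N (Complex.I * ((M - D : ℝ) : ℂ)) = 0)
    (hNb : N (Complex.I * ((M + D : ℝ) : ℂ)) = 0) {A B : ℝ}
    (hbound : ∀ z : ℂ, 0 ≤ z.im → z.im ≤ 2 * M → ‖N z‖ ≤ A + B * |z.re|)
    (hint : Integrable fun x : ℝ =>
      (N x - N (x + ((2 * M : ℝ) : ℂ) * Complex.I)) / stripDenom M D x) :
    ∫ x : ℝ, (N x - N (x + ((2 * M : ℝ) : ℂ) * Complex.I)) / stripDenom M D x = 0 := by
  have hM : 0 < M := hD.trans hDM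
  have hDabs : |D| < M := by rwa [abs_of_pos hD]
  set a : ℂ := Complex.I * ((M - D : ℝ) : ℂ) with ha
  set b : ℂ := Complex.I * ((M + D : ℝ) : ℂ) with hb
  have hia : a.im = M - D := by simp [ha]
  have hib : b.im = M + D := by simp [hb]
  have hab : a ≠ b := fun h => by rw [h] at hia; linarith
  have hMc : (M : ℂ) ≠ 0 := by exact_mod_cast hM.ne'
  -- both points are simple zeros of the denominator
  have hzero : ∀ d : ℝ, stripDenom M D (Complex.I * ((M + d : ℝ) : ℂ)) =
      ((cos (π * D / M) - cos (π * d / M) : ℝ) : ℂ) := by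
    intro d
    unfold stripDenom
    have : (π : ℂ) * (Complex.I * ((M + d : ℝ) : ℂ)) / M = (π * d / M) * Complex.I
        + π * Complex.I := by push_cast; field_simp; ring
    rw [this, Complex.cosh_add_pi_mul_I, Complex.cosh_mul_I]
    push_cast; ring
  have hFa : stripDenom M D a = 0 := by
    have := hzero (-D)
    rw [show π * -D / M = -(π * D / M) by ring, cos_neg, sub_self] at this
    simpa [ha, sub_eq_add_neg] using this
  have hFb : stripDenom M D b = 0 := by
    have := hzero D
    rw [sub_self] at this
    simpa [hb] using this
  obtain ⟨G, hG, hNG⟩ := exists_entire_quotient hN hab hNa hNb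
  obtain ⟨H, hH, hFH⟩ := exists_entire_quotient (stripDenom_differentiable M D) hab hFa hFb
  have hsin := sin_angle_pos hD hDM
  have hderiv : ∀ d : ℝ, HasDerivAt (stripDenom M D) (-(Complex.sin (π * d / M) * Complex.I)
      * (π / M)) (Complex.I * ((M + d : ℝ) : ℂ)) := by
    intro d
    have h1 : HasDerivAt (fun z : ℂ => π * z / M) (π / M) (Complex.I * ((M + d : ℝ) : ℂ)) := by
      simpa using ((hasDerivAt_id (Complex.I * ((M + d : ℝ) : ℂ))).const_mul (π : ℂ)).div_const
        (M : ℂ)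
    refine (h1.ccosh.add_const (Complex.cos (π * D / M))).congr_deriv ?_
    have : (π : ℂ) * (Complex.I * ((M + d : ℝ) : ℂ)) / M = (π * d / M) * Complex.I
        + π * Complex.I := by push_cast; field_simp; ring
    rw [this, Complex.sinh_add_pi_mul_I, Complex.sinh_mul_I]
  have hpi : (π : ℂ) / M ≠ 0 := div_ne_zero (by exact_mod_cast pi_ne_zero) hMc
  have hsinc : Complex.sin (π * D / M) ≠ 0 := by
    have : Complex.sin (π * D / M) = ((sin (π * D / M) : ℝ) : ℂ) := by push_cast; rfl
    rw [this]; exact_mod_cast hsin.ne'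
  have hprod : ∀ z, HasDerivAt (fun z => (z - a) * (z - b) * H z)
      ((1 * (z - b) + (z - a) * 1) * H z + (z - a) * (z - b) * deriv H z) z := fun z =>
    (((hasDerivAt_id z).sub_const a).mul ((hasDerivAt_id z).sub_const b)).mul
      (hH z).hasDerivAt
  have hfun : stripDenom M D = fun z => (z - a) * (z - b) * H z := funext hFH
  have hHa : H a ≠ 0 := by
    intro h
    have h1 := hderiv (-D)
    rw [← sub_eq_add_neg, ← ha, hfun] at h1
    have h2 := h1.unique (hprod a)
    rw [h] at h2
    simp [neg_div, hsinc, hM.ne', pi_ne_zero] at h2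
  have hHb : H b ≠ 0 := by
    intro h
    have h1 := hderiv D
    rw [← hb, hfun] at h1
    have h2 := h1.unique (hprod b)
    rw [h] at h2
    simp [hsinc, hM.ne', pi_ne_zero] at h2
  have hHne : ∀ z : ℂ, 0 ≤ z.im → z.im ≤ 2 * M → H z ≠ 0 := by
    intro z h0 h1 hz
    have : stripDenom M D z = 0 := by rw [hFH, hz, mul_zero]
    rcases stripDenom_eq_zero hDabs h0 h1 this with h | h
    · exact hHa (by rw [ha, ← h]; exact hz)
    · exact hHb (by rw [hb, ← h]; exact hz)
  have hquot : ∀ z : ℂ, z ≠ a → z ≠ b → G z / H z = N z / stripDenom M D z := by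
    intro z h1 h2
    rw [hNG, hFH, mul_div_mul_left]
    exact mul_ne_zero (sub_ne_zero.2 h1) (sub_ne_zero.2 h2)
  have hrect : ∀ R : ℝ, 0 ≤ R →
      (∫ x : ℝ in (-R)..R, (N x - N (x + ((2 * M : ℝ) : ℂ) * Complex.I)) / stripDenom M D x) =
      Complex.I * (∫ y : ℝ in (0 : ℝ)..(2 * M), G (((-R : ℝ) : ℂ) + y * Complex.I)
          / H (((-R : ℝ) : ℂ) + y * Complex.I))
        - Complex.I * ∫ y : ℝ in (0 : ℝ)..(2 * M), G ((R : ℂ) + y * Complex.I)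
          / H ((R : ℂ) + y * Complex.I) := by
    intro R hR
    have h := Complex.integral_boundary_rect_eq_zero_of_differentiableOn (fun z => G z / H z)
      (⟨-R, 0⟩ : ℂ) (⟨R, 2 * M⟩ : ℂ) (by
        refine DifferentiableOn.div hG.differentiableOn hH.differentiableOn ?_
        intro z hz
        have hz2 := hz.2
        simp only [Set.mem_preimage] at hz2
        rw [Set.uIcc_of_le (by positivity)] at hz2
        exact hHne z hz2.1 hz2.2)
    simp only [smul_eq_mul] at h
    have e1 : ∀ x : ℝ, G ((x : ℂ) + ((0 : ℝ) : ℂ) * Complex.I) / H ((x : ℂ) + ((0 : ℝ) : ℂ)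
        * Complex.I) = N x / stripDenom M D x := by
      intro x
      rw [Complex.ofReal_zero, zero_mul, add_zero]
      refine hquot _ ?_ ?_
      · intro h; have := congrArg Complex.im h; rw [hia] at this; simp at this; linarith
      · intro h; have := congrArg Complex.im h; rw [hib] at this; simp at this; linarith
    have e2 : ∀ x : ℝ, G ((x : ℂ) + ((2 * M : ℝ) : ℂ) * Complex.I) / H ((x : ℂ) + ((2 * M : ℝ) : ℂ)
        * Complex.I) = N ((x : ℂ) + ((2 * M : ℝ) : ℂ) * Complex.I) / stripDenom M D x := by
      intro x
      rw [hquot, stripDenom_add_period hM.ne']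
      · intro h; have := congrArg Complex.im h; rw [hia] at this; simp at this; linarith
      · intro h; have := congrArg Complex.im h; rw [hib] at this; simp at this; linarith
    simp only [e1, e2] at h
    have hne : ∀ x : ℝ, stripDenom M D x ≠ 0 := fun x => by
      rw [stripDenom_ofReal]; exact_mod_cast (denom_pos hDabs x).ne'
    have hFc : Continuous fun x : ℝ => stripDenom M D x :=
      (stripDenom_differentiable M D).continuous.comp Complex.continuous_ofReal
    have c1 : Continuous fun x : ℝ => N x / stripDenom M D x :=
      (hN.continuous.comp Complex.continuous_ofReal).div hFc hne
    have c2 : Continuous fun x : ℝ => N ((x : ℂ) + ((2 * M : ℝ) : ℂ) * Complex.I)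
        / stripDenom M D x :=
      (hN.continuous.comp (by fun_prop)).div hFc hne
    rw [← intervalIntegral.integral_sub (c1.intervalIntegrable _ _) (c2.intervalIntegrable _ _)]
      at h
    simp only [← sub_div] at h
    linear_combination h
  have hvert : ∀ s : ℝ, |s| = 1 → Tendsto (fun R : ℝ => Complex.I * ∫ y : ℝ in (0 : ℝ)..(2 * M),
      G (((s * R : ℝ) : ℂ) + y * Complex.I) / H (((s * R : ℝ) : ℂ) + y * Complex.I))
      atTop (𝓝 0) := by
    intro s hs
    have h0 := (tendsto_affine_div_sinh (a := π / M) (by positivity) A B).mul_const (2 * M)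
    rw [zero_mul] at h0
    refine squeeze_zero_norm' ?_ h0
    filter_upwards [eventually_ge_atTop (2 * M / π), eventually_gt_atTop 0] with R hR hR0
    have h3 : 2 ≤ π / M * R := by
      rw [div_le_iff₀ pi_pos] at hR
      rw [div_mul_eq_mul_div, le_div_iff₀ hM]; linarith
    have h4 : 0 < sinh (π / M * R) - 1 := by
      have := self_le_sinh_iff.2 (show 0 ≤ π / M * R by linarith)
      linarith
    rw [norm_mul, Complex.norm_I, one_mul]
    have h5 := intervalIntegral.norm_integral_le_of_norm_le_const (a := 0) (b := 2 * M)
      (f := fun y : ℝ => G (((s * R : ℝ) : ℂ) + y * Complex.I)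
        / H (((s * R : ℝ) : ℂ) + y * Complex.I))
      (C := (A + B * R) / (sinh (π / M * R) - 1)) (by
        intro y hy
        rw [Set.uIoc_of_le (by positivity)] at hy
        set z : ℂ := ((s * R : ℝ) : ℂ) + y * Complex.I with hz
        have hre : z.re = s * R := by simp [hz]
        have him : z.im = y := by simp [hz]
        have habs : |z.re| = R := by rw [hre, abs_mul, hs, one_mul, abs_of_pos hR0]
        have hna : z ≠ a := by
          intro h
          have : z.re = 0 := by rw [h, ha]; simp
          rw [this, abs_zero] at habs; linarith
        have hnb : z ≠ b := by
          intro h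
          have : z.re = 0 := by rw [h, hb]; simp
          rw [this, abs_zero] at habs; linarith
        rw [hquot z hna hnb, norm_div]
        have h6 := hbound z (by rw [him]; exact hy.1.le) (by rw [him]; exact hy.2)
        have h7 := norm_stripDenom_ge M D z
        rw [abs_div, abs_mul, habs, abs_of_pos pi_pos, abs_of_pos hM,
          mul_div_right_comm] at h7
        rw [habs] at h6
        have h8 := (norm_nonneg _).trans h6
        gcongr)
    rwa [sub_zero, abs_of_pos (by positivity)] at h5
  have hlim1 := intervalIntegral_tendsto_integral hint tendsto_neg_atTop_atBot tendsto_id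
  have hlim2 : Tendsto (fun R : ℝ => ∫ x : ℝ in (-R)..R,
      (N x - N (x + ((2 * M : ℝ) : ℂ) * Complex.I)) / stripDenom M D x) atTop (𝓝 (0 - 0)) := by
    refine ((hvert (-1) (by simp)).sub (hvert 1 (by simp))).congr' ?_
    filter_upwards [eventually_ge_atTop 0] with R hR
    rw [hrect R hR]
    simp
  rw [sub_zero] at hlim2
  exact tendsto_nhds_unique hlim1 hlim2

/-! ### Fourier transforms and convolutions -/

/-- The Fourier transform of a real function, normalised as `∫ e^{-2πiwx} f(x) dx`. -/
noncomputable def ft (f : ℝ → ℝ) (w : ℝ) : ℂ := 𝓕 (fun x : ℝ => (f x : ℂ)) w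

lemma ft_eq_integral (f : ℝ → ℝ) (w : ℝ) :
    ft f w = ∫ x : ℝ, Complex.exp (-(2 * π * w) * x * Complex.I) * f x := by
  rw [ft, Real.fourier_real_eq_integral_exp_smul]
  congr 1; ext x
  rw [smul_eq_mul]; congr 2; push_cast; ring

lemma integrable_exp_mul {f : ℝ → ℝ} (hf : Integrable f) (w : ℝ) :
    Integrable fun x : ℝ => Complex.exp (-(2 * π * w) * x * Complex.I) * f x := by
  refine hf.ofReal.bdd_mul (c := 1) (Continuous.aestronglyMeasurable (by fun_prop))
    (Eventually.of_forall fun x => ?_)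
  have : (-(2 * π * w) * x * Complex.I : ℂ) = ((-(2 * π * w) * x : ℝ) : ℂ) * Complex.I := by
    push_cast; ring
  rw [this, Complex.norm_exp_ofReal_mul_I]

lemma ft_poisson_of_pos {M D w : ℝ} (hD : 0 < D) (hDM : D < M) (hw : w ≠ 0) :
    ft (poisson M D) w = ((sinh (2 * π * w * D) / sinh (2 * π * w * M) : ℝ) : ℂ) := by
  have hM : 0 < M := hD.trans hDM
  have hDabs : |D| < M := by rwa [abs_of_pos hD]
  have hs := sin_angle_pos hD hDM
  set s := sin (π * D / M) with hsdef
  set E : ℂ → ℂ := fun z => Complex.exp (-(2 * π * w) * z * Complex.I) with hE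
  set a : ℂ := Complex.I * ((M - D : ℝ) : ℂ) with ha
  set b : ℂ := Complex.I * ((M + D : ℝ) : ℂ) with hb
  have hba : b - a = 2 * D * Complex.I := by rw [ha, hb]; push_cast; ring
  have hDc : (D : ℂ) ≠ 0 := by exact_mod_cast hD.ne'
  have hMc : (M : ℂ) ≠ 0 := by exact_mod_cast hM.ne'
  have hsc : (s : ℂ) ≠ 0 := by exact_mod_cast hs.ne'
  have hbane : b - a ≠ 0 := by rw [hba]; simp [hD.ne']
  -- the affine function `α + β z` interpolates the exponential at the two poles
  set β : ℂ := (E b - E a) / (b - a) with hβ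
  set α : ℂ := E a - β * a with hα
  have hβba : β * (b - a) = E b - E a := div_mul_cancel₀ _ hbane
  have hEa : E a = ((exp (2 * π * w * (M - D)) : ℝ) : ℂ) := by
    simp only [hE, ha]; push_cast; congr 1
    linear_combination (-2 * π * w * (M - D) : ℂ) * Complex.I_mul_I
  have hEb : E b = ((exp (2 * π * w * (M + D)) : ℝ) : ℂ) := by
    simp only [hE, hb]; push_cast; congr 1
    linear_combination (-2 * π * w * (M + D) : ℂ) * Complex.I_mul_I
  set N : ℂ → ℂ := fun z => E z - α - β * z with hN
  have hEd : Differentiable ℂ E := by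
    simp only [hE]; fun_prop
  have hNd : Differentiable ℂ N := by simp only [hN]; fun_prop
  have hEper : ∀ z : ℂ, E (z + ((2 * M : ℝ) : ℂ) * Complex.I)
      = E z * ((exp (4 * π * w * M) : ℝ) : ℂ) := by
    intro z
    simp only [hE]
    rw [Complex.ofReal_exp, ← Complex.exp_add]; congr 1; push_cast
    linear_combination (-4 * π * w * M : ℂ) * Complex.I_mul_I
  have hNper : ∀ z : ℂ, N z - N (z + ((2 * M : ℝ) : ℂ) * Complex.I)
      = E z * (1 - ((exp (4 * π * w * M) : ℝ) : ℂ)) + 2 * M * Complex.I * β := by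
    intro z; simp only [hN, hEper]; push_cast; ring
  have hinv : ∀ x : ℝ, 1 / stripDenom M D x = 2 * M / s * (poisson M D x : ℂ) := by
    intro x
    have h := (denom_pos hDabs x).ne'
    have h' : ((cosh (π * x / M) + cos (π * D / M) : ℝ) : ℂ) ≠ 0 := by exact_mod_cast h
    rw [stripDenom_ofReal, poisson, ← hsdef]
    rw [Complex.ofReal_div, Complex.ofReal_mul]
    push_cast at h' ⊢
    field_simp
  have hint1 := (integrable_exp_mul (poisson_integrable hDabs) w)
  have hint2 : Integrable fun x : ℝ => (poisson M D x : ℂ) := (poisson_integrable hDabs).ofReal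
  have hintegrand : (fun x : ℝ => (N x - N (x + ((2 * M : ℝ) : ℂ) * Complex.I)) / stripDenom M D x)
      = fun x : ℝ => (2 * M / s * (1 - ((exp (4 * π * w * M) : ℝ) : ℂ))) *
        (Complex.exp (-(2 * π * w) * x * Complex.I) * (poisson M D x : ℂ))
        + (2 * M / s * (2 * M * Complex.I * β)) * (poisson M D x : ℂ) := by
    ext x
    rw [← mul_one_div, hinv, hNper]; simp only [hE]; ring
  have h0 := integral_sub_period_div_stripDenom hD hDM (N := N) hNd
    (by simp only [hN, hα]; ring)
    (by simp only [hN, hα]; linear_combination -hβba)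
    (A := exp (|2 * π * w| * (2 * M)) + ‖α‖ + ‖β‖ * (2 * M)) (B := ‖β‖) (by
      intro z h0 h1
      have e1 : ‖E z‖ ≤ exp (|2 * π * w| * (2 * M)) := by
        simp only [hE]
        rw [Complex.norm_exp]
        apply exp_le_exp.2
        have : (-(2 * π * w) * z * Complex.I : ℂ).re = (2 * π * w) * z.im := by simp
        rw [this]
        calc (2 * π * w) * z.im ≤ |2 * π * w| * z.im := by gcongr; exact le_abs_self _
          _ ≤ _ := by gcongr
      have e2 : ‖z‖ ≤ |z.re| + 2 * M := by
        have := Complex.norm_le_abs_re_add_abs_im z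
        rw [abs_of_nonneg h0] at this; linarith
      calc ‖N z‖ ≤ ‖E z‖ + ‖α‖ + ‖β * z‖ := by
            simp only [hN]
            exact (norm_sub_le _ _).trans (by gcongr; exact norm_sub_le _ _)
        _ ≤ exp (|2 * π * w| * (2 * M)) + ‖α‖ + ‖β‖ * (|z.re| + 2 * M) := by
            rw [norm_mul]; gcongr
        _ = _ := by ring)
    (by
      rw [hintegrand]
      exact (hint1.const_mul _).add (hint2.const_mul _))
  rw [hintegrand, integral_add (hint1.const_mul _) (hint2.const_mul _), integral_const_mul,
    integral_const_mul, ← ft_eq_integral, integral_complex_ofReal,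
    integral_poisson_of_pos hD hDM] at h0
  have hT : 0 < exp (2 * π * w * M) := exp_pos _
  have h4 : exp (4 * π * w * M) = exp (2 * π * w * M) ^ 2 := by
    rw [sq, ← exp_add]; congr 1; ring
  have hwM : 2 * π * w * M ≠ 0 := by positivity
  have hne1 : exp (4 * π * w * M) ≠ 1 := by
    rw [Ne, exp_eq_one_iff]; intro h; apply hwM; linarith
  have hne1c : ((exp (4 * π * w * M) : ℝ) : ℂ) - 1 ≠ 0 := by
    rw [sub_ne_zero]; exact_mod_cast hne1
  have hmain : ft (poisson M D) w * (((exp (4 * π * w * M) : ℝ) : ℂ) - 1)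
      = ((exp (2 * π * w * (M + D)) : ℝ) : ℂ) - ((exp (2 * π * w * (M - D)) : ℝ) : ℂ) := by
    rw [← hEa, ← hEb, ← hβba, hba]
    have h2 : (2 * M / s : ℂ) ≠ 0 := by simp [hs.ne', hM.ne']
    push_cast at h0 ⊢
    have h3 : (2 * M / s : ℂ) * (ft (poisson M D) w * (Complex.exp (4 * π * w * M) - 1)
        - β * (2 * D * Complex.I)) = 0 := by
      rw [← neg_eq_zero, ← h0]
      field_simp
      ring
    exact sub_eq_zero.1 ((mul_eq_zero.1 h3).resolve_left h2)
  rw [eq_div_of_mul_eq hne1c hmain]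
  have hreal : (exp (2 * π * w * (M + D)) - exp (2 * π * w * (M - D))) / (exp (4 * π * w * M) - 1)
      = sinh (2 * π * w * D) / sinh (2 * π * w * M) := by
    have hsh : sinh (2 * π * w * M) ≠ 0 := by rwa [Ne, sinh_eq_zero]
    rw [div_eq_div_iff (sub_ne_zero.2 hne1) hsh, sinh_eq, sinh_eq, exp_neg, exp_neg, h4, mul_add,
      mul_sub, exp_add, exp_sub]
    have hU : 0 < exp (2 * π * w * D) := exp_pos _
    field_simp
  rw [← hreal]; push_cast; rfl

/-- The Fourier transform of the Poisson kernel of a strip. At `w = 0`, where the right hand side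
takes the junk value `0`, the correct value is `D / M`. -/
lemma ft_poisson {M D w : ℝ} (hD : |D| < M) (hw : w ≠ 0) :
    ft (poisson M D) w = ((sinh (2 * π * w * D) / sinh (2 * π * w * M) : ℝ) : ℂ) := by
  rcases lt_trichotomy D 0 with h | h | h
  · have h1 : ft (poisson M D) w = -ft (poisson M (-D)) w := by
      rw [ft_eq_integral, ft_eq_integral, ← integral_neg]
      congr 1; ext x; rw [poisson_neg_height]; push_cast; ring
    rw [h1, ft_poisson_of_pos (by linarith) (by rwa [abs_of_neg h] at hD) hw]
    rw [mul_neg, sinh_neg]; push_cast; ring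
  · rw [h, ft_eq_integral]; simp [poisson_zero_height]
  · exact ft_poisson_of_pos h (by rwa [abs_of_pos h] at hD) hw

lemma ft_poissonDeriv {M D w : ℝ} (hD : |D| < M) (hw : w ≠ 0) :
    ft (poissonDeriv M D) w = (2 * π * Complex.I * w) *
      ((sinh (2 * π * w * D) / sinh (2 * π * w * M) : ℝ) : ℂ) := by
  have hd : ∀ x, HasDerivAt (fun x : ℝ => (poisson M D x : ℂ)) (poissonDeriv M D x : ℂ) x :=
    fun x => (poisson_hasDerivAt M D x).ofReal_comp
  have hde : deriv (fun x : ℝ => (poisson M D x : ℂ)) = fun x : ℝ => (poissonDeriv M D x : ℂ) :=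
    funext fun x => (hd x).deriv
  have := Real.fourier_deriv (f := fun x : ℝ => (poisson M D x : ℂ))
    ((poisson_integrable hD).ofReal) (fun x => (hd x).differentiableAt)
    (by rw [hde]; exact (poissonDeriv_integrable hD).ofReal)
  rw [hde] at this
  rw [ft, this, ← ft_poisson hD hw]
  rfl

lemma ft_const_mul (c : ℝ) (f : ℝ → ℝ) (w : ℝ) : ft (fun x => c * f x) w = c * ft f w := by
  rw [ft_eq_integral, ft_eq_integral, ← integral_const_mul]
  congr 1; ext x; push_cast; ring

lemma ft_add {f g : ℝ → ℝ} (hf : Integrable f) (hg : Integrable g) (w : ℝ) :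
    ft (fun x => f x + g x) w = ft f w + ft g w := by
  rw [ft_eq_integral, ft_eq_integral, ft_eq_integral, ← integral_add (integrable_exp_mul hf w)
    (integrable_exp_mul hg w)]
  congr 1; ext x; push_cast; ring

lemma ft_sub {f g : ℝ → ℝ} (hf : Integrable f) (hg : Integrable g) (w : ℝ) :
    ft (fun x => f x - g x) w = ft f w - ft g w := by
  rw [ft_eq_integral, ft_eq_integral, ft_eq_integral, ← integral_sub (integrable_exp_mul hf w)
    (integrable_exp_mul hg w)]
  congr 1; ext x; push_cast; ring

/-- Continuous integrable functions are determined by their Fourier transforms away from `w = 0`. -/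
lemma eq_of_ft_eq {f g : ℝ → ℝ} (hfc : Continuous f) (hgc : Continuous g) (hf : Integrable f)
    (hg : Integrable g) (h : ∀ w, w ≠ 0 → ft f w = ft g w) : f = g := by
  set F : ℝ → ℂ := fun x => ((f x - g x : ℝ) : ℂ) with hF
  have hFi : Integrable F := (hf.sub hg).ofReal
  have hFc : Continuous F := by simp only [hF]; fun_prop
  have hz : 𝓕 F =ᵐ[volume] 0 := by
    have : ∀ᵐ w : ℝ, w ≠ 0 := by simp [ae_iff, measure_singleton]
    filter_upwards [this] with w hw
    have h1 := ft_sub hf hg w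
    rw [h w hw, sub_self] at h1
    exact h1
  have h2 := hFc.fourierInv_fourier_eq hFi ((integrable_zero _ _ _).congr hz.symm)
  ext x
  have h3 : F x = 0 := by
    rw [← h2, Real.fourierInv_eq]
    apply integral_eq_zero_of_ae
    filter_upwards [hz] with w hw
    rw [hw]; simp
  simpa [hF, sub_eq_zero] using h3

/-- The convolution `∫ k(x - t) φ(t) dt`. -/
noncomputable def conv (k φ : ℝ → ℝ) (x : ℝ) : ℝ := ∫ t, k (x - t) * φ t

lemma conv_eq_convolution (k φ : ℝ → ℝ) :
    conv k φ = φ ⋆[ContinuousLinearMap.mul ℝ ℝ] k := by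
  ext x; simp [conv, convolution_def, mul_comm]

lemma conv_integrable {k φ : ℝ → ℝ} (hk : Integrable k) (hφ : Integrable φ) :
    Integrable (conv k φ) := by
  rw [conv_eq_convolution]; exact hφ.integrable_convolution _ hk

lemma ft_conv {k φ : ℝ → ℝ} (hk : Integrable k) (hφ : Integrable φ) (w : ℝ) :
    ft (conv k φ) w = ft k w * ft φ w := by
  have h := Real.fourier_mul_convolution_eq (f₁ := fun x : ℝ => (φ x : ℂ))
    (f₂ := fun x : ℝ => (k x : ℂ)) hφ.ofReal hk.ofReal w
  rw [mul_comm, ft, ft, ft, ← h]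
  refine congrArg (fun f : ℝ → ℂ => 𝓕 f w) (funext fun x => ?_)
  simp only [conv, convolution_def, ContinuousLinearMap.mul_apply']
  rw [← integral_complex_ofReal]
  congr 1; ext t; push_cast; ring

lemma conv_integrand_integrable {k φ : ℝ → ℝ} (hkc : Continuous k) {C : ℝ}
    (hkb : ∀ x, |k x| ≤ C) (hφ : Integrable φ) (x : ℝ) : Integrable fun t => k (x - t) * φ t :=
  hφ.bdd_mul (c := C) (Continuous.aestronglyMeasurable (by fun_prop))
    (Eventually.of_forall fun t => hkb _)

lemma conv_continuous {k φ : ℝ → ℝ} (hkc : Continuous k) {C : ℝ}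
    (hkb : ∀ x, |k x| ≤ C) (hφ : Integrable φ) : Continuous (conv k φ) := by
  refine continuous_of_dominated (bound := fun t => C * |φ t|)
    (fun x => (conv_integrand_integrable hkc hkb hφ x).aestronglyMeasurable)
    (fun x => Eventually.of_forall fun t => ?_) (hφ.abs.const_mul C)
    (Eventually.of_forall fun t => by fun_prop)
  rw [norm_mul]
  exact mul_le_mul_of_nonneg_right (hkb _) (norm_nonneg _)

lemma conv_bounded {k φ : ℝ → ℝ} {C : ℝ} (hkb : ∀ x, |k x| ≤ C)
    (hφ : Integrable φ) (x : ℝ) : |conv k φ x| ≤ C * ∫ t, |φ t| := by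
  rw [← integral_const_mul, ← Real.norm_eq_abs, conv]
  refine norm_integral_le_of_norm_le (hφ.abs.const_mul C) (Eventually.of_forall fun t => ?_)
  rw [norm_mul]
  exact mul_le_mul_of_nonneg_right (hkb _) (norm_nonneg _)

/-! ### Dressing equations and their continuation to horizontal lines -/

/-- The part of `φ` inside the Fermi zone `[-q, q]`. -/
noncomputable def cutIn (q : ℝ) (φ : ℝ → ℝ) : ℝ → ℝ := (Set.Icc (-q) q).indicator φ

/-- The part of `φ` outside the Fermi zone `[-q, q]`. -/
noncomputable def cutOut (q : ℝ) (φ : ℝ → ℝ) : ℝ → ℝ := (Set.Icc (-q) q)ᶜ.indicator φ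

lemma cutIn_add_cutOut (q : ℝ) (φ : ℝ → ℝ) (x : ℝ) : cutIn q φ x + cutOut q φ x = φ x :=
  Set.indicator_self_add_compl_apply _ _ _

lemma cutIn_integrable (q : ℝ) {φ : ℝ → ℝ} (hφ : Continuous φ) : Integrable (cutIn q φ) :=
  (hφ.continuousOn.integrableOn_compact isCompact_Icc).integrable_indicator measurableSet_Icc

lemma cutOut_integrable (q : ℝ) {φ : ℝ → ℝ} (hφ : Integrable φ) : Integrable (cutOut q φ) :=
  hφ.indicator measurableSet_Icc.compl

lemma neg_mem_Icc_iff (q x : ℝ) : -x ∈ Set.Icc (-q) q ↔ x ∈ Set.Icc (-q) q := by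
  simp only [Set.mem_Icc]; constructor <;> rintro ⟨h1, h2⟩ <;> constructor <;> linarith

lemma cutIn_comp_neg (q : ℝ) (φ : ℝ → ℝ) (x : ℝ) :
    cutIn q (fun y => φ (-y)) x = cutIn q φ (-x) := by
  by_cases h : x ∈ Set.Icc (-q) q
  · rw [cutIn, cutIn, Set.indicator_of_mem h, Set.indicator_of_mem ((neg_mem_Icc_iff q x).2 h)]
  · rw [cutIn, cutIn, Set.indicator_of_notMem h,
      Set.indicator_of_notMem (mt (neg_mem_Icc_iff q x).1 h)]

lemma cutIn_odd {q : ℝ} {φ : ℝ → ℝ} (h : ∀ x, φ (-x) = -φ x) (x : ℝ) :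
    cutIn q φ (-x) = -cutIn q φ x := by
  rw [← cutIn_comp_neg]
  by_cases hx : x ∈ Set.Icc (-q) q
  · simp [cutIn, Set.indicator_of_mem hx, h]
  · simp [cutIn, Set.indicator_of_notMem hx]

lemma cutOut_odd {q : ℝ} {φ : ℝ → ℝ} (h : ∀ x, φ (-x) = -φ x) (x : ℝ) :
    cutOut q φ (-x) = -cutOut q φ x := by
  have h1 := cutIn_add_cutOut q φ x
  have h2 := cutIn_add_cutOut q φ (-x)
  rw [cutIn_odd h, h] at h2; linarith

lemma cutIn_ge {q m : ℝ} (hm : 0 ≤ m) {φ : ℝ → ℝ} {x : ℝ} (h : -m ≤ φ x) : -m ≤ cutIn q φ x := by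
  by_cases hx : x ∈ Set.Icc (-q) q
  · rwa [cutIn, Set.indicator_of_mem hx]
  · rw [cutIn, Set.indicator_of_notMem hx]; linarith

lemma cutOut_ge {q m : ℝ} (hm : 0 ≤ m) {φ : ℝ → ℝ} {x : ℝ} (h : -m ≤ φ x) :
    -m ≤ cutOut q φ x := by
  by_cases hx : x ∈ (Set.Icc (-q) q)ᶜ
  · rwa [cutOut, Set.indicator_of_mem hx]
  · rw [cutOut, Set.indicator_of_notMem hx]; linarith

/-- `φ` solves the dressing equation `φ + ∫_{-q}^q K(· - μ ∣ ζ) φ(μ) dμ = S`; the kernel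
`K(· ∣ ζ)` is the Poisson kernel of height `π/2 - ζ`. -/
structure IsDressed (ζ q : ℝ) (S φ : ℝ → ℝ) : Prop where
  continuous : Continuous φ
  eq : ∀ x, φ x = S x - conv (poisson (π / 2) (π / 2 - ζ)) (cutIn q φ) x

/-- The function `S_D - (K_{D+ζ/2} + K_{D-ζ/2}) ⋆ φ 1_{[-q,q]}`, where `K_D` is the Poisson kernel
of height `D` in the strip of half-width `π/2`: the dressed quantity on a horizontal line. -/
noncomputable def dressedLine (ζ q D : ℝ) (S φ : ℝ → ℝ) (x : ℝ) : ℝ :=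
  S x - (conv (poisson (π / 2) (D + ζ / 2)) (cutIn q φ) x
    + conv (poisson (π / 2) (D - ζ / 2)) (cutIn q φ) x)

lemma abs_height_lt {ζ : ℝ} (h0 : 0 < ζ) (h1 : ζ < π) : |π / 2 - ζ| < π / 2 := by
  rw [abs_lt]; constructor <;> linarith

lemma IsDressed.integrable {ζ q : ℝ} {S φ : ℝ → ℝ} (h : IsDressed ζ q S φ) (h0 : 0 < ζ)
    (h1 : ζ < π) (hS : Integrable S) : Integrable φ := by
  have : φ = fun x => S x - conv (poisson (π / 2) (π / 2 - ζ)) (cutIn q φ) x := funext h.eq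
  rw [this]
  exact hS.sub (conv_integrable (poisson_integrable (abs_height_lt h0 h1))
    (cutIn_integrable q h.continuous))

lemma IsDressed.bounded {ζ q : ℝ} {S φ : ℝ → ℝ} (h : IsDressed ζ q S φ) (h0 : 0 < ζ)
    (h1 : ζ < π) {C : ℝ} (hS : ∀ x, |S x| ≤ C) : ∃ C, 0 ≤ C ∧ ∀ x, |φ x| ≤ C := by
  obtain ⟨C', hC', h'⟩ := poisson_bounded (abs_height_lt h0 h1)
  have hb := conv_bounded h' (cutIn_integrable q h.continuous)
  refine ⟨C + C' * ∫ t, |cutIn q φ t|, ?_, fun x => ?_⟩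
  · have := (abs_nonneg _).trans (hS 0)
    have := (abs_nonneg _).trans (hb 0)
    linarith
  · rw [h.eq x]
    exact (abs_sub _ _).trans (add_le_add (hS x) (hb x))

lemma two_sinh_mul_cosh (a b : ℝ) : 2 * sinh a * cosh b = sinh (a + b) + sinh (a - b) := by
  rw [sinh_add, sinh_sub]; ring

/-- A dressed quantity on a line is the convolution of the Poisson kernel of the strip of half-width
`(π-ζ)/2` with the dressed quantity of the real axis *outside* the Fermi zone. Both sides have
Fourier transform `sinh(kD) / sinh(k(π-ζ)/2)` times that of `φ 1_{ℝ ∖ [-q,q]}`. -/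
theorem dressedLine_eq_conv_cutOut {ζ q D : ℝ} (h0 : 0 < ζ) (h1 : ζ < π)
    (hD : |D| < (π - ζ) / 2) {S S_D φ : ℝ → ℝ} (hφ : IsDressed ζ q S φ) (hSi : Integrable S)
    (hSDc : Continuous S_D) (hSDi : Integrable S_D) (m : ℝ → ℂ)
    (hS : ∀ w, w ≠ 0 → ft S w = m w * ft (poisson (π / 2) ((π - ζ) / 2)) w)
    (hSD : ∀ w, w ≠ 0 → ft S_D w = m w * ft (poisson (π / 2) D) w) :
    dressedLine ζ q D S_D φ = conv (poisson ((π - ζ) / 2) D) (cutOut q φ) := by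
  have hi := hφ.integrable h0 h1 hSi
  have hin := cutIn_integrable q hφ.continuous
  have hout := cutOut_integrable q hi
  obtain ⟨hD1, hD2⟩ := abs_lt.1 hD
  have hDp : |D + ζ / 2| < π / 2 := by rw [abs_lt]; constructor <;> linarith
  have hDm : |D - ζ / 2| < π / 2 := by rw [abs_lt]; constructor <;> linarith
  have hDpi : |D| < π / 2 := by rw [abs_lt]; constructor <;> linarith
  have hDz : |(π - ζ) / 2| < π / 2 := by rw [abs_lt]; constructor <;> linarith
  have hK := abs_height_lt h0 h1
  obtain ⟨Cp, -, hCp⟩ := poisson_bounded hDp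
  obtain ⟨Cm, -, hCm⟩ := poisson_bounded hDm
  obtain ⟨CT, -, hCT⟩ := poisson_bounded hD
  have ip := conv_integrable (poisson_integrable hDp) hin
  have im := conv_integrable (poisson_integrable hDm) hin
  have ipm : Integrable fun x => conv (poisson (π / 2) (D + ζ / 2)) (cutIn q φ) x
      + conv (poisson (π / 2) (D - ζ / 2)) (cutIn q φ) x := ip.add im
  refine eq_of_ft_eq ?_ (conv_continuous (poisson_continuous _ _) hCT hout)
    (hSDi.sub (ip.add im)) (conv_integrable (poisson_integrable hD) hout) fun w hw => ?_
  · exact hSDc.sub ((conv_continuous (poisson_continuous _ _) hCp hin).add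
      (conv_continuous (poisson_continuous _ _) hCm hin))
  have e1 : ft (dressedLine ζ q D S_D φ) w = m w * ft (poisson (π / 2) D) w
      - (ft (poisson (π / 2) (D + ζ / 2)) w + ft (poisson (π / 2) (D - ζ / 2)) w)
        * ft (cutIn q φ) w := by
    rw [← hSD w hw, add_mul, ← ft_conv (poisson_integrable hDp) hin,
      ← ft_conv (poisson_integrable hDm) hin, ← ft_add ip im, ← ft_sub hSDi ipm]
    rfl
  have e2 : ft φ w = m w * ft (poisson (π / 2) ((π - ζ) / 2)) w
      - ft (poisson (π / 2) (π / 2 - ζ)) w * ft (cutIn q φ) w := by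
    rw [← hS w hw, ← ft_conv (poisson_integrable hK) hin,
      ← ft_sub hSi (conv_integrable (poisson_integrable hK) hin)]
    exact congrArg (fun f => ft f w) (funext hφ.eq)
  have e3 : ft φ w = ft (cutIn q φ) w + ft (cutOut q φ) w := by
    rw [← ft_add hin hout]
    exact congrArg (fun f => ft f w) (funext fun x => (cutIn_add_cutOut q φ x).symm)
  have e4 : ft (cutOut q φ) w = m w * ft (poisson (π / 2) ((π - ζ) / 2)) w
      - ft (poisson (π / 2) (π / 2 - ζ)) w * ft (cutIn q φ) w - ft (cutIn q φ) w := by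
    rw [← e2, e3]; ring
  rw [e1, ft_conv (poisson_integrable hD) hout, e4, ft_poisson hDpi hw, ft_poisson hDp hw,
    ft_poisson hDm hw, ft_poisson hDz hw, ft_poisson hK hw, ft_poisson hD hw]
  set t := 2 * π * w with ht
  have ht0 : t ≠ 0 := by positivity
  have n1 : sinh (t * (π / 2)) ≠ 0 := by rw [Ne, sinh_eq_zero]; positivity
  have n2 : sinh (t * ((π - ζ) / 2)) ≠ 0 := by
    rw [Ne, sinh_eq_zero]
    have : (π - ζ) / 2 ≠ 0 := by linarith
    positivity
  have s1 : sinh (t * (D + ζ / 2)) + sinh (t * (D - ζ / 2))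
      = 2 * sinh (t * D) * cosh (t * (ζ / 2)) := by
    rw [two_sinh_mul_cosh]; congr 2 <;> ring
  have s2 : sinh (t * (π / 2)) + sinh (t * (π / 2 - ζ))
      = 2 * sinh (t * ((π - ζ) / 2)) * cosh (t * (ζ / 2)) := by
    rw [two_sinh_mul_cosh]; congr 2 <;> ring
  have n1c : ((sinh (t * (π / 2)) : ℝ) : ℂ) ≠ 0 := by exact_mod_cast n1
  have n2c : ((sinh (t * ((π - ζ) / 2)) : ℝ) : ℂ) ≠ 0 := by exact_mod_cast n2
  have s1c := congrArg (fun x : ℝ => (x : ℂ)) s1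
  have s2c := congrArg (fun x : ℝ => (x : ℂ)) s2
  simp only [Complex.ofReal_add, Complex.ofReal_mul, Complex.ofReal_ofNat] at s1c s2c
  simp only [Complex.ofReal_div]
  -- what is left is a rational identity between the values of the hyperbolic functions
  generalize ((sinh (t * (D + ζ / 2)) : ℝ) : ℂ) = a1 at *
  generalize ((sinh (t * (D - ζ / 2)) : ℝ) : ℂ) = a2 at *
  generalize ((sinh (t * (π / 2)) : ℝ) : ℂ) = a3 at *
  generalize ((sinh (t * (π / 2 - ζ)) : ℝ) : ℂ) = a4 at *
  generalize ((sinh (t * ((π - ζ) / 2)) : ℝ) : ℂ) = a5 at *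
  generalize ((sinh (t * D) : ℝ) : ℂ) = a6 at *
  generalize ((cosh (t * (ζ / 2)) : ℝ) : ℂ) = a7 at *
  generalize ft (cutIn q φ) w = F at *
  have e : a4 = 2 * a5 * a7 - a3 := by linear_combination s2c
  have e' : a1 = 2 * a6 * a7 - a2 := by linear_combination s1c
  rw [e', e]
  field_simp
  ring

/-- For `ζ < π/2` the dressing equation on `[-q, q]` turns, by inversion of `1 + K(· ∣ ζ)` on the
whole line, into an equation with *positive* kernels acting on the outside of the Fermi zone. -/
theorem IsDressed.eq_add_conv_conv {ζ q : ℝ} (h0 : 0 < ζ) (h1 : ζ < π / 2)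
    {S S_s φ : ℝ → ℝ} (hφ : IsDressed ζ q S φ) (hSi : Integrable S)
    (hSsc : Continuous S_s) (hSsi : Integrable S_s) (m : ℝ → ℂ)
    (hS : ∀ w, w ≠ 0 → ft S w = m w * ft (poisson (π / 2) ((π - ζ) / 2)) w)
    (hSs : ∀ w, w ≠ 0 → ft S_s w = m w * ft (poisson ζ (ζ / 2)) w) (x : ℝ) :
    φ x = S_s x + conv (poisson ζ (ζ / 2))
      (conv (poisson ((π - ζ) / 2) (π / 2 - ζ)) (cutOut q φ)) x := by
  have h1' : ζ < π := by linarith [pi_pos]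
  have hi := hφ.integrable h0 h1' hSi
  have hin := cutIn_integrable q hφ.continuous
  have hout := cutOut_integrable q hi
  have hD : |π / 2 - ζ| < (π - ζ) / 2 := by rw [abs_lt]; constructor <;> linarith
  have hDz : |(π - ζ) / 2| < π / 2 := by rw [abs_lt]; constructor <;> linarith
  have hs : |ζ / 2| < ζ := by rw [abs_lt]; constructor <;> linarith
  have hK := abs_height_lt h0 h1'
  obtain ⟨Cs, -, hCs⟩ := poisson_bounded hs
  have iT := conv_integrable (poisson_integrable hD) hout
  have is := conv_integrable (poisson_integrable hs) iT
  have key : φ = fun x => S_s x + conv (poisson ζ (ζ / 2))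
      (conv (poisson ((π - ζ) / 2) (π / 2 - ζ)) (cutOut q φ)) x := by
    refine eq_of_ft_eq hφ.continuous
      (hSsc.add (conv_continuous (poisson_continuous _ _) hCs iT)) hi (hSsi.add is) fun w hw => ?_
    have e2 : ft φ w = m w * ft (poisson (π / 2) ((π - ζ) / 2)) w
        - ft (poisson (π / 2) (π / 2 - ζ)) w * ft (cutIn q φ) w := by
      rw [← hS w hw, ← ft_conv (poisson_integrable hK) hin,
        ← ft_sub hSi (conv_integrable (poisson_integrable hK) hin)]
      exact congrArg (fun f => ft f w) (funext hφ.eq)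
    have e3 : ft φ w = ft (cutIn q φ) w + ft (cutOut q φ) w := by
      rw [← ft_add hin hout]
      exact congrArg (fun f => ft f w) (funext fun x => (cutIn_add_cutOut q φ x).symm)
    have e4 : ft (cutOut q φ) w = m w * ft (poisson (π / 2) ((π - ζ) / 2)) w
        - ft (poisson (π / 2) (π / 2 - ζ)) w * ft (cutIn q φ) w - ft (cutIn q φ) w := by
      rw [← e2, e3]; ring
    rw [ft_add hSsi is, hSs w hw, ft_conv (poisson_integrable hs) iT,
      ft_conv (poisson_integrable hD) hout, e4, e2, ft_poisson hDz hw, ft_poisson hK hw,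
      ft_poisson hD hw, ft_poisson hs hw]
    set t := 2 * π * w with ht
    have ht0 : t ≠ 0 := by positivity
    have n1 : sinh (t * (π / 2)) ≠ 0 := by rw [Ne, sinh_eq_zero]; positivity
    have n2 : sinh (t * ((π - ζ) / 2)) ≠ 0 := by
      rw [Ne, sinh_eq_zero]
      have : (π - ζ) / 2 ≠ 0 := by linarith
      positivity
    have n3 : sinh (t * (ζ / 2)) ≠ 0 := by rw [Ne, sinh_eq_zero]; positivity
    have n4 : cosh (t * (ζ / 2)) ≠ 0 := (cosh_pos _).ne'
    have s1 : sinh (t * ζ) = 2 * sinh (t * (ζ / 2)) * cosh (t * (ζ / 2)) := by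
      rw [two_sinh_mul_cosh, sub_self, sinh_zero, add_zero]; congr 1; ring
    have s2 : sinh (t * (π / 2)) + sinh (t * (π / 2 - ζ))
        = 2 * sinh (t * ((π - ζ) / 2)) * cosh (t * (ζ / 2)) := by
      rw [two_sinh_mul_cosh]; congr 2 <;> ring
    rw [s1]
    have n1c : ((sinh (t * (π / 2)) : ℝ) : ℂ) ≠ 0 := by exact_mod_cast n1
    have n2c : ((sinh (t * ((π - ζ) / 2)) : ℝ) : ℂ) ≠ 0 := by exact_mod_cast n2
    have n3c : ((sinh (t * (ζ / 2)) : ℝ) : ℂ) ≠ 0 := by exact_mod_cast n3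
    have n4c : ((cosh (t * (ζ / 2)) : ℝ) : ℂ) ≠ 0 := by exact_mod_cast n4
    have s2c := congrArg (fun x : ℝ => (x : ℂ)) s2
    simp only [Complex.ofReal_add, Complex.ofReal_mul, Complex.ofReal_ofNat] at s2c
    simp only [Complex.ofReal_div, Complex.ofReal_mul, Complex.ofReal_ofNat]
    -- what is left is a rational identity between the values of the hyperbolic functions
    generalize ((sinh (t * (π / 2)) : ℝ) : ℂ) = a3 at *
    generalize ((sinh (t * (π / 2 - ζ)) : ℝ) : ℂ) = a4 at *
    generalize ((sinh (t * ((π - ζ) / 2)) : ℝ) : ℂ) = a5 at *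
    generalize ((sinh (t * (ζ / 2)) : ℝ) : ℂ) = a6 at *
    generalize ((cosh (t * (ζ / 2)) : ℝ) : ℂ) = a7 at *
    generalize ft (cutIn q φ) w = F at *
    have e : a4 = 2 * a5 * a7 - a3 := by linear_combination s2c
    rw [e]
    field_simp
    ring
  exact congrFun key x

/-! ### Positivity tools for unimodal kernels -/

lemma integral_abs_poisson {M D : ℝ} (hD : |D| < M) : ∫ x, |poisson M D x| = |D| / M := by
  rcases lt_trichotomy D 0 with h | h | h
  · rw [abs_of_neg h] at hD ⊢
    rw [← integral_poisson_of_pos (by linarith : 0 < -D) hD]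
    congr 1; ext x
    rw [← abs_of_pos (poisson_pos (by linarith : 0 < -D) hD x), poisson_neg_height, abs_neg]
  · simp [h, poisson_zero_height]
  · rw [abs_of_pos h] at hD ⊢
    rw [← integral_poisson_of_pos h hD]
    congr 1; ext x
    exact abs_of_pos (poisson_pos h hD x)

lemma integral_poisson {M D : ℝ} (hD : 0 ≤ D) (hDM : D < M) : ∫ x, poisson M D x = D / M := by
  rcases hD.eq_or_lt with h | h
  · simp [← h, poisson_zero_height]
  · exact integral_poisson_of_pos h hDM

/-- If `φ = G + A` with `G ≥ 0` and each lower bound `-m` of `φ` improves to a lower bound `-ρ m`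
of `A`, then `A ≥ 0`. -/
lemma nonneg_of_contraction {s : Set ℝ} {φ G A : ℝ → ℝ} {ρ C : ℝ} (hρ0 : 0 ≤ ρ) (hρ1 : ρ < 1)
    (h : ∀ x ∈ s, φ x = G x + A x) (hG : ∀ x ∈ s, 0 ≤ G x)
    (hA : ∀ m, 0 ≤ m → (∀ x ∈ s, -m ≤ φ x) → ∀ x ∈ s, -(ρ * m) ≤ A x) (hC0 : 0 ≤ C)
    (hC : ∀ x ∈ s, -C ≤ φ x) : ∀ x ∈ s, 0 ≤ A x := by
  have key : ∀ n : ℕ, ∀ x ∈ s, -(ρ ^ n * C) ≤ φ x := by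
    intro n
    induction n with
    | zero => simpa using hC
    | succ n ih =>
      intro x hx
      have := hA _ (by positivity) ih x hx
      rw [h x hx, pow_succ']
      linarith [hG x hx, mul_assoc ρ (ρ ^ n) C]
  intro x hx
  have h1 : ∀ n : ℕ, -(ρ * (ρ ^ n * C)) ≤ A x := fun n => hA _ (by positivity) (key n) x hx
  have h2 : Tendsto (fun n : ℕ => -(ρ * (ρ ^ n * C))) atTop (𝓝 (-(ρ * (0 * C)))) :=
    (((tendsto_pow_atTop_nhds_zero_of_lt_one hρ0 hρ1).mul_const C).const_mul ρ).neg
  rw [zero_mul, mul_zero, neg_zero] at h2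
  exact le_of_tendsto' h2 h1

/-- The properties of a Poisson kernel of nonnegative height which the positivity argument uses. -/
structure IsBumpKernel (k : ℝ → ℝ) : Prop where
  continuous : Continuous k
  integrable : Integrable k
  bounded : ∃ C, ∀ x, |k x| ≤ C
  nonneg : ∀ x, 0 ≤ k x
  even : ∀ x, k (-x) = k x
  unimodal : ∀ x y, 0 < x → 0 < y → k (x + y) ≤ k (x - y)

lemma isBumpKernel_poisson {M D : ℝ} (hD : 0 ≤ D) (hDM : D < M) : IsBumpKernel (poisson M D) where
  continuous := poisson_continuous _ _
  integrable := poisson_integrable (by rwa [abs_of_nonneg hD])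
  bounded := by
    obtain ⟨C, -, h⟩ := poisson_bounded (M := M) (D := D) (by rwa [abs_of_nonneg hD])
    exact ⟨C, h⟩
  nonneg := poisson_nonneg hD hDM
  even := poisson_neg _ _
  unimodal := fun _ _ hx hy => poisson_add_le_sub hD hDM hx hy

lemma IsBumpKernel.integrand {k φ : ℝ → ℝ} (hk : IsBumpKernel k) (hφ : Integrable φ) (x : ℝ) :
    Integrable fun t => k (x - t) * φ t := by
  obtain ⟨C, hC⟩ := hk.bounded
  exact conv_integrand_integrable hk.continuous hC hφ x

lemma conv_neg_of_odd {k φ : ℝ → ℝ} (hk : ∀ x, k (-x) = k x) (hφ : ∀ x, φ (-x) = -φ x) (x : ℝ) :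
    conv k φ (-x) = -conv k φ x := by
  unfold conv
  rw [← integral_neg_eq_self, ← integral_neg]
  congr 1; ext t
  rw [hφ, ← hk (-x - -t)]
  ring_nf

lemma conv_neg_of_even {k φ : ℝ → ℝ} (hk : ∀ x, k (-x) = k x) (hφ : ∀ x, φ (-x) = φ x) (x : ℝ) :
    conv k φ (-x) = conv k φ x := by
  unfold conv
  rw [← integral_neg_eq_self]
  congr 1; ext t
  rw [hφ, ← hk (-x - -t)]
  ring_nf

lemma IsBumpKernel.conv_ge {k φ : ℝ → ℝ} (hk : IsBumpKernel k) (hφ : Integrable φ) {m : ℝ}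
    (h : ∀ x, -m ≤ φ x) (x : ℝ) : -((∫ t, k t) * m) ≤ conv k φ x := by
  have h1 : ∫ t, k (x - t) * (-m) = -((∫ t, k t) * m) := by
    rw [integral_mul_const, integral_sub_left_eq_self]; ring
  rw [← h1]
  refine integral_mono ((hk.integrable.comp_sub_left x).mul_const _) (hk.integrand hφ x)
    fun t => mul_le_mul_of_nonneg_left (h t) (hk.nonneg _)

lemma conv_eq_integral_Ioi {k φ : ℝ → ℝ} (hφ : ∀ x, φ (-x) = -φ x) (x : ℝ)
    (hi : Integrable fun t => k (x - t) * φ t) :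
    conv k φ x = ∫ t in Set.Ioi (0 : ℝ), (k (x - t) - k (x + t)) * φ t := by
  have h1 := integral_comp_neg_Iic (0 : ℝ) (fun t => k (x + t) * -φ t)
  rw [neg_zero] at h1
  have h2 : ∀ t, k (x + -t) * -φ (-t) = k (x - t) * φ t := fun t => by
    rw [hφ, neg_neg, ← sub_eq_add_neg]
  simp only [h2] at h1
  have hi' : Integrable fun t => k (x + t) * -φ t := by
    have := hi.comp_neg
    refine this.congr (Eventually.of_forall fun t => ?_)
    simp [hφ]
  rw [conv, ← intervalIntegral.integral_Iic_add_Ioi hi.integrableOn hi.integrableOn, h1,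
    ← integral_add hi'.integrableOn hi.integrableOn]
  congr 1; ext t; ring

lemma IsBumpKernel.conv_ge_of_odd {k φ : ℝ → ℝ} (hk : IsBumpKernel k) (hφ : Integrable φ)
    (hodd : ∀ x, φ (-x) = -φ x) {m : ℝ} (hm : 0 ≤ m)
    (h : ∀ x, 0 < x → -m ≤ φ x) {x : ℝ} (hx : 0 < x) : -((∫ t, k t) * m) ≤ conv k φ x := by
  have hi := hk.integrand hφ x
  have hk1 : Integrable fun t => k (x - t) := hk.integrable.comp_sub_left x
  have hk2 : Integrable fun t => k (x + t) := hk.integrable.comp_add_left x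
  obtain ⟨C, hC⟩ := hk.bounded
  have hi2 : Integrable fun t => (k (x - t) - k (x + t)) * φ t := by
    have hkc := hk.continuous
    refine hφ.bdd_mul (c := C + C) (Continuous.aestronglyMeasurable (by fun_prop))
      (Eventually.of_forall fun t => ?_)
    exact (abs_sub _ _).trans (add_le_add (hC _) (hC _))
  rw [conv_eq_integral_Ioi hodd x hi]
  calc -((∫ t, k t) * m) = (∫ t, k (x - t)) * (-m) := by rw [integral_sub_left_eq_self]; ring
    _ ≤ (∫ t in Set.Ioi (0 : ℝ), (k (x - t) - k (x + t))) * (-m) := by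
        refine mul_le_mul_of_nonpos_right ?_ (by linarith)
        calc ∫ t in Set.Ioi (0 : ℝ), (k (x - t) - k (x + t))
            ≤ ∫ t in Set.Ioi (0 : ℝ), k (x - t) :=
              integral_mono (hk1.sub hk2).integrableOn hk1.integrableOn
                fun t => by simpa using hk.nonneg _
          _ ≤ ∫ t, k (x - t) := setIntegral_le_integral hk1
              (Eventually.of_forall fun t => hk.nonneg _)
    _ = ∫ t in Set.Ioi (0 : ℝ), (k (x - t) - k (x + t)) * (-m) := by rw [integral_mul_const]
    _ ≤ _ := by
        refine setIntegral_mono_on ((hk1.sub hk2).mul_const _).integrableOn hi2.integrableOn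
          measurableSet_Ioi fun t ht => ?_
        exact mul_le_mul_of_nonneg_left (h t ht) (sub_nonneg.2 (hk.unimodal x t hx ht))

/-- A lower bound for the Poisson kernel. -/
lemma poisson_ge {M D : ℝ} (hD : 0 < D) (hDM : D < M) (x : ℝ) :
    sin (π * D / M) / (4 * M) * exp (-(π / M * |x|)) ≤ poisson M D x := by
  have hM : 0 < M := hD.trans hDM
  have hs := sin_angle_pos hD hDM
  have h0 := denom_pos (M := M) (D := D) (by rwa [abs_of_pos hD]) x
  have h1 : cosh (π * x / M) ≤ exp (π / M * |x|) := by
    have : |π * x / M| = π / M * |x| := by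
      rw [abs_div, abs_mul, abs_of_pos pi_pos, abs_of_pos hM]; ring
    rw [← cosh_abs, this, cosh_eq]
    have h2 : exp (-(π / M * |x|)) ≤ exp (π / M * |x|) := exp_le_exp.2 (by
      have : 0 ≤ π / M * |x| := by positivity
      linarith)
    linarith
  have h2 : cosh (π * x / M) + cos (π * D / M) ≤ 2 * exp (π / M * |x|) := by
    have := cos_le_one (π * D / M)
    have := one_le_cosh (π * x / M)
    linarith
  rw [poisson, exp_neg, ← div_eq_mul_inv, div_div]
  apply div_le_div_of_nonneg_left hs.le (by positivity)
  nlinarith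

lemma neg_poissonDeriv_ge {M D : ℝ} (hD : 0 < D) (hDM : D < M) : ∃ c, 0 < c ∧ ∀ x, 0 ≤ x →
    c * (sinh (π / M * x) * exp (-(2 * (π / M * x)))) ≤ -poissonDeriv M D x := by
  have hM : 0 < M := hD.trans hDM
  have hs := sin_angle_pos hD hDM
  refine ⟨sin (π * D / M) * (π / M) / (8 * M), by positivity, fun x hx => ?_⟩
  have h0 := denom_pos (M := M) (D := D) (by rwa [abs_of_pos hD]) x
  have hy : π * x / M = π / M * x := by ring
  rw [poissonDeriv, neg_div, neg_neg, hy]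
  rw [hy] at h0
  have hyp : 0 ≤ π / M * x := by positivity
  set y := π / M * x with hydef
  have h1 : cosh y + cos (π * D / M) ≤ 2 * exp y := by
    rw [cosh_eq]
    have h2 : exp (-y) ≤ exp y := exp_le_exp.2 (by linarith)
    have h3 : 1 ≤ exp y := one_le_exp hyp
    linarith [cos_le_one (π * D / M)]
  have hsh : 0 ≤ sinh y := sinh_nonneg_iff.2 hyp
  calc _ = sin (π * D / M) * (π / M) * sinh y / (2 * M * (2 * exp y) ^ 2) := by
        rw [exp_neg, show 2 * y = y + y by ring, exp_add]
        field_simp; ring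
    _ ≤ _ := by gcongr

/-- The profile `sinh(γx) e^{-2γx}`. It vanishes to first order at the origin and is of order
`e^{-γx}` at infinity, so that it can serve as a lower bound at both ends of `[0, ∞)`. -/
noncomputable def profile (γ x : ℝ) : ℝ := sinh (γ * x) * exp (-(2 * (γ * x)))

lemma profile_pos {γ x : ℝ} (hγ : 0 < γ) (hx : 0 < x) : 0 < profile γ x :=
  mul_pos (sinh_pos_iff.2 (by positivity)) (exp_pos _)

lemma profile_nonneg {γ x : ℝ} (hγ : 0 < γ) (hx : 0 ≤ x) : 0 ≤ profile γ x :=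
  mul_nonneg (sinh_nonneg_iff.2 (by positivity)) (exp_pos _).le

lemma profile_le_exp (γ x : ℝ) : profile γ x ≤ exp (-(γ * x)) := by
  have h1 : sinh (γ * x) ≤ exp (γ * x) := by
    rw [sinh_eq]; linarith [exp_pos (-(γ * x)), exp_pos (γ * x)]
  have h2 : profile γ x ≤ exp (γ * x) * exp (-(2 * (γ * x))) := by
    unfold profile; gcongr
  rw [← exp_add] at h2
  exact h2.trans_eq (by congr 1; ring)

lemma profile_le_one {γ x : ℝ} (hγ : 0 < γ) (hx : 0 ≤ x) : profile γ x ≤ 1 :=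
  (profile_le_exp γ x).trans (exp_le_one_iff.2 (neg_nonpos.2 (by positivity)))

lemma conv_poisson_ge_of_even {M D q : ℝ} (hD : 0 < D) (hDM : D < M) {φ : ℝ → ℝ}
    (hφ : Integrable φ) (h0 : ∀ x, 0 ≤ φ x) (h1 : ∀ x, q < x → 0 < φ x) :
    ∃ c, 0 < c ∧ ∀ x, 0 ≤ x → c * exp (-(π / M * x)) ≤ conv (poisson M D) φ x := by
  have hM : 0 < M := hD.trans hDM
  have hs := sin_angle_pos hD hDM
  have hi : Integrable fun t => exp (-(π / M * |t|)) * φ t := by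
    refine hφ.bdd_mul (c := 1) (Continuous.aestronglyMeasurable (by fun_prop))
      (Eventually.of_forall fun t => ?_)
    rw [norm_of_nonneg (exp_pos _).le]
    refine exp_le_one_iff.2 ?_
    have : 0 ≤ π / M * |t| := by positivity
    linarith
  have hpos : 0 < ∫ t, exp (-(π / M * |t|)) * φ t := by
    rw [integral_pos_iff_support_of_nonneg (fun t => mul_nonneg (exp_pos _).le (h0 t)) hi]
    have : Set.Ioi q ⊆ Function.support fun t => exp (-(π / M * |t|)) * φ t := fun t ht =>
      (mul_pos (exp_pos _) (h1 t ht)).ne'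
    exact lt_of_lt_of_le (by simp) (measure_mono this)
  refine ⟨sin (π * D / M) / (4 * M) * ∫ t, exp (-(π / M * |t|)) * φ t, by positivity,
    fun x hx => ?_⟩
  rw [mul_assoc, mul_comm _ (exp _), ← integral_const_mul, ← integral_const_mul]
  refine integral_mono ((hi.const_mul _).const_mul _)
    ((isBumpKernel_poisson hD.le hDM).integrand hφ x) fun t => ?_
  refine le_trans ?_ (mul_le_mul_of_nonneg_right (poisson_ge hD hDM (x - t)) (h0 t))
  have h2 : exp (-(π / M * x)) * exp (-(π / M * |t|)) ≤ exp (-(π / M * |x - t|)) := by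
    rw [← exp_add]
    apply exp_le_exp.2
    have : |x - t| ≤ x + |t| := by
      have := abs_sub x t; rwa [abs_of_nonneg hx] at this
    have : π / M * |x - t| ≤ π / M * (x + |t|) := by gcongr
    linarith
  calc _ = sin (π * D / M) / (4 * M) * (exp (-(π / M * x)) * exp (-(π / M * |t|))) * φ t := by ring
    _ ≤ _ := by
      have := h0 t
      gcongr

lemma conv_poisson_ge_of_odd {M D q : ℝ} (hD : 0 < D) (hDM : D < M) {φ : ℝ → ℝ}
    (hφ : Integrable φ) (hodd : ∀ x, φ (-x) = -φ x) (hq : 0 ≤ q) (h0 : ∀ x, 0 < x → 0 ≤ φ x)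
    (h1 : ∀ x, q < x → 0 < φ x) :
    ∃ c, 0 < c ∧ ∀ x, 0 ≤ x → c * profile (π / M) x ≤ conv (poisson M D) φ x := by
  have hM : 0 < M := hD.trans hDM
  have hs := sin_angle_pos hD hDM
  have hγ : 0 < π / M := by positivity
  set γ := π / M with hγdef
  have hk := isBumpKernel_poisson hD.le hDM
  have hi : IntegrableOn (fun t => profile γ t * φ t) (Set.Ioi 0) := by
    refine hφ.integrableOn.bdd_mul (c := 1)
      (Continuous.aestronglyMeasurable (by unfold profile; fun_prop))
      ((ae_restrict_iff' measurableSet_Ioi).2 (Eventually.of_forall fun t ht => ?_))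
    rw [norm_of_nonneg (profile_nonneg hγ (le_of_lt ht))]
    exact profile_le_one hγ (le_of_lt ht)
  have hpos : 0 < ∫ t in Set.Ioi (0 : ℝ), profile γ t * φ t := by
    rw [setIntegral_pos_iff_support_of_nonneg_ae ((ae_restrict_iff' measurableSet_Ioi).2
      (Eventually.of_forall fun t ht => mul_nonneg (profile_nonneg hγ (le_of_lt ht)) (h0 t ht))) hi]
    have : Set.Ioi q ⊆ (Function.support fun t => profile γ t * φ t) ∩ Set.Ioi 0 := fun t ht =>
      ⟨(mul_pos (profile_pos hγ (lt_of_le_of_lt hq ht)) (h1 t ht)).ne', lt_of_le_of_lt hq ht⟩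
    exact lt_of_lt_of_le (by simp) (measure_mono this)
  refine ⟨sin (π * D / M) / (4 * M) * ∫ t in Set.Ioi (0 : ℝ), profile γ t * φ t, by positivity,
    fun x hx => ?_⟩
  have hint := hk.integrand hφ x
  rw [conv_eq_integral_Ioi hodd x hint]
  have hi2 : Integrable fun t => (poisson M D (x - t) - poisson M D (x + t)) * φ t := by
    obtain ⟨C, hC⟩ := hk.bounded
    have hkc := hk.continuous
    refine hφ.bdd_mul (c := C + C) (Continuous.aestronglyMeasurable (by fun_prop))
      (Eventually.of_forall fun t => ?_)
    exact (abs_sub _ _).trans (add_le_add (hC _) (hC _))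
  rw [mul_assoc, mul_comm _ (profile _ _), ← integral_const_mul, ← integral_const_mul]
  refine setIntegral_mono_on ((hi.const_mul _).const_mul _) hi2.integrableOn measurableSet_Ioi
    fun t ht => ?_
  have ht' : 0 < t := ht
  rw [poisson_sub_add M D x t hs.ne' hM.ne']
  have hbound : ∀ y : ℝ, |y| ≤ x + t →
      cosh (π * y / M) + cos (π * D / M) ≤ 2 * exp (γ * (x + t)) := by
    intro y hy
    have e : |π * y / M| = γ * |y| := by
      rw [abs_div, abs_mul, abs_of_pos pi_pos, abs_of_pos hM, hγdef]; ring
    have h2 : cosh (π * y / M) ≤ cosh (γ * (x + t)) := by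
      rw [cosh_le_cosh, e, abs_of_nonneg (by positivity : 0 ≤ γ * (x + t))]
      gcongr
    have h3 : cosh (γ * (x + t)) ≤ exp (γ * (x + t)) := by
      rw [cosh_eq]
      have : exp (-(γ * (x + t))) ≤ exp (γ * (x + t)) := exp_le_exp.2 (by
        have : 0 ≤ γ * (x + t) := by positivity
        linarith)
      linarith
    have h4 : 1 ≤ exp (γ * (x + t)) := one_le_exp (by positivity)
    linarith [cos_le_one (π * D / M)]
  have hDabs : |D| < M := by rwa [abs_of_pos hD]
  have d1 := denom_pos hDabs (x - t)
  have d2 := denom_pos hDabs (x + t)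
  have b1 := hbound (x - t) (by rw [abs_le]; constructor <;> linarith)
  have b2 := hbound (x + t) (by rw [abs_of_nonneg (by positivity)])
  have e1 : π * x / M = γ * x := by rw [hγdef]; ring
  have e2 : π * t / M = γ * t := by rw [hγdef]; ring
  rw [e1, e2]
  have s1 : 0 ≤ sinh (γ * x) := sinh_nonneg_iff.2 (by positivity)
  have s2 : 0 ≤ sinh (γ * t) := sinh_nonneg_iff.2 (by positivity)
  have hφt := h0 t ht'
  calc _ = sin (π * D / M) / M * (sinh (γ * x) * sinh (γ * t)) /
        ((2 * exp (γ * (x + t))) * (2 * exp (γ * (x + t)))) * φ t := by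
        unfold profile
        rw [exp_neg, exp_neg, mul_add γ, exp_add, show 2 * (γ * x) = γ * x + γ * x by ring,
          show 2 * (γ * t) = γ * t + γ * t by ring, exp_add (γ * x) (γ * x),
          exp_add (γ * t) (γ * t)]
        field_simp; ring
    _ ≤ _ := by gcongr

/-! ### Uniqueness and positivity on the real axis -/

lemma conv_nonneg_of_even {k φ : ℝ → ℝ} (hk : IsBumpKernel k) (h : ∀ x, 0 ≤ φ x) (x : ℝ) :
    0 ≤ conv k φ x :=
  integral_nonneg fun t => mul_nonneg (hk.nonneg _) (h t)

lemma conv_nonneg_of_odd {k φ : ℝ → ℝ} (hk : IsBumpKernel k) (hφ : Integrable φ)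
    (hodd : ∀ x, φ (-x) = -φ x) (h : ∀ x, 0 < x → 0 ≤ φ x) {x : ℝ} (hx : 0 < x) :
    0 ≤ conv k φ x := by
  simpa using hk.conv_ge_of_odd hφ hodd le_rfl (by simpa using h) hx

lemma conv_neg_kernel (k φ : ℝ → ℝ) (x : ℝ) : conv (fun y => -k y) φ x = -conv k φ x := by
  simp [conv, integral_neg]

lemma poisson_height_sub (ζ : ℝ) :
    poisson (π / 2) (π / 2 - ζ) = fun x => -poisson (π / 2) (ζ - π / 2) x := by
  ext x; rw [← poisson_neg_height, neg_sub]

/-- The solution of the dressing equation is unique; hence it inherits the parity of its source. -/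
lemma IsDressed.unique {ζ q : ℝ} {S φ ψ : ℝ → ℝ} (h0 : 0 < ζ) (h1 : ζ < π)
    (hφ : IsDressed ζ q S φ) (hψ : IsDressed ζ q S ψ) : φ = ψ := by
  have hK := abs_height_lt h0 h1
  obtain ⟨C, hC, hb⟩ := poisson_bounded hK
  set k := poisson (π / 2) (π / 2 - ζ) with hk
  have hkc : Continuous k := poisson_continuous _ _
  have hiφ := cutIn_integrable q hφ.continuous
  have hiψ := cutIn_integrable q hψ.continuous
  have hd : ∀ x, φ x - ψ x = -∫ t, k (x - t) * (cutIn q φ t - cutIn q ψ t) := by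
    intro x
    simp only [mul_sub]
    rw [integral_sub (conv_integrand_integrable hkc hb hiφ x)
      (conv_integrand_integrable hkc hb hiψ x), hφ.eq x, hψ.eq x]
    simp only [conv]; ring
  have hcut : ∀ m, 0 ≤ m → (∀ x, |φ x - ψ x| ≤ m) → ∀ t, |cutIn q φ t - cutIn q ψ t| ≤ m := by
    intro m hm h t
    by_cases ht : t ∈ Set.Icc (-q) q
    · simpa [cutIn, Set.indicator_of_mem ht] using h t
    · simpa [cutIn, Set.indicator_of_notMem ht] using hm
  set ρ : ℝ := |π / 2 - ζ| / (π / 2) with hρ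
  have hρ0 : 0 ≤ ρ := by positivity
  have hρ1 : ρ < 1 := by rw [hρ, div_lt_one (by positivity)]; exact hK
  have step : ∀ m, 0 ≤ m → (∀ x, |φ x - ψ x| ≤ m) → ∀ x, |φ x - ψ x| ≤ ρ * m := by
    intro m hm h x
    have e : ∫ t, |k (x - t)| = ρ := by
      rw [integral_sub_left_eq_self (fun t => |k t|)]; exact integral_abs_poisson hK
    rw [hd x, abs_neg, ← e, ← integral_mul_const, ← Real.norm_eq_abs]
    have hki : Integrable fun t => |k (x - t)| := ((poisson_integrable hK).comp_sub_left x).abs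
    refine norm_integral_le_of_norm_le (hki.mul_const m) (Eventually.of_forall fun t => ?_)
    rw [norm_mul, Real.norm_eq_abs, Real.norm_eq_abs]
    exact mul_le_mul_of_nonneg_left (hcut m hm h t) (abs_nonneg _)
  have init : ∃ B, 0 ≤ B ∧ ∀ x, |φ x - ψ x| ≤ B := by
    refine ⟨C * (∫ t, |cutIn q φ t|) + C * ∫ t, |cutIn q ψ t|, ?_, fun x => ?_⟩
    · have : 0 ≤ ∫ t, |cutIn q φ t| := integral_nonneg fun t => abs_nonneg _
      have : 0 ≤ ∫ t, |cutIn q ψ t| := integral_nonneg fun t => abs_nonneg _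
      positivity
    · have e : φ x - ψ x = conv k (cutIn q ψ) x - conv k (cutIn q φ) x := by
        rw [hφ.eq x, hψ.eq x]; ring
      rw [e]
      refine (abs_sub _ _).trans ?_
      rw [add_comm]
      exact add_le_add (conv_bounded hb hiφ x) (conv_bounded hb hiψ x)
  obtain ⟨B, hB0, hB⟩ := init
  have iter : ∀ n : ℕ, ∀ x, |φ x - ψ x| ≤ ρ ^ n * B := by
    intro n
    induction n with
    | zero => simpa using hB
    | succ n ih =>
      intro x
      have := step _ (by positivity) ih x
      rwa [pow_succ', mul_assoc]
  ext x
  have h2 : Tendsto (fun n : ℕ => ρ ^ n * B) atTop (𝓝 (0 * B)) :=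
    (tendsto_pow_atTop_nhds_zero_of_lt_one hρ0 hρ1).mul_const B
  rw [zero_mul] at h2
  have h3 := ge_of_tendsto' h2 fun n => iter n x
  exact sub_eq_zero.1 (abs_eq_zero.1 (le_antisymm h3 (abs_nonneg _)))

lemma IsDressed.even {ζ q : ℝ} {S φ : ℝ → ℝ} (h0 : 0 < ζ) (h1 : ζ < π)
    (hφ : IsDressed ζ q S φ) (hS : ∀ x, S (-x) = S x) (x : ℝ) : φ (-x) = φ x := by
  have h : IsDressed ζ q S fun y => φ (-y) := by
    refine ⟨hφ.continuous.comp continuous_neg, fun x => ?_⟩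
    rw [hφ.eq (-x), hS]
    congr 1
    unfold conv
    rw [← integral_neg_eq_self]
    congr 1; ext t
    rw [← poisson_neg, cutIn_comp_neg]
    ring_nf
  exact congrFun (h.unique h0 h1 hφ) x

/-- `2π K_D`, the bare momentum density. -/
noncomputable def momentumSource (D x : ℝ) : ℝ := 2 * π * poisson (π / 2) D x

/-- `-c K_D'`, the derivative of the bare energy if `c = 4πJ sin ζ`. -/
noncomputable def energySource (c D x : ℝ) : ℝ := -(c * poissonDeriv (π / 2) D x)

lemma ft_momentumSource {D w : ℝ} :
    ft (momentumSource D) w = (fun _ : ℝ => (2 * π : ℂ)) w * ft (poisson (π / 2) D) w := by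
  unfold momentumSource
  rw [ft_const_mul]; push_cast; ring

lemma ft_neg_const_mul_poissonDeriv {M D c w : ℝ} (hD : |D| < M) (hw : w ≠ 0) :
    ft (fun x => -(c * poissonDeriv M D x)) w
      = (fun w : ℝ => -(c * (2 * π * Complex.I * w) : ℂ)) w * ft (poisson M D) w := by
  have : (fun x => -(c * poissonDeriv M D x)) = fun x => (-c) * poissonDeriv M D x := by
    ext x; ring
  rw [this, ft_const_mul, ft_poissonDeriv hD hw, ft_poisson hD hw]; push_cast; ring

lemma momentumSource_continuous (D : ℝ) : Continuous (momentumSource D) :=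
  (poisson_continuous _ _).const_mul _

lemma energySource_continuous (c D : ℝ) : Continuous (energySource c D) :=
  ((poissonDeriv_continuous _ _).const_mul _).neg

lemma momentumSource_integrable {D : ℝ} (hD : |D| < π / 2) : Integrable (momentumSource D) :=
  (poisson_integrable hD).const_mul _

lemma energySource_integrable {c D : ℝ} (hD : |D| < π / 2) : Integrable (energySource c D) :=
  ((poissonDeriv_integrable hD).const_mul _).neg

lemma momentumSource_bounded {D : ℝ} (hD : |D| < π / 2) : ∃ C, ∀ x, |momentumSource D x| ≤ C := by
  obtain ⟨C, hC, h⟩ := poisson_bounded hD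
  refine ⟨2 * π * C, fun x => ?_⟩
  rw [momentumSource, abs_mul, abs_of_pos (by positivity : 0 < 2 * π)]
  gcongr; exact h x

lemma energySource_bounded {c D : ℝ} (hD : |D| < π / 2) : ∃ C, ∀ x, |energySource c D x| ≤ C := by
  obtain ⟨C, hC, h⟩ := poissonDeriv_bounded hD
  refine ⟨|c| * C, fun x => ?_⟩
  rw [energySource, abs_neg, abs_mul]
  gcongr; exact h x

section Positivity

variable {ζ q c : ℝ} {φ : ℝ → ℝ}

lemma abs_half_sub_lt {ζ : ℝ} (h0 : 0 < ζ) (h1 : ζ < π) : |(π - ζ) / 2| < π / 2 := by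
  rw [abs_lt]; constructor <;> linarith

/-- The dressed momentum density is positive. -/
theorem dressedMomentumDensity_pos (h0 : 0 < ζ) (h1 : ζ < π) (hne : ζ ≠ π / 2)
    (hφ : IsDressed ζ q (momentumSource ((π - ζ) / 2)) φ) (x : ℝ) : 0 < φ x := by
  have hDz := abs_half_sub_lt h0 h1
  obtain ⟨C, hC⟩ := momentumSource_bounded hDz
  obtain ⟨B, hB0, hB⟩ := hφ.bounded h0 h1 hC
  have hi := hφ.integrable h0 h1 (momentumSource_integrable hDz)
  have hin := cutIn_integrable q hφ.continuous
  have hout := cutOut_integrable q hi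
  rcases lt_or_gt_of_ne hne with h | h
  · have hs := isBumpKernel_poisson (M := ζ) (D := ζ / 2) (by linarith) (by linarith)
    have hT := isBumpKernel_poisson (M := (π - ζ) / 2) (D := π / 2 - ζ) (by linarith) (by linarith)
    have heq := hφ.eq_add_conv_conv h0 h (momentumSource_integrable hDz)
      (S_s := fun x => 2 * π * poisson ζ (ζ / 2) x) ((poisson_continuous _ _).const_mul _)
      (hs.integrable.const_mul _) (fun _ => (2 * π : ℂ)) (fun w _ => ft_momentumSource)
      (fun w _ => by rw [ft_const_mul]; push_cast; ring)
    have hpos : ∀ x, 0 < 2 * π * poisson ζ (ζ / 2) x := fun x => by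
      have := poisson_pos (M := ζ) (D := ζ / 2) (by linarith) (by linarith) x
      positivity
    have hIs : ∫ t, poisson ζ (ζ / 2) t = 1 / 2 := by
      rw [integral_poisson (by linarith) (by linarith)]; field_simp
    have hIT : ∫ t, poisson ((π - ζ) / 2) (π / 2 - ζ) t ≤ 1 := by
      rw [integral_poisson (by linarith) (by linarith), div_le_one (by linarith)]; linarith
    have := nonneg_of_contraction (s := Set.univ) (φ := φ) (ρ := 1 / 2) (C := B) (by norm_num)
      (by norm_num) (fun x _ => heq x) (fun x _ => (hpos x).le) (fun m hm hmφ x _ => by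
        have h2 := hs.conv_ge (conv_integrable hT.integrable hout) (m := m) (fun y => by
          have h3 := hT.conv_ge hout (fun z => cutOut_ge (q := q) hm (hmφ z trivial)) y
          nlinarith) x
        rwa [hIs] at h2) hB0 (fun x _ => (abs_le.1 (hB x)).1) x trivial
    rw [heq x]; linarith [hpos x]
  · have hk := isBumpKernel_poisson (M := π / 2) (D := ζ - π / 2) (by linarith) (by linarith)
    have heq : ∀ x, φ x = momentumSource ((π - ζ) / 2) x
        + conv (poisson (π / 2) (ζ - π / 2)) (cutIn q φ) x := fun x => by
      rw [hφ.eq x, poisson_height_sub, conv_neg_kernel]; ring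
    have hpos : ∀ x, 0 < momentumSource ((π - ζ) / 2) x := fun x => by
      have := poisson_pos (M := π / 2) (D := (π - ζ) / 2) (by linarith) (by linarith) x
      unfold momentumSource; positivity
    have := nonneg_of_contraction (s := Set.univ) (φ := φ) (ρ := (ζ - π / 2) / (π / 2)) (C := B)
      (div_nonneg (by linarith) (by linarith))
      (by rw [div_lt_one (by linarith)]; linarith) (fun x _ => heq x) (fun x _ => (hpos x).le)
      (fun m hm hmφ x _ => by
        have h2 := hk.conv_ge hin (fun z => cutIn_ge (q := q) hm (hmφ z trivial)) x
        rwa [integral_poisson (by linarith) (by linarith)] at h2) hB0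
      (fun x _ => (abs_le.1 (hB x)).1) x trivial
    rw [heq x]; linarith [hpos x]

/-- The derivative of the dressed energy is positive on `(0, ∞)`, with a quantitative lower
bound. -/
theorem dressedEnergyDeriv_ge (h0 : 0 < ζ) (h1 : ζ < π) (hne : ζ ≠ π / 2) (hc : 0 < c)
    (hφ : IsDressed ζ q (energySource c ((π - ζ) / 2)) φ) (hodd : ∀ x, φ (-x) = -φ x) :
    ∃ a γ : ℝ, 0 < a ∧ 0 < γ ∧ ∀ x, 0 ≤ x → a * profile γ x ≤ φ x := by
  have hDz := abs_half_sub_lt h0 h1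
  obtain ⟨C, hC⟩ := energySource_bounded (c := c) hDz
  obtain ⟨B, hB0, hB⟩ := hφ.bounded h0 h1 hC
  have hi := hφ.integrable h0 h1 (energySource_integrable hDz)
  have hin := cutIn_integrable q hφ.continuous
  have hout := cutOut_integrable q hi
  have hφ0 : φ 0 = 0 := by have := hodd 0; rw [neg_zero] at this; linarith
  have hmain : ∃ G A : ℝ → ℝ, (∀ x, φ x = G x + A x) ∧ (∃ a γ : ℝ, 0 < a ∧ 0 < γ ∧
      ∀ x, 0 ≤ x → a * profile γ x ≤ G x) ∧ ∃ ρ, 0 ≤ ρ ∧ ρ < 1 ∧ ∀ m, 0 ≤ m →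
        (∀ x ∈ Set.Ioi (0 : ℝ), -m ≤ φ x) → ∀ x ∈ Set.Ioi (0 : ℝ), -(ρ * m) ≤ A x := by
    rcases lt_or_gt_of_ne hne with h | h
    · have hs := isBumpKernel_poisson (M := ζ) (D := ζ / 2) (by linarith) (by linarith)
      have hT := isBumpKernel_poisson (M := (π - ζ) / 2) (D := π / 2 - ζ) (by linarith)
        (by linarith)
      have hsabs : |ζ / 2| < ζ := by rw [abs_lt]; constructor <;> linarith
      refine ⟨fun x => -(c * poissonDeriv ζ (ζ / 2) x), _, hφ.eq_add_conv_conv h0 h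
        (energySource_integrable hDz) (S_s := fun x => -(c * poissonDeriv ζ (ζ / 2) x))
        ((poissonDeriv_continuous _ _).const_mul _).neg
        ((poissonDeriv_integrable hsabs).const_mul _).neg
        (fun w : ℝ => -(c * (2 * π * Complex.I * w) : ℂ))
        (fun w hw => ft_neg_const_mul_poissonDeriv hDz hw)
        (fun w hw => ft_neg_const_mul_poissonDeriv hsabs hw), ?_, 1 / 2, by norm_num, by norm_num,
        fun m hm hmφ x hx => ?_⟩
      · obtain ⟨a, ha, hle⟩ := neg_poissonDeriv_ge (M := ζ) (D := ζ / 2) (by linarith) (by linarith)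
        refine ⟨c * a, π / ζ, by positivity, by positivity, fun x hx => ?_⟩
        have := mul_le_mul_of_nonneg_left (hle x hx) hc.le
        unfold profile; linarith
      · have hIs : ∫ t, poisson ζ (ζ / 2) t = 1 / 2 := by
          rw [integral_poisson (by linarith) (by linarith)]; field_simp
        have hIT : ∫ t, poisson ((π - ζ) / 2) (π / 2 - ζ) t ≤ 1 := by
          rw [integral_poisson (by linarith) (by linarith), div_le_one (by linarith)]; linarith
        have h2 := hs.conv_ge_of_odd (conv_integrable hT.integrable hout)
          (conv_neg_of_odd hT.even (cutOut_odd hodd)) hm (fun y hy => by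
            have h3 := hT.conv_ge_of_odd hout (cutOut_odd hodd) hm
              (fun z hz => cutOut_ge (q := q) hm (hmφ z hz)) hy
            nlinarith) hx
        rwa [hIs] at h2
    · have hk := isBumpKernel_poisson (M := π / 2) (D := ζ - π / 2) (by linarith) (by linarith)
      refine ⟨energySource c ((π - ζ) / 2), conv (poisson (π / 2) (ζ - π / 2)) (cutIn q φ),
        fun x => ?_, ?_, (ζ - π / 2) / (π / 2), div_nonneg (by linarith) (by linarith),
        by rw [div_lt_one (by linarith)]; linarith, fun m hm hmφ x hx => ?_⟩
      · rw [hφ.eq x, poisson_height_sub, conv_neg_kernel]; ring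
      · obtain ⟨a, ha, hle⟩ := neg_poissonDeriv_ge (M := π / 2) (D := (π - ζ) / 2) (by linarith)
          (by linarith)
        refine ⟨c * a, π / (π / 2), by positivity, by positivity, fun x hx => ?_⟩
        have := mul_le_mul_of_nonneg_left (hle x hx) hc.le
        unfold profile energySource; linarith
      · have h2 := hk.conv_ge_of_odd hin (cutIn_odd hodd) hm
          (fun z hz => cutIn_ge (q := q) hm (hmφ z hz)) hx
        rwa [integral_poisson (by linarith) (by linarith)] at h2
  obtain ⟨G, A, heq, ⟨a, γ, ha, hγ, hG⟩, ρ, hρ0, hρ1, hA⟩ := hmain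
  have hnn := nonneg_of_contraction (s := Set.Ioi 0) hρ0 hρ1 (fun x _ => heq x)
    (fun x hx => (mul_nonneg ha.le (profile_nonneg hγ (le_of_lt hx))).trans (hG x (le_of_lt hx)))
    hA hB0 (fun x _ => (abs_le.1 (hB x)).1)
  refine ⟨a, γ, ha, hγ, fun x hx => ?_⟩
  rcases hx.eq_or_lt with rfl | hx
  · simp [profile, hφ0]
  · rw [heq x]; linarith [hG x hx.le, hnn x hx]

end Positivity

/-! ### Asymptotic expansions at infinity -/

lemma poisson_half_pi (D x : ℝ) :
    poisson (π / 2) D x = sin (2 * D) / (π * (cosh (2 * x) + cos (2 * D))) := by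
  have e1 : π * D / (π / 2) = 2 * D := by field_simp
  have e2 : π * x / (π / 2) = 2 * x := by field_simp
  rw [poisson, e1, e2]; ring_nf

lemma poissonDeriv_half_pi (D x : ℝ) : poissonDeriv (π / 2) D x
    = -(2 * sin (2 * D) * sinh (2 * x)) / (π * (cosh (2 * x) + cos (2 * D)) ^ 2) := by
  have e1 : π * D / (π / 2) = 2 * D := by field_simp
  have e2 : π * x / (π / 2) = 2 * x := by field_simp
  have e3 : π / (π / 2) = 2 := by field_simp
  rw [poissonDeriv, e1, e2, e3]; ring_nf

lemma sin_two_mul_add_int_mul_pi (D : ℝ) (n : ℤ) : sin (2 * (D + n * π)) = sin (2 * D) := by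
  rw [show 2 * (D + n * π) = 2 * D + n * (2 * π) by ring, sin_add_int_mul_two_pi]

lemma cos_two_mul_add_int_mul_pi (D : ℝ) (n : ℤ) : cos (2 * (D + n * π)) = cos (2 * D) := by
  rw [show 2 * (D + n * π) = 2 * D + n * (2 * π) by ring, cos_add_int_mul_two_pi]

lemma poisson_add_int_mul_pi (D : ℝ) (n : ℤ) : poisson (π / 2) (D + n * π) = poisson (π / 2) D := by
  ext x
  rw [poisson_half_pi, poisson_half_pi, sin_two_mul_add_int_mul_pi, cos_two_mul_add_int_mul_pi]

lemma momentumSource_add_int_mul_pi (D : ℝ) (n : ℤ) :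
    momentumSource (D + n * π) = momentumSource D := by
  unfold momentumSource; rw [poisson_add_int_mul_pi]

lemma energySource_add_int_mul_pi (c D : ℝ) (n : ℤ) :
    energySource c (D + n * π) = energySource c D := by
  ext x
  rw [energySource, energySource, poissonDeriv_half_pi, poissonDeriv_half_pi,
    sin_two_mul_add_int_mul_pi, cos_two_mul_add_int_mul_pi]

lemma dressedLine_add_int_mul_pi (ζ q D : ℝ) (S φ : ℝ → ℝ) (n : ℤ) :
    dressedLine ζ q (D + n * π) S φ = dressedLine ζ q D S φ := by
  unfold dressedLine
  rw [show D + n * π + ζ / 2 = D + ζ / 2 + n * π by ring,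
    show D + n * π - ζ / 2 = D - ζ / 2 + n * π by ring, poisson_add_int_mul_pi,
    poisson_add_int_mul_pi]

lemma exists_le_cosh_add_cos {a : ℝ} (h : sin a ≠ 0) :
    ∃ c : ℝ, 0 < c ∧ ∀ y : ℝ, c * cosh y ≤ cosh y + cos a := by
  refine exists_mul_cosh_le ?_
  have := (sin_eq_zero_or_denom_pos a 0).resolve_left h
  rw [cosh_zero] at this; linarith

lemma poisson_asymptotics (D : ℝ) : ∃ C, 0 ≤ C ∧ ∀ y : ℝ,
    |poisson (π / 2) D y - 2 / π * sin (2 * D) * exp (-(2 * y))| ≤ C * exp (-(4 * y)) := by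
  by_cases h : sin (2 * D) = 0
  · exact ⟨0, le_rfl, fun y => by simp [poisson_half_pi, h]⟩
  obtain ⟨c, hc, hle⟩ := exists_le_cosh_add_cos h
  refine ⟨|sin (2 * D)| / π * (5 / c), by positivity, fun y => ?_⟩
  have h0 := hle (2 * y)
  have hcosh := cosh_pos (2 * y)
  have hden : 0 < cosh (2 * y) + cos (2 * D) := lt_of_lt_of_le (by positivity) h0
  have hE : 0 < exp (2 * y) := exp_pos _
  have e4 : exp (-(4 * y)) = (exp (2 * y))⁻¹ * (exp (2 * y))⁻¹ := by
    rw [← exp_neg, ← exp_add]; congr 1; ring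
  have ecosh : cosh (2 * y) = (exp (2 * y) + (exp (2 * y))⁻¹) / 2 := by rw [cosh_eq, exp_neg]
  have e : poisson (π / 2) D y - 2 / π * sin (2 * D) * exp (-(2 * y))
      = sin (2 * D) / π * (-((exp (2 * y))⁻¹ * (exp (2 * y))⁻¹ + 2 * cos (2 * D) *
        (exp (2 * y))⁻¹) / (cosh (2 * y) + cos (2 * D))) := by
    rw [poisson_half_pi, exp_neg]
    have := hden.ne'
    field_simp
    rw [ecosh]
    field_simp
    ring
  rw [e, abs_mul, abs_div, abs_of_pos pi_pos, mul_assoc (|sin (2 * D)| / π)]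
  gcongr
  rw [abs_div, abs_neg, abs_of_pos hden, div_le_iff₀ hden, e4]
  have hIE : 0 < (exp (2 * y))⁻¹ := by positivity
  set I := (exp (2 * y))⁻¹ with hI
  have h1 : |I * I + 2 * cos (2 * D) * I| ≤ I * I + 2 * I := by
    refine (abs_add_le _ _).trans ?_
    rw [abs_of_pos (by positivity : 0 < I * I), abs_mul, abs_mul, abs_of_pos hIE, abs_two]
    have := abs_cos_le_one (2 * D)
    nlinarith
  have h2 : I * cosh (2 * y) ≥ 1 / 2 := by
    rw [ecosh]
    have : I * exp (2 * y) = 1 := inv_mul_cancel₀ hE.ne'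
    nlinarith
  have h3 := one_le_cosh (2 * y)
  refine h1.trans ?_
  calc I * I + 2 * I ≤ I * I * cosh (2 * y) + 4 * (I * (I * cosh (2 * y))) := by
        have : I * I * 1 ≤ I * I * cosh (2 * y) := by gcongr
        have : I * (1 / 2) ≤ I * (I * cosh (2 * y)) := by gcongr
        linarith
    _ = 5 / c * (I * I) * (c * cosh (2 * y)) := by field_simp; ring
    _ ≤ 5 / c * (I * I) * (cosh (2 * y) + cos (2 * D)) := by gcongr

lemma poissonDeriv_asymptotics (D : ℝ) : ∃ C, 0 ≤ C ∧ ∀ y : ℝ, 0 ≤ y →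
    |poissonDeriv (π / 2) D y + 4 / π * sin (2 * D) * exp (-(2 * y))| ≤ C * exp (-(4 * y)) := by
  by_cases h : sin (2 * D) = 0
  · exact ⟨0, le_rfl, fun y _ => by simp [poissonDeriv_half_pi, h]⟩
  obtain ⟨c, hc, hle⟩ := exists_le_cosh_add_cos h
  refine ⟨2 * |sin (2 * D)| / π * (32 / c ^ 2), by positivity, fun y hy => ?_⟩
  have h0 := hle (2 * y)
  have hcosh := cosh_pos (2 * y)
  have hden : 0 < cosh (2 * y) + cos (2 * D) := lt_of_lt_of_le (by positivity) h0
  have hE : 0 < exp (2 * y) := exp_pos _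
  have hE1 : 1 ≤ exp (2 * y) := one_le_exp (by linarith)
  have e4 : exp (-(4 * y)) = (exp (2 * y))⁻¹ * (exp (2 * y))⁻¹ := by
    rw [← exp_neg, ← exp_add]; congr 1; ring
  have ecosh : cosh (2 * y) = (exp (2 * y) + (exp (2 * y))⁻¹) / 2 := by rw [cosh_eq, exp_neg]
  have esinh : sinh (2 * y) = (exp (2 * y) - (exp (2 * y))⁻¹) / 2 := by rw [sinh_eq, exp_neg]
  set k := cos (2 * D) with hk
  set I := (exp (2 * y))⁻¹ with hI
  have hIE : 0 < I := by positivity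
  have hI1 : I ≤ 1 := inv_le_one_of_one_le₀ hE1
  have e : poissonDeriv (π / 2) D y + 4 / π * sin (2 * D) * exp (-(2 * y))
      = 2 * sin (2 * D) / π * ((2 * k + (2 * k ^ 2 + 3 / 2) * I + 2 * k * I ^ 2 + I ^ 3 / 2)
        / (cosh (2 * y) + k) ^ 2) := by
    rw [poissonDeriv_half_pi, exp_neg, ← hk, ← hI]
    have := hden.ne'
    have hEI : exp (2 * y) * I = 1 := mul_inv_cancel₀ hE.ne'
    have key : -sinh (2 * y) + 2 * I * (cosh (2 * y) + k) ^ 2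
        = 2 * k + (2 * k ^ 2 + 3 / 2) * I + 2 * k * I ^ 2 + I ^ 3 / 2 := by
      rw [ecosh, esinh]
      set E := exp (2 * y)
      linear_combination (E / 2 + I + 2 * k) * hEI
    rw [← key]
    field_simp
    ring
  rw [e, abs_mul, abs_div, abs_of_pos pi_pos, abs_mul, abs_two, mul_assoc (2 * |sin (2 * D)| / π)]
  gcongr
  rw [abs_div, abs_of_pos (by positivity : 0 < (cosh (2 * y) + k) ^ 2),
    div_le_iff₀ (by positivity), e4]
  have hk1 : |k| ≤ 1 := abs_cos_le_one _
  have hk2 := abs_le.1 hk1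
  have h1 : |2 * k + (2 * k ^ 2 + 3 / 2) * I + 2 * k * I ^ 2 + I ^ 3 / 2| ≤ 8 := by
    have a1 : I ^ 2 ≤ 1 := pow_le_one₀ hIE.le hI1
    have a2 : I ^ 3 ≤ 1 := pow_le_one₀ hIE.le hI1
    have a3 : 0 ≤ I ^ 2 := by positivity
    have a4 : 0 ≤ I ^ 3 := by positivity
    have a5 : k ^ 2 ≤ 1 := by rw [sq_le_one_iff_abs_le_one]; exact hk1
    have a6 : |k * I ^ 2| ≤ 1 := by
      rw [abs_mul, abs_of_nonneg a3]; exact mul_le_one₀ hk1 a3 a1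
    have a7 := abs_le.1 a6
    have a8 : 0 ≤ (2 * k ^ 2 + 3 / 2) * I := by positivity
    have a9 : (2 * k ^ 2 + 3 / 2) * I ≤ (2 * 1 + 3 / 2) * 1 := by gcongr
    rw [abs_le]; constructor <;> nlinarith
  refine h1.trans ?_
  have h2 : 1 / 2 ≤ I * cosh (2 * y) := by
    rw [ecosh]
    have : I * exp (2 * y) = 1 := inv_mul_cancel₀ hE.ne'
    nlinarith
  calc (8 : ℝ) = 32 * (1 / 2) ^ 2 := by norm_num
    _ ≤ 32 * (I * cosh (2 * y)) ^ 2 := by gcongr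
    _ = 32 / c ^ 2 * (I * I) * (c * cosh (2 * y)) ^ 2 := by field_simp
    _ ≤ 32 / c ^ 2 * (I * I) * (cosh (2 * y) + k) ^ 2 := by gcongr

/-- The coefficient of `sin(2D) e^{-2x}` in a dressed quantity on the line of height `D`, for a
source with coefficient `s`. -/
noncomputable def amplitude (ζ q s : ℝ) (φ : ℝ → ℝ) : ℝ :=
  s - 4 / π * cos ζ * ∫ t, exp (2 * t) * cutIn q φ t

lemma integrable_mul_cutIn {q : ℝ} {φ w : ℝ → ℝ} (hφ : Continuous φ) (hw : Continuous w) :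
    Integrable fun t => w t * cutIn q φ t := by
  have : (fun t => w t * cutIn q φ t) = cutIn q fun t => w t * φ t := by
    ext t
    by_cases ht : t ∈ Set.Icc (-q) q
    · simp [cutIn, Set.indicator_of_mem ht]
    · simp [cutIn, Set.indicator_of_notMem ht]
  rw [this]
  exact cutIn_integrable q (hw.mul hφ)

lemma conv_poisson_asymptotics (q D : ℝ) {φ : ℝ → ℝ} (hφ : Continuous φ) : ∃ C, 0 ≤ C ∧ ∀ x : ℝ,
    |conv (poisson (π / 2) D) (cutIn q φ) x - 2 / π * sin (2 * D) * exp (-(2 * x)) *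
      ∫ t, exp (2 * t) * cutIn q φ t| ≤ C * exp (-(4 * x)) := by
  obtain ⟨C, hC, h⟩ := poisson_asymptotics D
  have hi4 := integrable_mul_cutIn (q := q) (w := fun t => exp (4 * t)) hφ (by fun_prop)
  have hi2 := integrable_mul_cutIn (q := q) (w := fun t => exp (2 * t)) hφ (by fun_prop)
  refine ⟨C * ∫ t, |exp (4 * t) * cutIn q φ t|, ?_, fun x => ?_⟩
  · have : 0 ≤ ∫ t, |exp (4 * t) * cutIn q φ t| := integral_nonneg fun t => abs_nonneg _
    positivity
  have hix := integrable_mul_cutIn (q := q) (w := fun t => poisson (π / 2) D (x - t)) hφ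
    ((poisson_continuous _ _).comp (by fun_prop))
  rw [conv, ← integral_const_mul, ← integral_sub hix (hi2.const_mul _), mul_right_comm C,
    ← integral_const_mul, ← Real.norm_eq_abs]
  refine norm_integral_le_of_norm_le (hi4.abs.const_mul _) (Eventually.of_forall fun t => ?_)
  have e : exp (-(2 * x)) * exp (2 * t) = exp (-(2 * (x - t))) := by rw [← exp_add]; congr 1; ring
  have e' : exp (-(4 * x)) * exp (4 * t) = exp (-(4 * (x - t))) := by rw [← exp_add]; congr 1; ring
  have h1 := h (x - t)
  rw [Real.norm_eq_abs, abs_mul, abs_of_pos (exp_pos (4 * t))]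
  calc |poisson (π / 2) D (x - t) * cutIn q φ t
        - 2 / π * sin (2 * D) * exp (-(2 * x)) * (exp (2 * t) * cutIn q φ t)|
      = |poisson (π / 2) D (x - t) - 2 / π * sin (2 * D) * exp (-(2 * (x - t)))|
        * |cutIn q φ t| := by
        rw [← abs_mul, ← e]; congr 1; ring
    _ ≤ C * exp (-(4 * (x - t))) * |cutIn q φ t| := by gcongr
    _ = _ := by rw [← e']; ring

lemma dressedLine_asymptotics {ζ q D s : ℝ} {S φ : ℝ → ℝ} (hφ : Continuous φ)
    (hS : ∃ C, 0 ≤ C ∧ ∀ x, 0 ≤ x → |S x - s * sin (2 * D) * exp (-(2 * x))| ≤ C * exp (-(4 * x))) :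
    ∃ C, 0 ≤ C ∧ ∀ x, 0 ≤ x → |dressedLine ζ q D S φ x -
      sin (2 * D) * amplitude ζ q s φ * exp (-(2 * x))| ≤ C * exp (-(4 * x)) := by
  obtain ⟨C0, hC0, h0⟩ := hS
  obtain ⟨C1, hC1, h1⟩ := conv_poisson_asymptotics q (D + ζ / 2) hφ
  obtain ⟨C2, hC2, h2⟩ := conv_poisson_asymptotics q (D - ζ / 2) hφ
  refine ⟨C0 + C1 + C2, by positivity, fun x hx => ?_⟩
  have e : sin (2 * (D + ζ / 2)) + sin (2 * (D - ζ / 2)) = 2 * sin (2 * D) * cos ζ := by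
    rw [show 2 * (D + ζ / 2) = 2 * D + ζ by ring, show 2 * (D - ζ / 2) = 2 * D - ζ by ring,
      sin_add, sin_sub]; ring
  have a0 := abs_le.1 (h0 x hx)
  have a1 := abs_le.1 (h1 x)
  have a2 := abs_le.1 (h2 x)
  set I := ∫ t, exp (2 * t) * cutIn q φ t with hI
  have e2 : sin (2 * D) * amplitude ζ q s φ * exp (-(2 * x)) = s * sin (2 * D) * exp (-(2 * x))
      - (2 / π * sin (2 * (D + ζ / 2)) * exp (-(2 * x)) * I
        + 2 / π * sin (2 * (D - ζ / 2)) * exp (-(2 * x)) * I) := by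
    rw [amplitude, ← hI]
    linear_combination (2 / π * exp (-(2 * x)) * I) * e
  rw [e2, dressedLine, abs_le]
  constructor <;> linarith [a0.1, a0.2, a1.1, a1.2, a2.1, a2.2]

lemma momentumSource_asymptotics (D : ℝ) : ∃ C, 0 ≤ C ∧ ∀ x, 0 ≤ x →
    |momentumSource D x - 4 * sin (2 * D) * exp (-(2 * x))| ≤ C * exp (-(4 * x)) := by
  obtain ⟨C, hC, h⟩ := poisson_asymptotics D
  refine ⟨2 * π * C, by positivity, fun x _ => ?_⟩
  have e : momentumSource D x - 4 * sin (2 * D) * exp (-(2 * x))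
      = 2 * π * (poisson (π / 2) D x - 2 / π * sin (2 * D) * exp (-(2 * x))) := by
    rw [momentumSource]; field_simp; ring
  rw [e, abs_mul, abs_of_pos (by positivity : 0 < 2 * π), mul_assoc (2 * π)]
  gcongr; exact h x

lemma energySource_asymptotics (c D : ℝ) : ∃ C, 0 ≤ C ∧ ∀ x, 0 ≤ x →
    |energySource c D x - 4 * c / π * sin (2 * D) * exp (-(2 * x))| ≤ C * exp (-(4 * x)) := by
  obtain ⟨C, hC, h⟩ := poissonDeriv_asymptotics D
  refine ⟨|c| * C, by positivity, fun x hx => ?_⟩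
  have e : energySource c D x - 4 * c / π * sin (2 * D) * exp (-(2 * x))
      = -c * (poissonDeriv (π / 2) D x + 4 / π * sin (2 * D) * exp (-(2 * x))) := by
    rw [energySource]; ring
  rw [e, abs_mul, abs_neg, mul_assoc |c|]
  gcongr; exact h x hx

/-- A function with a lower bound of order `e^{-γx}`, `γ < 4`, and an expansion
`A e^{-2x} + O(e^{-4x})` has `A > 0`. -/
lemma pos_of_profile_le {L : ℝ → ℝ} {A C a γ : ℝ} (ha : 0 < a) (hγ : 0 < γ) (hγ4 : γ < 4)
    (hL : ∀ x, 0 ≤ x → |L x - A * exp (-(2 * x))| ≤ C * exp (-(4 * x)))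
    (hge : ∀ x, 0 ≤ x → a * profile γ x ≤ L x) : 0 < A := by
  by_contra hA
  have hA' : A ≤ 0 := not_lt.1 hA
  have h1 : ∀ x, 0 ≤ x → a * profile γ x ≤ C * exp (-(4 * x)) := fun x hx => by
    have h2 := (abs_le.1 (hL x hx)).2
    have h3 : A * exp (-(2 * x)) ≤ 0 := mul_nonpos_of_nonpos_of_nonneg hA' (exp_pos _).le
    linarith [hge x hx]
  have h2 : Tendsto (fun x : ℝ => exp ((4 - γ) * x)) atTop atTop :=
    tendsto_exp_atTop.comp (tendsto_id.const_mul_atTop (by linarith))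
  have h3 : Tendsto (fun x : ℝ => exp (-(2 * γ) * x)) atTop (𝓝 0) :=
    tendsto_exp_atBot.comp (tendsto_id.const_mul_atTop_of_neg (by linarith))
  have h4 := ((h2.eventually_gt_atTop (4 * C / a)).and
    (h3.eventually_lt_const (by norm_num : (0 : ℝ) < 1 / 2))).and (eventually_ge_atTop 0)
  obtain ⟨x, ⟨hx1, hx2⟩, hx0⟩ := h4.exists
  have h5 := h1 x hx0
  have e4 : exp (-(4 * x)) * exp (4 * x) = 1 := by rw [← exp_add]; simp
  have e5 : profile γ x * exp (4 * x)
      = exp ((4 - γ) * x) * (1 - exp (-(2 * γ) * x)) / 2 := by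
    rw [profile, sinh_eq, sub_div, sub_mul, sub_mul, mul_sub, mul_one, sub_div]
    congr 1
    · rw [div_mul_eq_mul_div, div_mul_eq_mul_div, ← exp_add, ← exp_add]; congr 2; ring
    · rw [div_mul_eq_mul_div, div_mul_eq_mul_div, ← exp_add, ← exp_add, ← exp_add]; congr 2; ring
  have h6 : a * (profile γ x * exp (4 * x)) ≤ C := by
    have := mul_le_mul_of_nonneg_right h5 (exp_pos (4 * x)).le
    rw [mul_assoc, mul_assoc, e4, mul_one] at this
    exact this
  rw [e5] at h6
  have h7 := exp_pos ((4 - γ) * x)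
  have h8 : exp ((4 - γ) * x) / 4 ≤ exp ((4 - γ) * x) * (1 - exp (-(2 * γ) * x)) / 2 := by
    nlinarith
  rw [div_lt_iff₀ ha] at hx1
  nlinarith

/-! ### Signs on horizontal lines -/

/-- The heights `D` of the lines on which dressed quantities are studied. For `D = (π-ζ)/2` the line
is the real axis. The last range occurs for `ζ > π/2` only. -/
def IsLineHeight (ζ D : ℝ) : Prop :=
  D ≠ 0 ∧ (D = (π - ζ) / 2 ∨ |D| < (π - ζ) / 2 ∨ (-(ζ / 2) ≤ D ∧ D ≤ -((π - ζ) / 2)))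

section Line

variable {ζ q c D : ℝ} {S φ : ℝ → ℝ}

lemma conv_poisson_half_pi (φ : ℝ → ℝ) (x : ℝ) : conv (poisson (π / 2) (π / 2)) φ x = 0 := by
  simp [conv, poisson_self_height (by positivity : 0 < π / 2)]

lemma dressedLine_real_axis (hφ : IsDressed ζ q S φ) :
    dressedLine ζ q ((π - ζ) / 2) S φ = φ := by
  ext x
  rw [dressedLine, hφ.eq x, show (π - ζ) / 2 + ζ / 2 = π / 2 by ring,
    show (π - ζ) / 2 - ζ / 2 = π / 2 - ζ by ring]
  rw [conv_poisson_half_pi, zero_add]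

lemma conv_neg_height (M D : ℝ) (φ : ℝ → ℝ) (x : ℝ) :
    conv (poisson M (-D)) φ x = -conv (poisson M D) φ x := by
  simp [conv, poisson_neg_height, integral_neg]

lemma cutOut_pos (h : ∀ x, q < x → 0 < φ x) (x : ℝ) (hx : q < x) :
    0 < cutOut q φ x := by
  have : x ∈ (Set.Icc (-q) q)ᶜ := fun h => absurd h.2 (not_le.2 hx)
  rw [cutOut, Set.indicator_of_mem this]; exact h x hx

lemma cutOut_nonneg {x : ℝ} (h : 0 ≤ φ x) : 0 ≤ cutOut q φ x := by
  simpa using cutOut_ge (q := q) le_rfl (by simpa using h)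

lemma cutIn_nonneg {x : ℝ} (h : 0 ≤ φ x) : 0 ≤ cutIn q φ x := by
  simpa using cutIn_ge (q := q) le_rfl (by simpa using h)

/-- In the last range of `IsLineHeight` the kernels of heights `D ± ζ/2` are nonnegative. -/
lemma isBumpKernel_exceptional (h1 : ζ < π) (hD1 : -(ζ / 2) ≤ D)
    (hD2 : D ≤ -((π - ζ) / 2)) :
    IsBumpKernel (poisson (π / 2) (D + ζ / 2)) ∧ IsBumpKernel (poisson (π / 2) (D - ζ / 2)) := by
  refine ⟨isBumpKernel_poisson (by linarith) (by linarith), ?_⟩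
  have e : poisson (π / 2) (D - ζ / 2) = poisson (π / 2) (D - ζ / 2 + π) :=
    by
    simpa using (poisson_add_int_mul_pi (D - ζ / 2) 1).symm
  rw [e]
  rcases (show D - ζ / 2 + π ≤ π / 2 by linarith).eq_or_lt with h | h
  · have e' : poisson (π / 2) (D - ζ / 2 + π) = poisson (π / 2) 0 := by
      ext x; rw [h, poisson_self_height (by positivity), poisson_zero_height]
    rw [e']
    exact isBumpKernel_poisson le_rfl (by positivity)
  · exact isBumpKernel_poisson (by linarith) h

lemma dressedLine_momentum_eq (h0 : 0 < ζ) (h1 : ζ < π) (hD : |D| < (π - ζ) / 2)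
    (hφ : IsDressed ζ q (momentumSource ((π - ζ) / 2)) φ) :
    dressedLine ζ q D (momentumSource D) φ = conv (poisson ((π - ζ) / 2) D) (cutOut q φ) := by
  have hDpi : |D| < π / 2 := by linarith
  exact dressedLine_eq_conv_cutOut h0 h1 hD hφ (momentumSource_integrable (abs_half_sub_lt h0 h1))
    (momentumSource_continuous D) (momentumSource_integrable hDpi) _
    (fun w _ => ft_momentumSource) (fun w _ => ft_momentumSource)

lemma dressedLine_energy_eq (h0 : 0 < ζ) (h1 : ζ < π) (hD : |D| < (π - ζ) / 2)
    (hφ : IsDressed ζ q (energySource c ((π - ζ) / 2)) φ) :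
    dressedLine ζ q D (energySource c D) φ = conv (poisson ((π - ζ) / 2) D) (cutOut q φ) := by
  have hDpi : |D| < π / 2 := by linarith
  exact dressedLine_eq_conv_cutOut h0 h1 hD hφ (energySource_integrable (abs_half_sub_lt h0 h1))
    (energySource_continuous c D) (energySource_integrable hDpi) _
    (fun w hw => ft_neg_const_mul_poissonDeriv (abs_half_sub_lt h0 h1) hw)
    (fun w hw => ft_neg_const_mul_poissonDeriv hDpi hw)

/-- The derivative of the dressed momentum has on each line the sign of the height of the line. -/
theorem dressedLine_momentum_sign (h0 : 0 < ζ) (h1 : ζ < π) (hne : ζ ≠ π / 2)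
    (hD : IsLineHeight ζ D) (hφ : IsDressed ζ q (momentumSource ((π - ζ) / 2)) φ) (x : ℝ) :
    0 < D * dressedLine ζ q D (momentumSource D) φ x := by
  have hpos := dressedMomentumDensity_pos h0 h1 hne hφ
  have heven := hφ.even h0 h1 (fun x => by simp [momentumSource, poisson_neg])
  have hi := hφ.integrable h0 h1 (momentumSource_integrable (abs_half_sub_lt h0 h1))
  have hout := cutOut_integrable q hi
  have core : ∀ d, 0 < d → d < (π - ζ) / 2 →
      0 < conv (poisson ((π - ζ) / 2) d) (cutOut q φ) x := by
    intro d hd hd1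
    obtain ⟨a, ha, hle⟩ := conv_poisson_ge_of_even hd hd1 hout
      (fun y => cutOut_nonneg (hpos y).le) (cutOut_pos fun y _ => hpos y)
    have hev : ∀ y, cutOut q φ (-y) = cutOut q φ y := by
      intro y
      have e1 := cutIn_add_cutOut q φ y
      have e2 := cutIn_add_cutOut q φ (-y)
      rw [← cutIn_comp_neg, heven] at e2
      simp only [heven] at e2
      linarith
    have h2 := hle |x| (abs_nonneg x)
    have h3 : conv (poisson ((π - ζ) / 2) d) (cutOut q φ) |x|
        = conv (poisson ((π - ζ) / 2) d) (cutOut q φ) x := by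
      rcases abs_choice x with h | h <;> rw [h]
      exact conv_neg_of_even (poisson_neg _ _) hev x
    rw [← h3]
    exact lt_of_lt_of_le (by positivity) h2
  rcases hD.2 with h | h | ⟨hD1, hD2⟩
  · rw [h, dressedLine_real_axis hφ]
    have := hpos x
    have : 0 < (π - ζ) / 2 := by linarith
    positivity
  · rw [dressedLine_momentum_eq h0 h1 h hφ]
    obtain ⟨ha, hb⟩ := abs_lt.1 h
    rcases lt_or_gt_of_ne hD.1 with hneg | hp
    · have := core (-D) (by linarith) (by linarith)
      rw [conv_neg_height] at this
      nlinarith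
    · exact mul_pos hp (core D hp hb)
  · obtain ⟨k1, k2⟩ := isBumpKernel_exceptional h1 hD1 hD2
    have hneg : D < 0 := by linarith
    have c1 := conv_nonneg_of_even k1 (fun y => cutIn_nonneg (q := q) (hpos y).le) x
    have c2 := conv_nonneg_of_even k2 (fun y => cutIn_nonneg (q := q) (hpos y).le) x
    have c3 : momentumSource D x < 0 := by
      have := poisson_pos (M := π / 2) (D := -D) (by linarith) (by linarith) x
      rw [poisson_neg_height] at this
      unfold momentumSource
      nlinarith [pi_pos]
    refine mul_pos_of_neg_of_neg hneg ?_
    unfold dressedLine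
    linarith

/-- The derivative of the dressed energy has on each right half-line the sign of the height. -/
theorem dressedLine_energy_sign (h0 : 0 < ζ) (h1 : ζ < π) (hne : ζ ≠ π / 2) (hc : 0 < c)
    (hq : 0 ≤ q) (hD : IsLineHeight ζ D) (hφ : IsDressed ζ q (energySource c ((π - ζ) / 2)) φ)
    (hodd : ∀ x, φ (-x) = -φ x) : ∃ a γ : ℝ, 0 < a ∧ 0 < γ ∧ ∀ x, 0 ≤ x →
      a * profile γ x ≤ D * dressedLine ζ q D (energySource c D) φ x := by
  obtain ⟨a, γ, ha, hγ, hge⟩ := dressedEnergyDeriv_ge h0 h1 hne hc hφ hodd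
  have hpos : ∀ x, 0 < x → 0 < φ x := fun x hx =>
    lt_of_lt_of_le (mul_pos ha (profile_pos hγ hx)) (hge x hx.le)
  have hi := hφ.integrable h0 h1 (energySource_integrable (abs_half_sub_lt h0 h1))
  have hin := cutIn_integrable q hφ.continuous
  have hout := cutOut_integrable q hi
  have core : ∀ d, 0 < d → d < (π - ζ) / 2 → ∃ a γ : ℝ, 0 < a ∧ 0 < γ ∧ ∀ x, 0 ≤ x →
      a * profile γ x ≤ conv (poisson ((π - ζ) / 2) d) (cutOut q φ) x := by
    intro d hd hd1
    obtain ⟨a, ha, hle⟩ := conv_poisson_ge_of_odd hd hd1 hout (cutOut_odd hodd) hq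
      (fun y hy => cutOut_nonneg (hpos y hy).le)
      (cutOut_pos fun y hy => hpos y (lt_of_le_of_lt hq hy))
    exact ⟨a, _, ha, by have : 0 < π - ζ := by linarith
                        positivity, hle⟩
  rcases hD.2 with h | h | ⟨hD1, hD2⟩
  · rw [h, dressedLine_real_axis hφ]
    have hz : 0 < (π - ζ) / 2 := by linarith
    refine ⟨(π - ζ) / 2 * a, γ, by positivity, hγ, fun x hx => ?_⟩
    rw [mul_assoc]
    exact mul_le_mul_of_nonneg_left (hge x hx) hz.le
  · rw [dressedLine_energy_eq h0 h1 h hφ]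
    obtain ⟨hl, hb⟩ := abs_lt.1 h
    rcases lt_or_gt_of_ne hD.1 with hneg | hp
    · obtain ⟨a, γ, ha, hγ, hle⟩ := core (-D) (by linarith) (by linarith)
      refine ⟨-D * a, γ, mul_pos (by linarith) ha, hγ, fun x hx => ?_⟩
      have := hle x hx
      rw [conv_neg_height] at this
      nlinarith
    · obtain ⟨a, γ, ha, hγ, hle⟩ := core D hp hb
      refine ⟨D * a, γ, mul_pos hp ha, hγ, fun x hx => ?_⟩
      rw [mul_assoc]
      exact mul_le_mul_of_nonneg_left (hle x hx) hp.le
  · obtain ⟨k1, k2⟩ := isBumpKernel_exceptional h1 hD1 hD2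
    have hneg : D < 0 := by linarith
    obtain ⟨a, ha, hle⟩ := neg_poissonDeriv_ge (M := π / 2) (D := -D) (by linarith) (by linarith)
    refine ⟨-D * (c * a), π / (π / 2), mul_pos (by linarith) (mul_pos hc ha), by positivity,
      fun x hx => ?_⟩
    have h2 := hle x hx
    rw [poissonDeriv_neg_height, neg_neg] at h2
    rcases hx.eq_or_lt with rfl | hx
    · have o1 := conv_neg_of_odd k1.even (cutIn_odd (q := q) hodd) 0
      have o2 := conv_neg_of_odd k2.even (cutIn_odd (q := q) hodd) 0
      have o3 := poissonDeriv_neg (π / 2) D 0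
      rw [neg_zero] at o1 o2 o3
      have o4 : poissonDeriv (π / 2) D 0 = 0 := by linarith
      have o5 : conv (poisson (π / 2) (D + ζ / 2)) (cutIn q φ) 0 = 0 := by linarith
      have o6 : conv (poisson (π / 2) (D - ζ / 2)) (cutIn q φ) 0 = 0 := by linarith
      simp [dressedLine, energySource, o4, o5, o6, profile]
    · have c1 := conv_nonneg_of_odd k1 hin (cutIn_odd hodd)
        (fun y hy => cutIn_nonneg (q := q) (hpos y hy).le) hx
      have c2 := conv_nonneg_of_odd k2 hin (cutIn_odd hodd)
        (fun y hy => cutIn_nonneg (q := q) (hpos y hy).le) hx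
      have h3 := mul_le_mul_of_nonneg_left h2 hc.le
      have h4 : dressedLine ζ q D (energySource c D) φ x
          ≤ -(c * (a * profile (π / (π / 2)) x)) := by
        unfold dressedLine energySource profile
        linarith
      have h5 := mul_le_mul_of_nonpos_left h4 hneg.le
      refine le_trans (le_of_eq ?_) h5
      ring

lemma gamma_lt_four (h : ζ < π / 2) : π / ((π - ζ) / 2) < 4 := by
  rw [div_lt_iff₀ (by linarith [pi_pos])]; linarith

theorem amplitude_momentum_pos (h0 : 0 < ζ) (h1 : ζ < π) (hne : ζ ≠ π / 2)
    (hφ : IsDressed ζ q (momentumSource ((π - ζ) / 2)) φ) : 0 < amplitude ζ q 4 φ := by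
  have hpos := dressedMomentumDensity_pos h0 h1 hne hφ
  have hi := hφ.integrable h0 h1 (momentumSource_integrable (abs_half_sub_lt h0 h1))
  have hout := cutOut_integrable q hi
  rcases lt_or_gt_of_ne hne with h | h
  · have hd : 0 < π / 2 - ζ := by linarith
    have hd1 : π / 2 - ζ < (π - ζ) / 2 := by linarith
    have hγ : 0 < π / ((π - ζ) / 2) := div_pos pi_pos (by linarith)
    obtain ⟨a, ha, hle⟩ := conv_poisson_ge_of_even hd hd1 hout
      (fun y => cutOut_nonneg (hpos y).le) (cutOut_pos fun y _ => hpos y)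
    obtain ⟨C, -, hC⟩ := dressedLine_asymptotics (ζ := ζ) (q := q) hφ.continuous
      (momentumSource_asymptotics (π / 2 - ζ))
    rw [dressedLine_momentum_eq h0 h1 (by rwa [abs_of_pos hd]) hφ] at hC
    have := pos_of_profile_le ha hγ (gamma_lt_four h) hC (fun x hx =>
      (mul_le_mul_of_nonneg_left (profile_le_exp _ x) ha.le).trans (hle x hx))
    exact pos_of_mul_pos_right this (sin_pos_of_pos_of_lt_pi (by linarith) (by linarith)).le
  · have hcos : cos ζ < 0 := cos_neg_of_pi_div_two_lt_of_lt h (by linarith)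
    have hI : 0 ≤ ∫ t, exp (2 * t) * cutIn q φ t :=
      integral_nonneg fun t => mul_nonneg (exp_pos _).le (cutIn_nonneg (hpos t).le)
    have : 4 / π * cos ζ * (∫ t, exp (2 * t) * cutIn q φ t) ≤ 0 :=
      mul_nonpos_of_nonpos_of_nonneg
        (mul_nonpos_of_nonneg_of_nonpos (by positivity) hcos.le) hI
    unfold amplitude; linarith

lemma integral_exp_mul_cutIn_odd (hφ : Continuous φ) (hodd : ∀ x, φ (-x) = -φ x) :
    ∫ t, exp (2 * t) * cutIn q φ t = ∫ t, sinh (2 * t) * cutIn q φ t := by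
  have hi := integrable_mul_cutIn (q := q) (w := fun t => exp (2 * t)) hφ (by fun_prop)
  have h1 : ∫ t, exp (2 * t) * cutIn q φ t = ∫ t, -(exp (-(2 * t)) * cutIn q φ t) := by
    rw [← integral_neg_eq_self]
    congr 1; ext t
    rw [cutIn_odd hodd]; ring_nf
  have hi' := integrable_mul_cutIn (q := q) (w := fun t => -exp (-(2 * t))) hφ (by fun_prop)
  have h2 : ∫ t, sinh (2 * t) * cutIn q φ t = ∫ t, (1 / 2 * (exp (2 * t) * cutIn q φ t)
      + 1 / 2 * (-exp (-(2 * t)) * cutIn q φ t)) := by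
    congr 1; ext t; rw [sinh_eq]; ring
  rw [h2, integral_add (hi.const_mul _) (hi'.const_mul _), integral_const_mul, integral_const_mul]
  simp only [neg_mul]
  rw [← h1]; ring

lemma integral_exp_mul_cutIn_even (hφ : Continuous φ) (heven : ∀ x, φ (-x) = φ x) :
    ∫ t, exp (2 * t) * cutIn q φ t = ∫ t, cosh (2 * t) * cutIn q φ t := by
  have hi := integrable_mul_cutIn (q := q) (w := fun t => exp (2 * t)) hφ (by fun_prop)
  have h1 : ∫ t, exp (2 * t) * cutIn q φ t = ∫ t, exp (-(2 * t)) * cutIn q φ t := by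
    rw [← integral_neg_eq_self]
    congr 1; ext t
    rw [← cutIn_comp_neg]; simp only [heven]; ring_nf
  have hi' := integrable_mul_cutIn (q := q) (w := fun t => exp (-(2 * t))) hφ (by fun_prop)
  have h2 : ∫ t, cosh (2 * t) * cutIn q φ t = ∫ t, (1 / 2 * (exp (2 * t) * cutIn q φ t)
      + 1 / 2 * (exp (-(2 * t)) * cutIn q φ t)) := by
    congr 1; ext t; rw [cosh_eq]; ring
  rw [h2, integral_add (hi.const_mul _) (hi'.const_mul _), integral_const_mul, integral_const_mul,
    ← h1]; ring

theorem amplitude_energy_pos (h0 : 0 < ζ) (h1 : ζ < π) (hne : ζ ≠ π / 2) (hc : 0 < c) (hq : 0 ≤ q)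
    (hφ : IsDressed ζ q (energySource c ((π - ζ) / 2)) φ) (hodd : ∀ x, φ (-x) = -φ x) :
    0 < amplitude ζ q (4 * c / π) φ := by
  obtain ⟨a, γ, ha, hγ, hge⟩ := dressedEnergyDeriv_ge h0 h1 hne hc hφ hodd
  have hpos : ∀ x, 0 < x → 0 < φ x := fun x hx =>
    lt_of_lt_of_le (mul_pos ha (profile_pos hγ hx)) (hge x hx.le)
  have hi := hφ.integrable h0 h1 (energySource_integrable (abs_half_sub_lt h0 h1))
  have hout := cutOut_integrable q hi
  rcases lt_or_gt_of_ne hne with h | h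
  · have hd : 0 < π / 2 - ζ := by linarith
    have hd1 : π / 2 - ζ < (π - ζ) / 2 := by linarith
    have hγ : 0 < π / ((π - ζ) / 2) := div_pos pi_pos (by linarith)
    obtain ⟨a, ha, hle⟩ := conv_poisson_ge_of_odd hd hd1 hout (cutOut_odd hodd) hq
      (fun y hy => cutOut_nonneg (hpos y hy).le)
      (cutOut_pos fun y hy => hpos y (lt_of_le_of_lt hq hy))
    obtain ⟨C, -, hC⟩ := dressedLine_asymptotics (ζ := ζ) (q := q) hφ.continuous
      (energySource_asymptotics c (π / 2 - ζ))
    rw [dressedLine_energy_eq h0 h1 (by rwa [abs_of_pos hd]) hφ] at hC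
    have := pos_of_profile_le ha hγ (gamma_lt_four h) hC hle
    exact pos_of_mul_pos_right this (sin_pos_of_pos_of_lt_pi (by linarith) (by linarith)).le
  · have hcos : cos ζ < 0 := cos_neg_of_pi_div_two_lt_of_lt h (by linarith)
    have hI : 0 ≤ ∫ t, exp (2 * t) * cutIn q φ t := by
      rw [integral_exp_mul_cutIn_odd hφ.continuous hodd]
      refine integral_nonneg fun t => ?_
      rcases le_total 0 t with ht | ht
      · refine mul_nonneg (sinh_nonneg_iff.2 (by linarith)) (cutIn_nonneg ?_)
        exact (mul_nonneg ha.le (profile_nonneg hγ ht)).trans (hge t ht)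
      · have e : cutIn q φ t = -cutIn q φ (-t) := by rw [cutIn_odd hodd, neg_neg]
        have : 0 ≤ cutIn q φ (-t) := cutIn_nonneg
          ((mul_nonneg ha.le (profile_nonneg hγ (by linarith))).trans (hge (-t) (by linarith)))
        rw [e]
        exact mul_nonneg_of_nonpos_of_nonpos (sinh_nonpos_iff.2 (by linarith)) (by linarith)
    have : 4 / π * cos ζ * (∫ t, exp (2 * t) * cutIn q φ t) ≤ 0 :=
      mul_nonpos_of_nonpos_of_nonneg
        (mul_nonpos_of_nonneg_of_nonpos (by positivity) hcos.le) hI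
    have h4 : 0 < 4 * c / π := by positivity
    unfold amplitude; linarith

end Line

/-! ### Parity, smoothness and velocity thresholds -/

lemma hasDerivAt_conv_cutIn {k k' φ : ℝ → ℝ} {q : ℝ} (hk : ∀ x, HasDerivAt k (k' x) x)
    (hk' : Continuous k') (hφ : Continuous φ) (x : ℝ) :
    HasDerivAt (conv k (cutIn q φ)) (conv k' (cutIn q φ) x) x := by
  have hkc : Continuous k := continuous_iff_continuousAt.2 fun x => (hk x).continuousAt
  obtain ⟨C, hC⟩ := (isCompact_Icc (a := x - 1 - q) (b := x + 1 + q)).exists_bound_of_continuousOn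
    hk'.continuousOn
  have hin := cutIn_integrable q hφ
  have hi : ∀ y, Integrable fun t => k (y - t) * cutIn q φ t := fun y =>
    integrable_mul_cutIn (w := fun t => k (y - t)) hφ (by fun_prop)
  have hi' : ∀ y, Integrable fun t => k' (y - t) * cutIn q φ t := fun y =>
    integrable_mul_cutIn (w := fun t => k' (y - t)) hφ (by fun_prop)
  refine (hasDerivAt_integral_of_dominated_loc_of_deriv_le (bound := fun t => C * |cutIn q φ t|)
    (s := Metric.ball x 1) (Metric.ball_mem_nhds x one_pos)
    (Eventually.of_forall fun y => (hi y).aestronglyMeasurable) (hi x)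
    (F' := fun y t => k' (y - t) * cutIn q φ t) (hi' x).aestronglyMeasurable
    (Eventually.of_forall fun t y hy => ?_) (hin.abs.const_mul C)
    (Eventually.of_forall fun t y _ => ?_)).2
  · by_cases ht : t ∈ Set.Icc (-q) q
    · rw [norm_mul, Real.norm_eq_abs (cutIn q φ t)]
      refine mul_le_mul_of_nonneg_right (hC _ ?_) (abs_nonneg _)
      rw [Metric.mem_ball, Real.dist_eq, abs_lt] at hy
      constructor <;> linarith [ht.1, ht.2]
    · simp [cutIn, Set.indicator_of_notMem ht]
  · have h1 : HasDerivAt (fun y : ℝ => y - t) 1 y := (hasDerivAt_id y).sub_const t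
    have h2 := ((hk (y - t)).comp y h1).mul_const (cutIn q φ t)
    simpa using h2

lemma conv_cutIn_continuous {k φ : ℝ → ℝ} {q : ℝ} (hk : Continuous k) (hφ : Continuous φ) :
    Continuous (conv k (cutIn q φ)) := by
  have e : conv k (cutIn q φ) = fun x => ∫ t in Set.Icc (-q) q, k (x - t) * φ t := by
    ext x
    rw [conv, ← integral_indicator measurableSet_Icc]
    congr 1; ext t
    by_cases ht : t ∈ Set.Icc (-q) q
    · simp [cutIn, Set.indicator_of_mem ht]
    · simp [cutIn, Set.indicator_of_notMem ht]
  rw [e]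
  exact continuous_parametric_integral_of_continuous (by fun_prop) isCompact_Icc

lemma contDiff_conv_poisson {q D : ℝ} {φ : ℝ → ℝ} (hφ : Continuous φ) :
    ContDiff ℝ 1 (conv (poisson (π / 2) D) (cutIn q φ)) := by
  have h := hasDerivAt_conv_cutIn (q := q) (poisson_hasDerivAt (π / 2) D)
    (poissonDeriv_continuous _ _) hφ
  rw [contDiff_one_iff_deriv]
  refine ⟨fun x => (h x).differentiableAt, ?_⟩
  rw [show deriv (conv (poisson (π / 2) D) (cutIn q φ)) = conv (poissonDeriv (π / 2) D) (cutIn q φ)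
    from funext fun x => (h x).deriv]
  exact conv_cutIn_continuous (poissonDeriv_continuous _ _) hφ

lemma dressedLine_contDiff {ζ q D : ℝ} {S φ : ℝ → ℝ} (hS : ContDiff ℝ 1 S) (hφ : Continuous φ) :
    ContDiff ℝ 1 (dressedLine ζ q D S φ) :=
  hS.sub ((contDiff_conv_poisson hφ).add (contDiff_conv_poisson hφ))

lemma momentumSource_contDiff (D : ℝ) : ContDiff ℝ 1 (momentumSource D) :=
  contDiff_const.mul ((poisson_contDiff _ _).of_le le_top)

lemma energySource_contDiff (c D : ℝ) : ContDiff ℝ 1 (energySource c D) :=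
  (contDiff_const.mul ((poissonDeriv_contDiff _ _).of_le le_top)).neg

lemma dressedLine_even {ζ q D : ℝ} {φ : ℝ → ℝ} (heven : ∀ x, φ (-x) = φ x) (x : ℝ) :
    dressedLine ζ q D (momentumSource D) φ (-x) = dressedLine ζ q D (momentumSource D) φ x := by
  have h : ∀ y, cutIn q φ (-y) = cutIn q φ y := fun y => by
    rw [← cutIn_comp_neg]; simp only [heven]
  unfold dressedLine momentumSource
  rw [conv_neg_of_even (poisson_neg _ _) h, conv_neg_of_even (poisson_neg _ _) h, poisson_neg]

lemma dressedLine_odd {ζ q c D : ℝ} {φ : ℝ → ℝ} (hodd : ∀ x, φ (-x) = -φ x) (x : ℝ) :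
    dressedLine ζ q D (energySource c D) φ (-x) = -dressedLine ζ q D (energySource c D) φ x := by
  unfold dressedLine energySource
  rw [conv_neg_of_odd (poisson_neg _ _) (cutIn_odd hodd),
    conv_neg_of_odd (poisson_neg _ _) (cutIn_odd hodd), poissonDeriv_neg]
  ring

lemma tendsto_mul_exp_of_asymptotics {L : ℝ → ℝ} {A : ℝ}
    (h : ∃ C, 0 ≤ C ∧ ∀ x, 0 ≤ x → |L x - A * exp (-(2 * x))| ≤ C * exp (-(4 * x))) :
    Tendsto (fun x => L x * exp (2 * x)) atTop (𝓝 A) := by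
  obtain ⟨C, hC, h⟩ := h
  have h1 : Tendsto (fun x : ℝ => C * exp (-2 * x)) atTop (𝓝 (C * 0)) :=
    (tendsto_exp_atBot.comp (tendsto_id.const_mul_atTop_of_neg (by norm_num))).const_mul C
  rw [mul_zero] at h1
  rw [tendsto_iff_norm_sub_tendsto_zero]
  refine squeeze_zero' (Eventually.of_forall fun x => norm_nonneg _) ?_ h1
  filter_upwards [eventually_ge_atTop 0] with x hx
  have e1 : exp (-(2 * x)) * exp (2 * x) = 1 := by rw [← exp_add]; simp
  have e2 : exp (-(4 * x)) * exp (2 * x) = exp (-2 * x) := by rw [← exp_add]; congr 1; ring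
  have e : L x * exp (2 * x) - A = (L x - A * exp (-(2 * x))) * exp (2 * x) := by
    linear_combination A * e1
  rw [e, norm_mul, Real.norm_eq_abs, norm_of_nonneg (exp_pos _).le, ← e2, ← mul_assoc]
  exact mul_le_mul_of_nonneg_right (h x hx) (exp_pos _).le

/-- An odd `C¹` function with positive derivative at `0`, without further zeros, and with a nonzero
limit at infinity takes every small value exactly once. -/
lemma exists_unique_preimage {F : ℝ → ℝ} {L : ℝ} (hF : ContDiff ℝ 1 F)
    (hodd : ∀ x, F (-x) = -F x) (hd : 0 < deriv F 0) (hne : ∀ x, 0 < x → F x ≠ 0)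
    (hL : Tendsto F atTop (𝓝 L)) (hL0 : L ≠ 0) :
    ∃ m, 0 < m ∧ ∀ v, |v| < m → ∃! x, F x = v := by
  have hF0 : F 0 = 0 := by have := hodd 0; rw [neg_zero] at this; linarith
  have hdc : Continuous (deriv F) := hF.continuous_deriv le_rfl
  have hdF : Differentiable ℝ F := hF.differentiable one_ne_zero
  obtain ⟨δ, hδ, hball⟩ := Metric.eventually_nhds_iff.1 (hdc.continuousAt.eventually_const_lt hd)
  set r := δ / 2 with hr
  have hr0 : 0 < r := by positivity
  have hmono : StrictMonoOn F (Set.Icc (-r) r) := by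
    refine strictMonoOn_of_deriv_pos (convex_Icc _ _) hF.continuous.continuousOn fun x hx => ?_
    rw [interior_Icc] at hx
    apply hball
    rw [Real.dist_eq, sub_zero, abs_lt]
    constructor <;> linarith [hx.1, hx.2]
  have hrm : r ∈ Set.Icc (-r) r := ⟨by linarith, le_rfl⟩
  have h0m : (0 : ℝ) ∈ Set.Icc (-r) r := ⟨by linarith, hr0.le⟩
  have hFr : 0 < F r := by have := hmono h0m hrm hr0; rwa [hF0] at this
  -- away from the origin `|F|` is bounded below, by compactness and the limit at infinity
  have hfar : ∃ m, 0 < m ∧ ∀ x, r ≤ x → m ≤ |F x| := by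
    have h1 : ∀ᶠ x in atTop, |L| / 2 < |F x| :=
      hL.abs.eventually_const_lt (by have := abs_pos.2 hL0; linarith)
    obtain ⟨X, hX⟩ := eventually_atTop.1 h1
    obtain ⟨y, hy, hmin⟩ := (isCompact_Icc (a := r) (b := max r X)).exists_isMinOn
      ⟨r, le_rfl, le_max_left _ _⟩ (hF.continuous.abs.continuousOn)
    refine ⟨min (|F y|) (|L| / 2), lt_min (abs_pos.2 (hne y (by linarith [hy.1])))
      (by have := abs_pos.2 hL0; linarith), fun x hx => ?_⟩
    rcases le_total x (max r X) with h | h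
    · exact (min_le_left _ _).trans (hmin ⟨hx, h⟩)
    · exact (min_le_right _ _).trans (hX x ((le_max_right _ _).trans h)).le
  obtain ⟨m, hm, hfar⟩ := hfar
  refine ⟨min (F r) m, lt_min hFr hm, fun v hv => ?_⟩
  obtain ⟨hv1, hv2⟩ := abs_lt.1 (lt_of_lt_of_le hv (min_le_left _ _))
  have hnear : ∀ x, F x = v → x ∈ Set.Icc (-r) r := by
    intro x hx
    have h1 : |F x| < m := by rw [hx]; exact lt_of_lt_of_le hv (min_le_right _ _)
    by_contra hc
    rcases le_total r x with h | h
    · exact absurd (hfar x h) (not_le.2 h1)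
    · have h2 : r ≤ -x := by
        by_contra h3
        exact hc ⟨by linarith [not_le.1 h3], h⟩
      have := hfar (-x) h2
      rw [hodd, abs_neg] at this
      exact absurd this (not_le.2 h1)
  obtain ⟨x, hx, hxv⟩ := intermediate_value_Icc (by linarith : -r ≤ r) hF.continuous.continuousOn
    (show v ∈ Set.Icc (F (-r)) (F r) by rw [hodd]; exact ⟨hv1.le, hv2.le⟩)
  exact ⟨x, hxv, fun y hy => hmono.injOn (hnear y hy) hx (hy.trans hxv.symm)⟩

/-- Derivatives at `0` inherit a one-sided inequality of functions vanishing at `0`. -/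
lemma deriv_nonneg_of_right {G : ℝ → ℝ} {g : ℝ} (hG : HasDerivAt G g 0) (h0 : G 0 = 0)
    (h : ∀ x, 0 ≤ x → 0 ≤ G x) : 0 ≤ g := by
  have h1 := (hasDerivAt_iff_tendsto_slope.1 hG).mono_left
    (nhdsWithin_mono 0 (show Set.Ioi (0 : ℝ) ⊆ {0}ᶜ from fun x hx => ne_of_gt hx))
  refine ge_of_tendsto h1 ?_
  filter_upwards [self_mem_nhdsWithin] with x hx
  have hx' : (0 : ℝ) < x := hx
  rw [slope_def_field, h0, sub_zero, sub_zero]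
  exact div_nonneg (h x hx'.le) hx'.le

lemma profile_hasDerivAt_zero (γ : ℝ) : HasDerivAt (profile γ) γ 0 := by
  unfold profile
  have h1 : HasDerivAt (fun x : ℝ => γ * x) γ 0 := by
    simpa using (hasDerivAt_id (0 : ℝ)).const_mul γ
  have h2 := h1.sinh.mul ((h1.const_mul 2).neg.exp)
  refine h2.congr_deriv ?_
  simp

/-- The two velocity thresholds of a line on which `N` is the derivative of the dressed momentum
and `E` the derivative of the dressed energy. -/
theorem exists_thresholds {N E : ℝ → ℝ} {d s A B : ℝ} (hN : ContDiff ℝ 1 N) (hE : ContDiff ℝ 1 E)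
    (hNeven : ∀ x, N (-x) = N x) (hEodd : ∀ x, E (-x) = -E x) (hdN : ∀ x, 0 < d * N x)
    (hdE : ∃ a γ : ℝ, 0 < a ∧ 0 < γ ∧ ∀ x, 0 ≤ x → a * profile γ x ≤ d * E x)
    (hs : s ≠ 0) (hA : 0 < A) (hB : 0 < B)
    (hNa : ∃ C, 0 ≤ C ∧ ∀ x, 0 ≤ x → |N x - s * A * exp (-(2 * x))| ≤ C * exp (-(4 * x)))
    (hEa : ∃ C, 0 ≤ C ∧ ∀ x, 0 ≤ x → |E x - s * B * exp (-(2 * x))| ≤ C * exp (-(4 * x))) :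
    ∃ m M : ℝ, 0 < m ∧ (∀ v, |v| < m → ∃! x, E x = v * N x) ∧ ∀ x, |E x| ≤ M * |N x| := by
  have hN0 : ∀ x, N x ≠ 0 := fun x h => by have := hdN x; rw [h, mul_zero] at this; exact this.false
  have hE0 : E 0 = 0 := by have := hEodd 0; rw [neg_zero] at this; linarith
  have hd0 : d ≠ 0 := fun h => by have := hdN 0; rw [h, zero_mul] at this; exact this.false
  obtain ⟨a, γ, ha, hγ, hge⟩ := hdE
  set F : ℝ → ℝ := fun x => E x / N x with hF
  have hFc : ContDiff ℝ 1 F := hE.div hN hN0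
  have hFodd : ∀ x, F (-x) = -F x := fun x => by simp only [hF, hNeven, hEodd, neg_div]
  have hFpos : ∀ x, 0 < x → F x ≠ 0 := fun x hx => by
    have h1 : 0 < d * E x := lt_of_lt_of_le (mul_pos ha (profile_pos hγ hx)) (hge x hx.le)
    refine div_ne_zero (fun h => ?_) (hN0 x)
    rw [h, mul_zero] at h1; exact h1.false
  have hlim : Tendsto F atTop (𝓝 (B / A)) := by
    have h1 := (tendsto_mul_exp_of_asymptotics hEa).div (tendsto_mul_exp_of_asymptotics hNa)
      (mul_ne_zero hs hA.ne')
    rw [mul_div_mul_left _ _ hs] at h1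
    refine h1.congr fun x => ?_
    simp only [hF, Pi.div_apply]
    exact mul_div_mul_right _ _ (exp_pos _).ne'
  have hderiv : 0 < deriv F 0 := by
    have hEd := (hE.differentiable one_ne_zero 0).hasDerivAt
    have hNd := (hN.differentiable one_ne_zero 0).hasDerivAt
    have h1 := (hEd.div hNd (hN0 0)).deriv
    have h2 : deriv F 0 = (d * deriv E 0) * (d * N 0) / (d * N 0) ^ 2 := by
      rw [show deriv F 0 = _ from h1, hE0]
      have := hN0 0
      field_simp
      ring
    have h3 : 0 ≤ d * deriv E 0 - a * γ := by
      refine deriv_nonneg_of_right (G := fun x => d * E x - a * profile γ x)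
        ((hEd.const_mul d).sub ((profile_hasDerivAt_zero γ).const_mul a)) ?_ fun x hx => ?_
      · simp [hE0, profile]
      · linarith [hge x hx]
    rw [h2]
    have h4 := hdN 0
    have h5 : 0 < d * deriv E 0 := by have := mul_pos ha hγ; linarith
    positivity
  obtain ⟨m, hm, huniq⟩ := exists_unique_preimage hFc hFodd hderiv hFpos hlim
    (div_pos hB hA).ne'
  have hbdd : ∃ M, ∀ x, |F x| ≤ M := by
    have h1 : ∀ᶠ x in atTop, |F x| < |B / A| + 1 := hlim.abs.eventually_lt_const (by linarith)
    obtain ⟨X, hX⟩ := eventually_atTop.1 h1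
    obtain ⟨C, hC⟩ := (isCompact_Icc (a := -|X|) (b := |X|)).exists_bound_of_continuousOn
      hFc.continuous.continuousOn
    refine ⟨max C (|B / A| + 1), fun x => ?_⟩
    rcases le_total |x| |X| with h | h
    · exact (hC x (abs_le.1 h)).trans (le_max_left _ _)
    · have h2 : |F x| = |F (|x|)| := by
        rcases abs_choice x with h | h <;> rw [h]
        rw [hFodd, abs_neg]
      rw [h2]
      exact (hX _ ((le_abs_self X).trans h)).le.trans (le_max_right _ _)
  obtain ⟨M, hM⟩ := hbdd
  refine ⟨m, M, hm, fun v hv => ?_, fun x => ?_⟩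
  · have : ∀ x, F x = v ↔ E x = v * N x := fun x => div_eq_iff (hN0 x)
    simpa only [this] using huniq v hv
  · have := hM x
    rwa [hF, abs_div, div_le_iff₀ (abs_pos.2 (hN0 x))] at this

/-! ### The kernels and the dressed momentum on the lines `ℝ` and `ℝ + iπ/2` -/

lemma K_eq (η : ℝ) (z : ℂ) :
    K η z = Complex.sin (2 * η) / (π * (Complex.cosh (2 * z) - Complex.cos (2 * η))) := by
  have h : 2 * (Complex.sinh (z + Complex.I * η) * Complex.sinh (z - Complex.I * η))
      = Complex.cosh (2 * z) - Complex.cos (2 * η) := by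
    have e1 : Complex.cosh (2 * z) = Complex.cosh ((z + Complex.I * η) + (z - Complex.I * η)) := by
      congr 1; ring
    have e2 : Complex.cos (2 * η) = Complex.cosh ((z + Complex.I * η) - (z - Complex.I * η)) := by
      rw [← Complex.cosh_mul_I]; congr 1; ring
    rw [e1, e2, Complex.cosh_add (z + Complex.I * η) (z - Complex.I * η),
      Complex.cosh_sub (z + Complex.I * η) (z - Complex.I * η)]
    ring
  rw [K, ← h]; push_cast; ring_nf

/-- On the lines `ℝ` and `ℝ + iπ/2` the kernel `K` is a Poisson kernel. -/
lemma K_line (η x : ℝ) {σ : ℕ} (hσ : σ = 0 ∨ σ = 1) :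
    K η ((x : ℂ) + ((σ * π / 2 : ℝ) : ℂ) * Complex.I)
      = (poisson (π / 2) ((π - 2 * η + σ * π) / 2) x : ℂ) := by
  rw [K_eq, poisson_half_pi]
  rcases hσ with rfl | rfl
  · have e1 : 2 * ((π - 2 * η + ((0 : ℕ) : ℝ) * π) / 2) = π - 2 * η := by push_cast; ring
    rw [e1, sin_pi_sub, cos_pi_sub]
    push_cast
    simp [sub_eq_add_neg]
  · have e1 : 2 * ((π - 2 * η + ((1 : ℕ) : ℝ) * π) / 2) = 2 * π - 2 * η := by push_cast; ring
    have e2 : 2 * ((x : ℂ) + (((1 : ℕ) * π / 2 : ℝ) : ℂ) * Complex.I)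
        = 2 * x + π * Complex.I := by push_cast; ring
    rw [e1, e2, Complex.cosh_add_pi_mul_I, sin_two_pi_sub, cos_two_pi_sub]
    push_cast
    rw [neg_sub_left, mul_neg, div_neg, neg_div, add_comm (Complex.cosh _)]

lemma sinh_ne_zero_of_re {w : ℂ} (hw : w.re ≠ 0) : Complex.sinh w ≠ 0 := by
  intro h
  have h1 : Complex.sin (w * Complex.I) = 0 := by rw [Complex.sin_mul_I, h, zero_mul]
  obtain ⟨k, hk⟩ := Complex.sin_eq_zero_iff.1 h1
  have h2 := congrArg Complex.im hk
  simp at h2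
  exact hw h2

lemma K_differentiableAt (η : ℝ) {z : ℂ} (hz : z.re < 0) : DifferentiableAt ℂ (K η) z := by
  unfold K
  have h1 : Complex.sinh (z + Complex.I * η) ≠ 0 := sinh_ne_zero_of_re (by simp; exact hz.ne)
  have h2 : Complex.sinh (z - Complex.I * η) ≠ 0 := sinh_ne_zero_of_re (by simp; exact hz.ne)
  have h3 : (π : ℂ) ≠ 0 := by exact_mod_cast pi_ne_zero
  refine DifferentiableAt.div (by fun_prop) (by fun_prop) ?_
  simp [h1, h2, pi_ne_zero]

/-- On a horizontal line free of poles the bare phase is, up to a constant, a primitive of the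
kernel. The constant is the regularised integral along the imaginary axis, whose limit exists
because the contour may be pushed to the left. -/
lemma barePhase_line {g : ℂ → ℂ} {k₀ k : ℝ → ℝ} {y : ℝ}
    (hd : ∀ z : ℂ, z.re < 0 → DifferentiableAt ℂ g z) (hk₀c : Continuous k₀) (hkc : Continuous k)
    (hk₀ : ∀ s : ℝ, g s = k₀ s) (hk : ∀ s : ℝ, g (s + y * Complex.I) = k s) :
    ∃ c : ℂ, ∀ x : ℝ, barePhase g (x + y * Complex.I)
      = c + ((2 * π * ∫ s in (0 : ℝ)..x, k s : ℝ) : ℂ) := by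
  set c₀ : ℂ := Complex.I * (∫ t in (0 : ℝ)..y, g (((-1 : ℝ) : ℂ) + t * Complex.I))
    - ((∫ s in (-1 : ℝ)..0, k₀ s : ℝ) : ℂ) + ((∫ s in (-1 : ℝ)..0, k s : ℝ) : ℂ) with hc₀
  have hvert : ∀ δ : ℝ, 0 < δ → (∫ t in (0 : ℝ)..y, g (t * Complex.I - δ) * Complex.I)
      = Complex.I * (∫ t in (0 : ℝ)..y, g (((-1 : ℝ) : ℂ) + t * Complex.I))
        - ((∫ s in (-1 : ℝ)..(-δ), k₀ s : ℝ) : ℂ) + ((∫ s in (-1 : ℝ)..(-δ), k s : ℝ) : ℂ) := by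
    intro δ hδ
    have h := Complex.integral_boundary_rect_eq_zero_of_differentiableOn g
      (⟨-1, 0⟩ : ℂ) (⟨-δ, y⟩ : ℂ) (fun z hz => by
        refine (hd z ?_).differentiableWithinAt
        have h1 : z.re ≤ max (-1) (-δ) := (hz.1).2
        exact lt_of_le_of_lt h1 (max_lt (by norm_num) (by linarith)))
    simp only [smul_eq_mul, Complex.ofReal_zero, zero_mul, add_zero, hk₀, hk] at h
    rw [intervalIntegral.integral_ofReal, intervalIntegral.integral_ofReal] at h
    rw [intervalIntegral.integral_mul_const]
    have e : ∀ t : ℝ, g (t * Complex.I - δ) = g (((-δ : ℝ) : ℂ) + t * Complex.I) := fun t => by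
      congr 1; push_cast; ring
    simp only [e]
    linear_combination h
  have hprim : ∀ f : ℝ → ℝ, Continuous f → ∀ a : ℝ,
      Continuous fun b : ℝ => ((∫ s in a..b, f s : ℝ) : ℂ) := fun f hf a =>
    Complex.continuous_ofReal.comp
      (intervalIntegral.continuous_primitive (fun _ _ => hf.intervalIntegrable _ _) a)
  have hlim1 : Tendsto (fun δ : ℝ => ∫ t in (0 : ℝ)..y, g (t * Complex.I - δ) * Complex.I)
      (𝓝[>] 0) (𝓝 c₀) := by
    have h1 : Continuous fun δ : ℝ =>
        Complex.I * (∫ t in (0 : ℝ)..y, g (((-1 : ℝ) : ℂ) + t * Complex.I))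
        - ((∫ s in (-1 : ℝ)..(-δ), k₀ s : ℝ) : ℂ) + ((∫ s in (-1 : ℝ)..(-δ), k s : ℝ) : ℂ) :=
      (continuous_const.sub ((hprim k₀ hk₀c (-1)).comp continuous_neg)).add
        ((hprim k hkc (-1)).comp continuous_neg)
    have h2 := (h1.tendsto 0).mono_left (nhdsWithin_le_nhds (s := Set.Ioi 0))
    rw [neg_zero] at h2
    refine h2.congr' ?_
    filter_upwards [self_mem_nhdsWithin] with δ hδ
    exact (hvert δ hδ).symm
  refine ⟨2 * π * c₀, fun x => ?_⟩
  have hhor : ∀ δ : ℝ, (∫ s in (0 : ℝ)..x, g (s + y * Complex.I - δ))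
      = ((∫ s in (0 : ℝ)..(x - δ), k s : ℝ) : ℂ) - ((∫ s in (0 : ℝ)..(-δ), k s : ℝ) : ℂ) := by
    intro δ
    have e : ∀ s : ℝ, g (s + y * Complex.I - δ) = ((k (s - δ) : ℝ) : ℂ) := fun s => by
      rw [← hk]; congr 1; push_cast; ring
    simp only [e]
    rw [intervalIntegral.integral_ofReal, intervalIntegral.integral_comp_sub_right, zero_sub,
      ← Complex.ofReal_sub, intervalIntegral.integral_interval_sub_left
        (hkc.intervalIntegrable _ _) (hkc.intervalIntegrable _ _)]
  have hlim2 : Tendsto (fun δ : ℝ => ∫ s in (0 : ℝ)..x, g (s + y * Complex.I - δ))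
      (𝓝[>] 0) (𝓝 ((∫ s in (0 : ℝ)..x, k s : ℝ) : ℂ)) := by
    simp only [hhor]
    have h1 : Continuous fun δ : ℝ => ((∫ s in (0 : ℝ)..(x - δ), k s : ℝ) : ℂ)
        - ((∫ s in (0 : ℝ)..(-δ), k s : ℝ) : ℂ) :=
      ((hprim k hkc 0).comp (continuous_const.sub continuous_id)).sub
        ((hprim k hkc 0).comp continuous_neg)
    have h2 := (h1.tendsto 0).mono_left (nhdsWithin_le_nhds (s := Set.Ioi 0))
    simpa using h2
  have hre : ((x : ℂ) + y * Complex.I).re = x := by simp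
  have him : ((x : ℂ) + y * Complex.I).im = y := by simp
  rw [barePhase, hre, him, (hlim1.add hlim2).limUnder_eq]
  push_cast; ring

lemma intervalIntegral_eq_conv {q : ℝ} (hq : 0 < q) (k φ : ℝ → ℝ) (x : ℝ) :
    ∫ μ in (-q)..q, k (x - μ) * φ μ = conv k (cutIn q φ) x := by
  rw [intervalIntegral.integral_of_le (by linarith), ← integral_Icc_eq_integral_Ioc, conv,
    ← integral_indicator measurableSet_Icc]
  congr 1; ext t
  by_cases ht : t ∈ Set.Icc (-q) q
  · simp [cutIn, Set.indicator_of_mem ht]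
  · simp [cutIn, Set.indicator_of_notMem ht]

/-- The height of the line `ℝ + iσπ/2` for strings of length `r`. -/
noncomputable def height (ζ : ℝ) (r σ : ℕ) : ℝ := (π - r * ζ + σ * π) / 2

lemma K_line_string (ζ x : ℝ) (r : ℕ) {σ : ℕ} (hσ : σ = 0 ∨ σ = 1) :
    K ((r : ℝ) * ζ / 2) ((x : ℂ) + ((σ * π / 2 : ℝ) : ℂ) * Complex.I)
      = (poisson (π / 2) (height ζ r σ) x : ℂ) := by
  rw [K_line _ _ hσ, height]
  congr 2; ring

/-- The kernel `K_r` on the line `ℝ + iσπ/2`, for the height `D` of that line. -/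
noncomputable def stringKernel (ζ D x : ℝ) : ℝ :=
  poisson (π / 2) (D + ζ / 2) x + poisson (π / 2) (D - ζ / 2) x

lemma stringKernel_continuous (ζ D : ℝ) : Continuous (stringKernel ζ D) :=
  (poisson_continuous _ _).add (poisson_continuous _ _)

lemma Kstring_line (ζ x : ℝ) (r : ℕ) {σ : ℕ} (hσ : σ = 0 ∨ σ = 1) :
    Kstring ζ r ((x : ℂ) + ((σ * π / 2 : ℝ) : ℂ) * Complex.I)
      = (stringKernel ζ (height ζ r σ) x : ℂ) := by
  rw [Kstring, K_line _ _ hσ, K_line _ _ hσ, stringKernel, height, add_comm]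
  push_cast
  congr 3 <;> ring

lemma conv_stringKernel {ζ q D : ℝ} {φ : ℝ → ℝ} (hφ : Continuous φ) (x : ℝ) :
    conv (stringKernel ζ D) (cutIn q φ) x = conv (poisson (π / 2) (D + ζ / 2)) (cutIn q φ) x
      + conv (poisson (π / 2) (D - ζ / 2)) (cutIn q φ) x := by
  have h1 := integrable_mul_cutIn (q := q) (w := fun t => poisson (π / 2) (D + ζ / 2) (x - t)) hφ
    ((poisson_continuous _ _).comp (by fun_prop))
  have h2 := integrable_mul_cutIn (q := q) (w := fun t => poisson (π / 2) (D - ζ / 2) (x - t)) hφ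
    ((poisson_continuous _ _).comp (by fun_prop))
  simp only [conv]
  rw [← integral_add h1 h2]
  congr 1; ext t; rw [stringKernel]; ring

lemma stripRep_line (x : ℝ) {σ : ℕ} (hσ : σ = 0 ∨ σ = 1) :
    stripRep ((x : ℂ) + ((σ * π / 2 : ℝ) : ℂ) * Complex.I)
      = (x : ℂ) + ((σ * π / 2 : ℝ) : ℂ) * Complex.I := by
  have hre : ((x : ℂ) + ((σ * π / 2 : ℝ) : ℂ) * Complex.I).re = x := by simp
  have him : ((x : ℂ) + ((σ * π / 2 : ℝ) : ℂ) * Complex.I).im = σ * π / 2 := by simp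
  have hm : toIocMod pi_pos (-(π / 2)) (σ * π / 2) = σ * π / 2 := by
    rw [toIocMod_eq_self]
    rcases hσ with rfl | rfl
    · constructor <;> push_cast <;> linarith [pi_pos]
    · constructor <;> push_cast <;> linarith [pi_pos]
  apply Complex.ext
  · rw [stripRep, hre]
  · rw [stripRep, him]; exact hm

/-- On the lines `ℝ` and `ℝ + iπ/2` the derivative of the dressed momentum is a dressed quantity of
the real density `p₁'`. -/
lemma dressedMomentum_hasDerivAt {ζ q : ℝ} {p₁ : ℝ → ℝ} (hq : 0 < q) (hp : ContDiff ℝ 1 p₁)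
    (r : ℕ) {σ : ℕ} (hσ : σ = 0 ∨ σ = 1) (x : ℝ) :
    HasDerivAt (fun x : ℝ => dressedMomentum ζ q p₁ r
        ((x : ℂ) + ((σ * π / 2 : ℝ) : ℂ) * Complex.I))
      ((dressedLine ζ q (height ζ r σ) (momentumSource (height ζ r σ))
        (deriv p₁) x : ℝ) : ℂ) x := by
  have hpc : Continuous (deriv p₁) := hp.continuous_deriv le_rfl
  set D := height ζ r σ with hD
  set ω : ℝ := σ * π / 2 with hω
  obtain ⟨c₁, hc₁⟩ := barePhase_line (g := K ((r : ℝ) * ζ / 2)) (y := ω)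
    (k₀ := poisson (π / 2) (height ζ r 0)) (k := poisson (π / 2) D)
    (fun z hz => K_differentiableAt _ hz) (poisson_continuous _ _) (poisson_continuous _ _)
    (fun s => by simpa using K_line_string ζ s r (σ := 0) (Or.inl rfl))
    (fun s => K_line_string ζ s r hσ)
  obtain ⟨c₂, hc₂⟩ := barePhase_line (g := Kstring ζ r) (y := ω)
    (k₀ := stringKernel ζ (height ζ r 0)) (k := stringKernel ζ D)
    (fun z hz => (K_differentiableAt _ hz).add (K_differentiableAt _ hz))
    (stringKernel_continuous _ _) (stringKernel_continuous _ _)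
    (fun s => by simpa using Kstring_line ζ s r (σ := 0) (Or.inl rfl))
    (fun s => Kstring_line ζ s r hσ)
  set Φ : ℝ → ℝ := fun y => ∫ s in (0 : ℝ)..y, stringKernel ζ D s with hΦ
  have hΦd : ∀ y, HasDerivAt Φ (stringKernel ζ D y) y := fun y =>
    (stringKernel_continuous ζ D).integral_hasStrictDerivAt 0 y |>.hasDerivAt
  have hΦc : Continuous Φ := continuous_iff_continuousAt.2 fun y => (hΦd y).continuousAt
  -- the integers and the indicator functions in `p_r` contribute constants along the line
  have hform : ∃ C : ℂ, ∀ x : ℝ, dressedMomentum ζ q p₁ r ((x : ℂ) + (ω : ℂ) * Complex.I)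
      = C + ((2 * π * (∫ s in (0 : ℝ)..x, poisson (π / 2) D s)
        - conv Φ (cutIn q (deriv p₁)) x : ℝ) : ℂ) := by
    refine ⟨c₁ - (c₂ * ((∫ μ in (-q)..q, deriv p₁ μ : ℝ) : ℂ)) / (2 * π)
      + π * (ell ζ r : ℂ) - (p₁ q : ℂ) * (emm ζ r : ℂ)
      - 2 * (p₁ q : ℂ) * ∑ s ∈ ({1, -1} : Finset ℤ),
        (if s = -1 ∧ r = 1 then (0 : ℂ) else 1)
          * (Real.sign (1 - 2 / Real.pi * hatAngle (((r : ℝ) + s) / 2 * ζ)) : ℂ)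
          * (stripSet ζ r s).indicator (fun _ => (1 : ℂ)) ((ω : ℂ) * Complex.I), fun x => ?_⟩
    have hind : ∀ s : ℤ, (stripSet ζ r s).indicator (fun _ => (1 : ℂ)) ((x : ℂ) + ω * Complex.I)
        = (stripSet ζ r s).indicator (fun _ => (1 : ℂ)) ((ω : ℂ) * Complex.I) := by
      intro s
      have : ((x : ℂ) + ω * Complex.I) ∈ stripSet ζ r s ↔ (ω * Complex.I : ℂ) ∈ stripSet ζ r s := by
        simp [stripSet]
      by_cases h : (ω * Complex.I : ℂ) ∈ stripSet ζ r s
      · rw [Set.indicator_of_mem h, Set.indicator_of_mem (this.2 h)]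
      · rw [Set.indicator_of_notMem h, Set.indicator_of_notMem (mt this.1 h)]
    have hint : (∫ μ in (-q)..q, barePhase (Kstring ζ r) ((x : ℂ) + ω * Complex.I - μ)
          * ((deriv p₁ μ : ℝ) : ℂ))
        = c₂ * ((∫ μ in (-q)..q, deriv p₁ μ : ℝ) : ℂ)
          + ((2 * π * conv Φ (cutIn q (deriv p₁)) x : ℝ) : ℂ) := by
      have e : ∀ μ : ℝ, barePhase (Kstring ζ r) ((x : ℂ) + ω * Complex.I - μ)
          * ((deriv p₁ μ : ℝ) : ℂ)
          = c₂ * ((deriv p₁ μ : ℝ) : ℂ) + ((2 * π * (Φ (x - μ) * deriv p₁ μ) : ℝ) : ℂ) := by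
        intro μ
        have : (x : ℂ) + ω * Complex.I - μ = ((x - μ : ℝ) : ℂ) + ω * Complex.I := by
          push_cast; ring
        rw [this, hc₂]; push_cast; ring
      simp only [e]
      have i1 : Continuous fun μ : ℝ => c₂ * ((deriv p₁ μ : ℝ) : ℂ) := by fun_prop
      have i2 : Continuous fun μ : ℝ => ((2 * π * (Φ (x - μ) * deriv p₁ μ) : ℝ) : ℂ) := by
        fun_prop
      rw [intervalIntegral.integral_add (i1.intervalIntegrable _ _) (i2.intervalIntegrable _ _),
        intervalIntegral.integral_const_mul, intervalIntegral.integral_ofReal,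
        intervalIntegral.integral_ofReal, intervalIntegral.integral_const_mul,
        intervalIntegral_eq_conv hq]
    have hrep : stripRep ((x : ℂ) + ω * Complex.I) = (x : ℂ) + ω * Complex.I := stripRep_line x hσ
    rw [dressedMomentum, hrep, stripMomentum, hint, hc₁]
    simp only [hind]
    have hpi : (2 * π : ℂ) ≠ 0 := mul_ne_zero two_ne_zero (by exact_mod_cast pi_ne_zero)
    push_cast
    rw [add_div, mul_div_cancel_left₀ _ hpi]
    ring
  obtain ⟨C, hC⟩ := hform
  rw [funext hC]
  have h1 : HasDerivAt (fun x : ℝ => ∫ s in (0 : ℝ)..x, poisson (π / 2) D s)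
      (poisson (π / 2) D x) x :=
    (poisson_continuous _ _).integral_hasStrictDerivAt 0 x |>.hasDerivAt
  have h2 := hasDerivAt_conv_cutIn (q := q) hΦd (stringKernel_continuous ζ D) hpc x
  have h3 := ((h1.const_mul (2 * π)).sub h2).ofReal_comp.const_add C
  rw [conv_stringKernel hpc] at h3
  exact h3

/-! ### The dressed energy, admissible heights and the derivative of `u_r` -/

lemma K_real (η x : ℝ) : K η x = (poisson (π / 2) (π / 2 - η) x : ℂ) := by
  have h := K_line η x (σ := 0) (Or.inl rfl)
  rw [show (π - 2 * η + ((0 : ℕ) : ℝ) * π) / 2 = π / 2 - η by push_cast; ring] at h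
  rw [← h]; simp

section Energy

variable {ζ J h q : ℝ} {ε₁ : ℝ → ℝ}

lemma IsDressedEnergy.isDressed (hq : 0 < q) (hε : IsDressedEnergy ζ J h q ε₁) :
    IsDressed ζ q (fun x => h - 4 * π * J * sin ζ * poisson (π / 2) ((π - ζ) / 2) x) ε₁ := by
  refine ⟨hε.1, fun x => ?_⟩
  have hx := hε.2 x
  have e : ∀ μ : ℝ, K ζ ((x : ℂ) - μ) * (ε₁ μ : ℂ)
      = ((poisson (π / 2) (π / 2 - ζ) (x - μ) * ε₁ μ : ℝ) : ℂ) := fun μ => by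
    rw [← Complex.ofReal_sub, K_real]; push_cast; rfl
  simp only [e] at hx
  rw [intervalIntegral.integral_ofReal, intervalIntegral_eq_conv hq, K_real,
    show π / 2 - ζ / 2 = (π - ζ) / 2 by ring] at hx
  have hr : ε₁ x + conv (poisson (π / 2) (π / 2 - ζ)) (cutIn q ε₁) x
      = h - 4 * π * J * sin ζ * poisson (π / 2) ((π - ζ) / 2) x := by exact_mod_cast hx
  linarith

lemma conv_poissonDeriv_cutIn {D : ℝ} {φ : ℝ → ℝ} (hq : 0 < q) (hφ : ContDiff ℝ 1 φ)
    (h₁ : φ q = 0) (h₂ : φ (-q) = 0) (x : ℝ) :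
    conv (poissonDeriv (π / 2) D) (cutIn q φ) x
      = conv (poisson (π / 2) D) (cutIn q (deriv φ)) x := by
  have hu : ∀ t, HasDerivAt (fun t => poisson (π / 2) D (x - t))
      (-poissonDeriv (π / 2) D (x - t)) t := fun t => by
      have h := HasDerivAt.comp t (poisson_hasDerivAt (π / 2) D (x - t))
        ((hasDerivAt_id' t).const_sub x)
      rw [mul_neg_one] at h
      exact h
  have hv : ∀ t, HasDerivAt φ (deriv φ t) t := fun t =>
    (hφ.differentiable one_ne_zero t).hasDerivAt
  have hc : Continuous fun t => -poissonDeriv (π / 2) D (x - t) :=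
    ((poissonDeriv_continuous _ _).comp (by fun_prop)).neg
  have h := intervalIntegral.integral_mul_deriv_eq_deriv_mul (a := -q) (b := q)
    (fun t _ => hu t) (fun t _ => hv t) (hc.intervalIntegrable _ _)
    ((hφ.continuous_deriv le_rfl).intervalIntegrable _ _)
  rw [h₁, h₂] at h
  simp only [neg_mul, intervalIntegral.integral_neg] at h
  rw [intervalIntegral_eq_conv hq, intervalIntegral_eq_conv hq] at h
  linarith

lemma IsDressedEnergy.even (h0 : 0 < ζ) (h1 : ζ < π) (hq : 0 < q)
    (hε : IsDressedEnergy ζ J h q ε₁) (x : ℝ) : ε₁ (-x) = ε₁ x :=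
  (hε.isDressed hq).even h0 h1 (fun x => by rw [poisson_neg]) x

lemma IsDressedEnergy.contDiff (hq : 0 < q) (hε : IsDressedEnergy ζ J h q ε₁) :
    ContDiff ℝ 1 ε₁ := by
  rw [funext (hε.isDressed hq).eq]
  exact (contDiff_const.sub (contDiff_const.mul ((poisson_contDiff _ _).of_le le_top))).sub
    (contDiff_conv_poisson hε.1)

/-- Because `ε₁` vanishes at `±q`, its derivative solves the differentiated dressing equation
without boundary terms. -/
lemma IsDressedEnergy.deriv_isDressed (h0 : 0 < ζ) (h1 : ζ < π) (hq : 0 < q)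
    (hε : IsDressedEnergy ζ J h q ε₁) (hF : ε₁ q = 0) :
    IsDressed ζ q (energySource (4 * π * J * sin ζ) ((π - ζ) / 2)) (deriv ε₁) := by
  refine ⟨(hε.contDiff hq).continuous_deriv le_rfl, fun x => ?_⟩
  have hd := ((((poisson_hasDerivAt (π / 2) ((π - ζ) / 2) x).const_mul
    (4 * π * J * sin ζ)).const_sub h).sub (hasDerivAt_conv_cutIn (q := q)
      (poisson_hasDerivAt (π / 2) (π / 2 - ζ)) (poissonDeriv_continuous _ _)
        hε.1 x)).congr_of_eventuallyEq
      (Eventually.of_forall (hε.isDressed hq).eq)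
  rw [hd.deriv, conv_poissonDeriv_cutIn hq (hε.contDiff hq) hF
    ((hε.even h0 h1 hq q).trans hF), energySource]

lemma IsDressedEnergy.deriv_odd (h0 : 0 < ζ) (h1 : ζ < π) (hq : 0 < q)
    (hε : IsDressedEnergy ζ J h q ε₁) (x : ℝ) : deriv ε₁ (-x) = -deriv ε₁ x := by
  have e : (fun y => ε₁ (-y)) = ε₁ := funext (hε.even h0 h1 hq)
  have := deriv_comp_neg (f := ε₁) x
  rw [e] at this
  linarith

lemma dressedEnergy_line (hq : 0 < q) (r : ℕ) {σ : ℕ} (hσ : σ = 0 ∨ σ = 1) (x : ℝ) :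
    dressedEnergy ζ J h q ε₁ r ((x : ℂ) + ((σ * π / 2 : ℝ) : ℂ) * Complex.I)
      = ((r * h - 4 * π * J * sin ζ * poisson (π / 2) (height ζ r σ) x
        - conv (stringKernel ζ (height ζ r σ)) (cutIn q ε₁) x : ℝ) : ℂ) := by
  have e : ∀ μ : ℝ, Kstring ζ r ((x : ℂ) + ((σ * π / 2 : ℝ) : ℂ) * Complex.I - μ) * (ε₁ μ : ℂ)
      = ((stringKernel ζ (height ζ r σ) (x - μ) * ε₁ μ : ℝ) : ℂ) := fun μ => by
    rw [show (x : ℂ) + ((σ * π / 2 : ℝ) : ℂ) * Complex.I - μ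
      = ((x - μ : ℝ) : ℂ) + ((σ * π / 2 : ℝ) : ℂ) * Complex.I by push_cast; ring,
      Kstring_line _ _ _ hσ]
    push_cast; rfl
  rw [dressedEnergy, K_line_string ζ x r hσ]
  simp only [e]
  rw [intervalIntegral.integral_ofReal, intervalIntegral_eq_conv hq]
  push_cast; rfl

/-- On the lines `ℝ` and `ℝ + iπ/2` the derivative of the dressed energy is a dressed quantity of
the real function `ε₁'`. -/
lemma dressedEnergy_hasDerivAt (h0 : 0 < ζ) (h1 : ζ < π) (hq : 0 < q)
    (hε : IsDressedEnergy ζ J h q ε₁) (hF : ε₁ q = 0) (r : ℕ) {σ : ℕ} (hσ : σ = 0 ∨ σ = 1) (x : ℝ) :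
    HasDerivAt (fun x : ℝ => dressedEnergy ζ J h q ε₁ r
        ((x : ℂ) + ((σ * π / 2 : ℝ) : ℂ) * Complex.I))
      ((dressedLine ζ q (height ζ r σ) (energySource (4 * π * J * sin ζ) (height ζ r σ))
        (deriv ε₁) x : ℝ) : ℂ) x := by
  rw [funext fun x : ℝ => dressedEnergy_line hq r hσ x]
  refine HasDerivAt.ofReal_comp ?_
  rw [show conv (stringKernel ζ (height ζ r σ)) (cutIn q ε₁) = _ from
    funext (conv_stringKernel hε.1)]
  have hconv : ∀ D, HasDerivAt (conv (poisson (π / 2) D) (cutIn q ε₁))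
      (conv (poisson (π / 2) D) (cutIn q (deriv ε₁)) x) x := fun D => by
    rw [← conv_poissonDeriv_cutIn hq (hε.contDiff hq) hF ((hε.even h0 h1 hq q).trans hF)]
    exact hasDerivAt_conv_cutIn (poisson_hasDerivAt _ _) (poissonDeriv_continuous _ _) hε.1 x
  exact (((poisson_hasDerivAt (π / 2) (height ζ r σ) x).const_mul
    (4 * π * J * sin ζ)).const_sub (r * h)).sub ((hconv _).add (hconv _))

end Energy

section Momentum

variable {ζ q : ℝ} {p₁ : ℝ → ℝ}

lemma IsDressedMomentum.deriv_isDressed (hq : 0 < q) (hp : IsDressedMomentum ζ q p₁) :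
    IsDressed ζ q (momentumSource ((π - ζ) / 2)) (deriv p₁) := by
  refine ⟨hp.1.continuous_deriv le_rfl, fun x => ?_⟩
  have h1 := dressedMomentum_hasDerivAt (ζ := ζ) hq hp.1 1 (σ := 0) (Or.inl rfl) x
  rw [show (fun x : ℝ => dressedMomentum ζ q p₁ 1
      ((x : ℂ) + ((((0 : ℕ) : ℝ) * π / 2 : ℝ) : ℂ) * Complex.I)) = fun x : ℝ => (p₁ x : ℂ) from
    funext fun x => by rw [hp.2 x]; simp] at h1
  have h2 : HasDerivAt (fun x : ℝ => (p₁ x : ℂ)) ((deriv p₁ x : ℝ) : ℂ) x :=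
    (hp.1.differentiable one_ne_zero x).hasDerivAt.ofReal_comp
  rw [Complex.ofReal_injective (h2.unique h1),
    show height ζ 1 0 = (π - ζ) / 2 by simp [height], dressedLine]
  have h5 : conv (poisson (π / 2) ((π - ζ) / 2 + ζ / 2)) (cutIn q (deriv p₁)) x = 0 := by
    rw [show (π - ζ) / 2 + ζ / 2 = π / 2 by ring, conv_poisson_half_pi]
  rw [h5, zero_add, show (π - ζ) / 2 - ζ / 2 = π / 2 - ζ by ring]

lemma IsDressedMomentum.deriv_even (h0 : 0 < ζ) (h1 : ζ < π) (hq : 0 < q)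
    (hp : IsDressedMomentum ζ q p₁) (x : ℝ) : deriv p₁ (-x) = deriv p₁ x :=
  (hp.deriv_isDressed hq).even h0 h1 (fun x => by simp [momentumSource, poisson_neg]) x

end Momentum

section Heights

variable {ζ : ℝ}

lemma ne_int_mul_pi (hirr : Irrational (ζ / π)) {r : ℕ} (hr : r ≠ 0) (k : ℤ) :
    (r : ℝ) * ζ ≠ k * π := by
  intro h
  refine (hirr.natCast_mul hr).ne_int k ?_
  rw [← mul_div_assoc, h, mul_div_cancel_right₀ _ pi_ne_zero]

lemma ne_pi_div_two (hirr : Irrational (ζ / π)) : ζ ≠ π / 2 := fun h =>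
  ne_int_mul_pi hirr (r := 2) two_ne_zero 1 (by rw [h]; push_cast; ring)

lemma sin_two_height_ne_zero (hirr : Irrational (ζ / π)) {r : ℕ} (hr : r ≠ 0) (σ : ℕ) :
    sin (2 * height ζ r σ) ≠ 0 := by
  intro h
  obtain ⟨k, hk⟩ := sin_eq_zero_iff.1 h
  refine ne_int_mul_pi hirr hr (1 + σ - k) ?_
  rw [height] at hk; push_cast; linarith

/-- A line lying by `β/2 ∈ (0, π/2]` below the real axis in the height coordinate is admissible. -/
lemma isLineHeight_of_shift {D β : ℝ} (hD : D = (π - ζ - β) / 2) (hβ : 0 < β) (hβπ : β ≤ π)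
    (hne : D ≠ 0) : IsLineHeight ζ D := by
  refine ⟨hne, Or.inr ?_⟩
  rcases lt_or_ge (-((π - ζ) / 2)) D with h | h
  · exact Or.inl (abs_lt.2 ⟨h, by linarith⟩)
  · exact Or.inr ⟨by linarith, h⟩

lemma height_add_ne_zero (hirr : Irrational (ζ / π)) {r : ℕ} (hr : r ≠ 0) (σ : ℕ) (n : ℤ) :
    height ζ r σ + n * π ≠ 0 := by
  intro h
  have := sin_two_mul_add_int_mul_pi (height ζ r σ) n
  rw [h, mul_zero, sin_zero] at this
  exact sin_two_height_ne_zero hirr hr σ this.symm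

/-- The line `ℝ + iσπ/2` carrying the centres of a string has, modulo `π`, an admissible height:
`sin((r-1)ζ - σπ) > 0`. For `ζ < π/2` this holds because `σ` is the parity of `⌊(r-1)ζ/π⌋`; for
`ζ > π/2` it is the string inequality for `k = 1`. -/
lemma IsString.isLineHeight (hirr : Irrational (ζ / π)) {r σ : ℕ} (h : IsString ζ r σ) :
    (σ = 0 ∨ σ = 1) ∧ ∃ n : ℤ, IsLineHeight ζ (height ζ r σ + n * π) := by
  obtain ⟨hr, h⟩ := h
  have hr0 : r ≠ 0 := by omega
  -- it suffices to find `n` with `β = (r-1)ζ - σπ - 2πn ∈ (0, π)`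
  suffices hs : (σ = 0 ∨ σ = 1) ∧ ∃ n : ℤ, 0 < ((r : ℝ) - 1) * ζ - σ * π - 2 * π * n ∧
      ((r : ℝ) - 1) * ζ - σ * π - 2 * π * n < π by
    obtain ⟨hσ, n, hn1, hn2⟩ := hs
    refine ⟨hσ, n, isLineHeight_of_shift ?_ hn1 hn2.le (height_add_ne_zero hirr hr0 _ _)⟩
    rw [height]; ring
  rcases h with ⟨h0, -, hσ, -⟩ | ⟨hlo, h1, hσ, hk⟩
  · have hx : 0 ≤ ((r : ℝ) - 1) * ζ / π := by
      have : (2 : ℝ) ≤ r := by exact_mod_cast hr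
      have : 0 ≤ (r : ℝ) - 1 := by linarith
      positivity
    have hle := Nat.floor_le hx
    have hlt := Nat.lt_floor_add_one (((r : ℝ) - 1) * ζ / π)
    rw [← kappa] at hle hlt
    rw [le_div_iff₀ pi_pos] at hle
    rw [div_lt_iff₀ pi_pos] at hlt
    have hmod := Nat.mod_add_div (kappa ζ r) 2
    rw [← hσ] at hmod
    have hcast : (kappa ζ r : ℝ) = σ + 2 * ((kappa ζ r / 2 : ℕ) : ℝ) := by exact_mod_cast hmod.symm
    have hne := ne_int_mul_pi hirr (r := r - 1) (by omega) (kappa ζ r)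
    rw [Nat.cast_sub (by omega)] at hne
    push_cast at hne
    have hlt' := lt_of_le_of_ne hle hne.symm
    refine ⟨by omega, ((kappa ζ r / 2 : ℕ) : ℤ), ?_, ?_⟩
    · rw [Int.cast_natCast]; rw [hcast] at hlt'; linarith
    · rw [Int.cast_natCast]; rw [hcast] at hlt; linarith
  · refine ⟨hσ, ⌊(((r : ℝ) - 1) * ζ - σ * π) / (2 * π)⌋, ?_⟩
    have h0 : 0 < ζ := by linarith [pi_pos]
    have hk1 := hk 1 le_rfl (by omega)
    have hsin : 0 < sin (((r : ℝ) - 1) * ζ - σ * π) := by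
      rw [sin_sub_nat_mul_pi]
      have hz := sin_pos_of_pos_of_lt_pi h0 h1
      push_cast at hk1
      rw [one_mul, mul_right_comm] at hk1
      exact pos_of_mul_pos_left hk1 hz.le
    set y := ((r : ℝ) - 1) * ζ - σ * π with hy
    have h2π : 0 < 2 * π := by positivity
    have f1 := Int.floor_le (y / (2 * π))
    have f2 := Int.lt_floor_add_one (y / (2 * π))
    rw [le_div_iff₀ h2π] at f1
    rw [div_lt_iff₀ h2π] at f2
    set n := ⌊y / (2 * π)⌋ with hn
    have hsin' : 0 < sin (y - 2 * π * n) := by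
      rw [mul_comm, sin_sub_int_mul_two_pi]; exact hsin
    constructor
    · refine lt_of_le_of_ne (by linarith) fun h => ?_
      rw [← h, sin_zero] at hsin'; exact hsin'.false
    · by_contra hge
      have : sin (y - 2 * π * n) ≤ 0 := by
        rw [← sin_sub_two_pi]
        exact sin_nonpos_of_nonpos_of_neg_pi_le (by linarith) (by linarith)
      linarith

end Heights

section Velocity

variable {ζ J h q : ℝ} {ε₁ p₁ : ℝ → ℝ}

/-- `v_∞` is the ratio of the amplitudes of `ε₁'` and `p₁'`. -/
lemma vInfty_eq (h0 : 0 < ζ) (h1 : ζ < π) (hq : 0 < q) (hε : IsDressedEnergy ζ J h q ε₁)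
    (hp : IsDressedMomentum ζ q p₁) : vInfty ζ J q ε₁ p₁
      = amplitude ζ q (4 * (4 * π * J * sin ζ) / π) (deriv ε₁) / amplitude ζ q 4 (deriv p₁) := by
  have e : ∀ w φ : ℝ → ℝ, ∫ μ in (-q)..q, w μ * φ μ = ∫ t, w t * cutIn q φ t := by
    intro w φ
    have := intervalIntegral_eq_conv hq (fun t => w (-t)) φ 0
    simpa [conv] using this
  rw [vInfty, e, e, amplitude, amplitude, integral_exp_mul_cutIn_odd
    ((hε.contDiff hq).continuous_deriv le_rfl) (hε.deriv_odd h0 h1 hq),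
    integral_exp_mul_cutIn_even (hp.1.continuous_deriv le_rfl) (hp.deriv_even h0 h1 hq),
    ← mul_div_mul_left (4 * (4 * π * J * sin ζ) / π - _) _ (by positivity : π / 2 ≠ 0)]
  congr 1 <;> field_simp <;> ring

/-- Along the line `ℝ + iσπ/2` the derivative of `u_r` is `N - E / v` for real dressed quantities
`N`, `E`. -/
lemma uLine_hasDerivAt (h0 : 0 < ζ) (h1 : ζ < π) (hq : 0 < q)
    (hε : IsDressedEnergy ζ J h q ε₁) (hF : ε₁ q = 0) (hp : IsDressedMomentum ζ q p₁)
    (r : ℕ) {σ : ℕ} (hσ : σ = 0 ∨ σ = 1) (v x : ℝ) :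
    HasDerivAt (uLine ζ J h q ε₁ p₁ r σ v)
      ((dressedLine ζ q (height ζ r σ) (momentumSource (height ζ r σ)) (deriv p₁) x
        - dressedLine ζ q (height ζ r σ) (energySource (4 * π * J * sin ζ) (height ζ r σ))
          (deriv ε₁) x / v : ℝ) : ℂ) x := by
  have e : uLine ζ J h q ε₁ p₁ r σ v = fun x : ℝ =>
      dressedMomentum ζ q p₁ r ((x : ℂ) + ((σ * π / 2 : ℝ) : ℂ) * Complex.I)
      - dressedEnergy ζ J h q ε₁ r ((x : ℂ) + ((σ * π / 2 : ℝ) : ℂ) * Complex.I) / v := by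
    ext x
    have : (x : ℂ) + Complex.I * σ * π / 2 = (x : ℂ) + ((σ * π / 2 : ℝ) : ℂ) * Complex.I := by
      push_cast; ring
    rw [uLine, this, u]
  rw [e]
  have := (dressedMomentum_hasDerivAt (ζ := ζ) hq hp.1 r hσ x).sub
    ((dressedEnergy_hasDerivAt h0 h1 hq hε hF r hσ x).div_const (v : ℂ))
  exact this.congr_deriv (by push_cast; rfl)

/-- The velocity thresholds of the line `ℝ + iσπ/2`, whose height is `D` modulo `π`. Above the upper
one the derivative of `u_r` is real with the sign of `D`. -/
theorem uLine_thresholds (h0 : 0 < ζ) (h1 : ζ < π) (hirr : Irrational (ζ / π)) (hJ : 0 < J)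
    (hq : 0 < q) (hε : IsDressedEnergy ζ J h q ε₁) (hF : ε₁ q = 0) (hp : IsDressedMomentum ζ q p₁)
    {r : ℕ} (hr : r ≠ 0) {σ : ℕ} (hσ : σ = 0 ∨ σ = 1) {n : ℤ} {D : ℝ}
    (hn : height ζ r σ + n * π = D) (hD : IsLineHeight ζ D) : ∃ m M : ℝ, 0 < m ∧
      (∀ v : ℝ, M < |v| → ∀ x, 0 < D * (deriv (uLine ζ J h q ε₁ p₁ r σ v) x).re) ∧
      ∀ v : ℝ, v ≠ 0 → |v| < m → ∃! x : ℝ, deriv (uLine ζ J h q ε₁ p₁ r σ v) x = 0 := by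
  set c := 4 * π * J * sin ζ with hc
  have hc0 : 0 < c := by have := sin_pos_of_pos_of_lt_pi h0 h1; positivity
  have hne := ne_pi_div_two hirr
  have hpd := hp.deriv_isDressed hq
  have hed := hε.deriv_isDressed h0 h1 hq hF
  have hodd := hε.deriv_odd h0 h1 hq
  set N := dressedLine ζ q (height ζ r σ) (momentumSource (height ζ r σ)) (deriv p₁) with hN
  set E := dressedLine ζ q (height ζ r σ) (energySource c (height ζ r σ)) (deriv ε₁) with hE
  have hdN : ∀ x, 0 < D * N x := fun x => by
    have := dressedLine_momentum_sign h0 h1 hne hD hpd x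
    rwa [← hn, momentumSource_add_int_mul_pi, dressedLine_add_int_mul_pi, hn] at this
  have hdE := dressedLine_energy_sign h0 h1 hne hc0 hq.le hD hed hodd
  rw [← hn, energySource_add_int_mul_pi, dressedLine_add_int_mul_pi, hn] at hdE
  obtain ⟨m, M, hm, huniq, hM⟩ := exists_thresholds
    (dressedLine_contDiff (momentumSource_contDiff _) hpd.continuous)
    (dressedLine_contDiff (energySource_contDiff _ _) hed.continuous)
    (dressedLine_even (hp.deriv_even h0 h1 hq)) (dressedLine_odd hodd) hdN hdE
    (sin_two_height_ne_zero hirr hr σ) (amplitude_momentum_pos h0 h1 hne hpd)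
    (amplitude_energy_pos h0 h1 hne hc0 hq.le hed hodd)
    (dressedLine_asymptotics hpd.continuous (momentumSource_asymptotics _))
    (dressedLine_asymptotics hed.continuous (energySource_asymptotics _ _))
  have hderiv : ∀ v x, deriv (uLine ζ J h q ε₁ p₁ r σ v) x = ((N x - E x / v : ℝ) : ℂ) :=
    fun v x => (uLine_hasDerivAt h0 h1 hq hε hF hp r hσ v x).deriv
  refine ⟨m, max M 0, hm, fun v hv x => ?_, fun v hv0 hv => ?_⟩
  · have hMv : M < |v| := (le_max_left _ _).trans_lt hv
    have hv0 : 0 < |v| := (le_max_right _ _).trans_lt hv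
    have hDN : 0 < |D| * |N x| := by rw [← abs_mul]; exact abs_pos.2 (hdN x).ne'
    have hN0 : 0 < |N x| := pos_of_mul_pos_right hDN (abs_nonneg D)
    have h2 : |E x / v| < |N x| := by
      rw [abs_div, div_lt_iff₀ hv0]
      calc |E x| ≤ M * |N x| := hM x
        _ < |N x| * |v| := by rw [mul_comm]; gcongr
    rw [hderiv, Complex.ofReal_re, mul_sub, sub_pos]
    calc D * (E x / v) ≤ |D| * |E x / v| := by rw [← abs_mul]; exact le_abs_self _
      _ < |D| * |N x| := mul_lt_mul_of_pos_left h2 (pos_of_mul_pos_left hDN (abs_nonneg _))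
      _ = D * N x := by rw [← abs_mul, abs_of_pos (hdN x)]
  · have hiff : ∀ x, deriv (uLine ζ J h q ε₁ p₁ r σ v) x = 0 ↔ E x = v * N x := fun x => by
      rw [hderiv, Complex.ofReal_eq_zero, sub_eq_zero, eq_div_iff hv0, mul_comm (N x), eq_comm]
    simpa only [hiff] using huniq v hv

lemma vInfty_pos (h0 : 0 < ζ) (h1 : ζ < π) (hirr : Irrational (ζ / π)) (hJ : 0 < J)
    (hq : 0 < q) (hε : IsDressedEnergy ζ J h q ε₁) (hF : ε₁ q = 0)
    (hp : IsDressedMomentum ζ q p₁) : 0 < vInfty ζ J q ε₁ p₁ := by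
  have hc0 : 0 < 4 * π * J * sin ζ := by have := sin_pos_of_pos_of_lt_pi h0 h1; positivity
  have hne := ne_pi_div_two hirr
  rw [vInfty_eq h0 h1 hq hε hp]
  exact div_pos (amplitude_energy_pos h0 h1 hne hc0 hq.le (hε.deriv_isDressed h0 h1 hq hF)
    (hε.deriv_odd h0 h1 hq)) (amplitude_momentum_pos h0 h1 hne (hp.deriv_isDressed hq))

end Velocity

end XXZ

/-! ### The velocity thresholds of `u_r` -/

open Real XXZ in
theorem mainTheorem6 (ζ J h q : ℝ) (hζ₀ : 0 < ζ) (hζ₁ : ζ < Real.pi)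
    (hζ_irr : Irrational (ζ / Real.pi)) (hJ : 0 < J)
    (hh₀ : 0 < h) (hh₁ : h < 8 * J * Real.cos (ζ / 2) ^ 2)
    (ε₁ p₁ : ℝ → ℝ) (hq : 0 < q) (hε₁ : XXZ.IsDressedEnergy ζ J h q ε₁) (hFermi : ε₁ q = 0)
    (hp₁ : XXZ.IsDressedMomentum ζ q p₁) :
    -- particles and holes, `r = 1`
    (∃ vm vM : ℝ, 0 < vm ∧ vm < XXZ.vInfty ζ J q ε₁ p₁ ∧ XXZ.vInfty ζ J q ε₁ p₁ < vM ∧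
      (∀ v : ℝ, v ≠ 0 →
        Differentiable ℝ (XXZ.uLine ζ J h q ε₁ p₁ 1 0 v) ∧
        Differentiable ℝ (XXZ.uLine ζ J h q ε₁ p₁ 1 1 v) ∧
        ∀ x : ℝ, (deriv (XXZ.uLine ζ J h q ε₁ p₁ 1 0 v) x).im = 0 ∧
          (deriv (XXZ.uLine ζ J h q ε₁ p₁ 1 1 v) x).im = 0) ∧
      (∀ v : ℝ, vM < |v| → ∀ x : ℝ,
        0 < (deriv (XXZ.uLine ζ J h q ε₁ p₁ 1 0 v) x).re ∧
        0 < -(deriv (XXZ.uLine ζ J h q ε₁ p₁ 1 1 v) x).re) ∧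
      (∀ v : ℝ, v ≠ 0 → |v| < vm →
        (∃! x : ℝ, deriv (XXZ.uLine ζ J h q ε₁ p₁ 1 0 v) x = 0) ∧
        (∃! x : ℝ, deriv (XXZ.uLine ζ J h q ε₁ p₁ 1 1 v) x = 0))) ∧
    -- bound states, `r ≥ 2`, with their string parity `σ`
    (∀ r σ : ℕ, XXZ.IsString ζ r σ →
      ∃ vm vM : ℝ, 0 < vm ∧ vm < XXZ.vInfty ζ J q ε₁ p₁ ∧ XXZ.vInfty ζ J q ε₁ p₁ < vM ∧
        (∀ v : ℝ, v ≠ 0 → Differentiable ℝ (XXZ.uLine ζ J h q ε₁ p₁ r σ v)) ∧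
        (∀ v : ℝ, vM < |v| → ∀ x : ℝ,
          0 < ‖deriv (XXZ.uLine ζ J h q ε₁ p₁ r σ v) x‖) ∧
        (∀ v : ℝ, v ≠ 0 → |v| < vm →
          ∃! x : ℝ, deriv (XXZ.uLine ζ J h q ε₁ p₁ r σ v) x = 0)) := by
  have hv := vInfty_pos hζ₀ hζ₁ hζ_irr hJ hq hε₁ hFermi hp₁
  have hd := fun (r : ℕ) {σ : ℕ} (hσ : σ = 0 ∨ σ = 1) v x =>
    uLine_hasDerivAt hζ₀ hζ₁ hq hε₁ hFermi hp₁ r hσ v x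
  refine ⟨?_, fun r σ hrσ => ?_⟩
  -- the heights of `ℝ` and `ℝ + iπ/2` are `(π-ζ)/2` and, modulo `π`, `-ζ/2`
  · obtain ⟨m₀, M₀, hm₀, hM₀, hu₀⟩ := uLine_thresholds hζ₀ hζ₁ hζ_irr hJ hq hε₁ hFermi hp₁
      one_ne_zero (σ := 0) (n := 0) (Or.inl rfl) (D := (π - ζ) / 2) (by simp [height])
      ⟨by linarith, Or.inl rfl⟩
    obtain ⟨m₁, M₁, hm₁, hM₁, hu₁⟩ := uLine_thresholds hζ₀ hζ₁ hζ_irr hJ hq hε₁ hFermi hp₁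
      one_ne_zero (σ := 1) (n := -1) (Or.inr rfl) (D := -(ζ / 2))
      (by rw [height]; push_cast; ring)
      (isLineHeight_of_shift (β := π) (by ring) pi_pos le_rfl (by linarith))
    set V := vInfty ζ J q ε₁ p₁
    -- the terms `V / 2` and `V` make the two thresholds enclose `v_∞`
    refine ⟨min (min m₀ m₁) (V / 2), max (max M₀ M₁) V + 1, by positivity,
      (min_le_right _ _).trans_lt (by linarith), (le_max_right _ _).trans_lt (by linarith),
      fun v _ => ⟨fun x => (hd 1 (Or.inl rfl) v x).differentiableAt,
        fun x => (hd 1 (Or.inr rfl) v x).differentiableAt, fun x => ⟨?_, ?_⟩⟩,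
      fun v hM x => ⟨?_, ?_⟩, fun v hv0 hm => ⟨?_, ?_⟩⟩
    · rw [(hd 1 (Or.inl rfl) v x).deriv, Complex.ofReal_im]
    · rw [(hd 1 (Or.inr rfl) v x).deriv, Complex.ofReal_im]
    · have h1 : M₀ < |v| := by
        linarith [le_max_left M₀ M₁, le_max_left (max M₀ M₁) V]
      exact pos_of_mul_pos_right (hM₀ v h1 x) (by linarith)
    · have h1 : M₁ < |v| := by
        linarith [le_max_right M₀ M₁, le_max_left (max M₀ M₁) V]
      have h2 := hM₁ v h1 x
      rw [neg_mul, ← mul_neg] at h2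
      exact pos_of_mul_pos_right h2 (by linarith)
    · exact hu₀ v hv0 (hm.trans_le ((min_le_left _ _).trans (min_le_left _ _)))
    · exact hu₁ v hv0 (hm.trans_le ((min_le_left _ _).trans (min_le_right _ _)))
  · obtain ⟨hσ, n, hD⟩ := hrσ.isLineHeight hζ_irr
    have hr : r ≠ 0 := by have := hrσ.1; omega
    obtain ⟨m, M, hm, hM, hu⟩ := uLine_thresholds hζ₀ hζ₁ hζ_irr hJ hq hε₁ hFermi hp₁
      hr hσ rfl hD
    set V := vInfty ζ J q ε₁ p₁
    refine ⟨min m (V / 2), max M V + 1, by positivity,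
      (min_le_right _ _).trans_lt (by linarith), (le_max_right _ _).trans_lt (by linarith),
      fun v _ x => (hd r hσ v x).differentiableAt, fun v hMv x => ?_,
      fun v hv0 hmv => hu v hv0 (hmv.trans_le (min_le_left _ _))⟩
    have h1 := hM v (by linarith [le_max_left M V]) x
    refine norm_pos_iff.2 fun h0 => ?_
    rw [h0, Complex.zero_re, mul_zero] at h1
    exact h1.false
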